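/- **Setting.** Let $a^+,a^->0$, $\beta^+,\beta^-\ge 0$, $d^\pm(z)=a^\pm z^{\beta^\pm}$ for $z\ge 0$ (with $0^0=1$), and $\mathcal D=\{x\in\mathbb R^2: x_1\ge 0,\ -d^-(x_1)\le x_2\le d^+(x_1)\}$. Let $\mathcal D_B\subseteq\mathcal D$ be a set for which there is $B\in(0,\infty)$ such that every $x\in\mathcal D_B$ has distance at most $B$ from $\mathbb R^2\setminus\mathcal D$; put $\mathcal D_B^\pm=\{x\in\mathcal D_B:\pm x_2>0\}$. Let $\xi=(\xi_0,\xi_1,\dots)$ be a time-homogeneous Markov chain on a state space $S\subseteq\mathcal D$ started at a fixed point $x_0\in S$; write $S_B=S\cap\mathcal D_B$, $S_I=S\setminus\mathcal D_B$, $S_B^\pm=S\cap\mathcal D_B^\pm$, $\mathbb P_x,\mathbb E_x$ for the law and expectation when $\xi_0=x$, and $\Delta=\xi_1-\xi_0$. Let $n^+(x_1)$ and $n^-(x_1)$ be the unit vectors in the directions $(a^+\beta^+x_1^{\beta^+-1},-1)$ and $(a^-\beta^-x_1^{\beta^--1},1)$; let $n^+(x_1,\theta)$ be $n^+(x_1)$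 rotated anticlockwise by $\theta$ and $n^-(x_1,\theta)$ be $n^-(x_1)$ rotated clockwise by $\theta$. Let $|\alpha|<\pi/2$, $\alpha^+=\alpha$, $\alpha^-=-\alpha$. **Assumptions.** (N) $\mathbb P_x(\limsup_n\|\xi_n\|=\infty)=1$ for all $x\in S$. (M$_p$) There is $p>2$ with $\sup_{x\in S}\mathbb E_x\|\Delta\|^p<\infty$. (D) $\sup_{x\in S_I:\|x\|\ge r}\|\mathbb E_x\Delta\|=o(r^{-1})$ as $r\to\infty$. (R) There are functions $\mu^\pm:S_B^\pm\to\mathbb R$ with $\liminf_{\|x\|\to\infty}\mu^\pm(x)>0$ and $\sup_{x\in S_B^\pm:\|x\|\ge r}\|\mathbb E_x\Delta-\mu^\pm(x)\,n^\pm(x_1,\alpha^\pm)\|=O(r^{-1})$ as $r\to\infty$. (C) There is a symmetric positive-definite matrix $\Sigma=\begin{pmatrix}\sigma_1^2&\rho\\ \rho&\sigma_2^2\end{pmatrix}$ with $\sup_{x\in S_I:\|x\|\ge r}\|\mathbb E_x(\Delta\Delta^{\top})-\Sigma\|_{\mathrm{op}}\to0$ as $r\to\infty$. (D$_+$) and (C$_+$)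 are (D) and (C) with the bounds $O(r^{-1-\varepsilon})$ and $O(r^{-\varepsilon})$, respectively, for some $\varepsilon>0$ (and the same $\Sigma$). Let $$\beta_{\mathrm c}=\beta_{\mathrm c}(\Sigma,\alpha)=\frac{\sigma_1^2}{\sigma_2^2}+\frac{\sigma_2^2-\sigma_1^2}{\sigma_2^2}\sin^2\alpha+\frac{\rho}{\sigma_2^2}\sin2\alpha .$$ Call $\xi$ *recurrent* if there is $r_0\in[0,\infty)$ with $\liminf_n\|\xi_n\|\le r_0$ a.s., and *transient* if $\|\xi_n\|\to\infty$ a.s. **Theorem.** Suppose that (N), (M$_p$), (D), (R) and (C) hold. (a) Suppose that $\beta^+,\beta^-\in[0,1)$ and let $\beta=\max(\beta^+,\beta^-)$. If $\beta^+=0$ or $\beta^-=0$, suppose also that, outside a bounded set, every $x\in S_B$ has either $x_2>0$ and $d^+(x_1)-x_2\le K$, or $x_2<0$ and $d^-(x_1)+x_2\le K$, for some constant $K$. Then: (i) if $0<\beta<\beta_{\mathrm c}$, then $\xi$ is recurrent; (ii) if $\beta>\beta_{\mathrm c}$, then $\xi$ is transient; (iii) if, in addition, (D$_+$) and (C$_+$)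 hold and $\beta=\beta_{\mathrm c}$, then $\xi$ is recurrent. (b) If (D$_+$) and (C$_+$) hold and $\beta^+,\beta^->1$, then $\xi$ is recurrent. -/

import Mathlib

open MeasureTheory ProbabilityTheory Filter Topology
open scoped ENNReal

noncomputable section

namespace CurvilinearWedge

/-- The plane `ℝ²` with its Euclidean norm; `x 0` and `x 1` are the Cartesian coordinates written
`x₁` and `x₂` in the comments. -/
abbrev Plane : Type := EuclideanSpace ℝ (Fin 2)

/-! ### The domain -/

/-- The boundary function `d(z) = a z^β`. -/
def bdry (a β z : ℝ) : ℝ := a * z ^ β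

/-- The domain `𝒟 = {x : x₁ ≥ 0, -a⁻ x₁^{β⁻} ≤ x₂ ≤ a⁺ x₁^{β⁺}}`. -/
def domain (ap am βp βm : ℝ) : Set Plane :=
  {x | 0 ≤ x 0 ∧ -bdry am βm (x 0) ≤ x 1 ∧ x 1 ≤ bdry ap βp (x 0)}

/-- `DB` is an admissible choice of the "boundary" `𝒟_B`: a subset of the domain `D`, all of whose
points are within a fixed finite distance of the complement of `D`. -/
def IsBoundaryPart (D DB : Set Plane) : Prop :=
  DB ⊆ D ∧ ∃ B : ℝ, 0 < B ∧ ∀ x ∈ DB, Metric.infDist x Dᶜ ≤ B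

/-- The part of `DB` in the open upper half-plane. -/
def upperPart (DB : Set Plane) : Set Plane := {x ∈ DB | 0 < x 1}

/-- The part of `DB` in the open lower half-plane. -/
def lowerPart (DB : Set Plane) : Set Plane := {x ∈ DB | x 1 < 0}

/-- Outside a bounded set, each point of `S ∩ 𝒟_B` lies off the horizontal axis and within bounded
vertical distance of the boundary curve in its own half-plane: `x₂ = ± d^±(x₁) + O(1)`. -/
def BoundaryNearCurves (ap am βp βm : ℝ) (S DB : Set Plane) : Prop :=
  ∃ K : ℝ, ∀ x ∈ S ∩ DB, K ≤ ‖x‖ →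
    (0 < x 1 ∧ bdry ap βp (x 0) - x 1 ≤ K) ∨ (x 1 < 0 ∧ bdry am βm (x 0) + x 1 ≤ K)

/-! ### Reflection vectors -/

/-- Rotation of the plane by the angle `φ`, anticlockwise. -/
def rotate (φ : ℝ) (v : Plane) : Plane :=
  !₂[Real.cos φ * v 0 - Real.sin φ * v 1, Real.sin φ * v 0 + Real.cos φ * v 1]

/-- The vector `(a β z^{β-1}, -1)`, an inwards normal to the upper curve at `(z, d⁺(z))`. -/
def normalUpper (a β z : ℝ) : Plane := !₂[a * β * z ^ (β - 1), -1]

/-- The vector `(a β z^{β-1}, 1)`, an inwards normal to the lower curve at `(z, -d⁻(z))`. -/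
def normalLower (a β z : ℝ) : Plane := !₂[a * β * z ^ (β - 1), 1]

/-- `n⁺(z, α)`: the inwards unit normal to the upper curve, rotated by `α` anticlockwise. -/
def reflUpper (a β z α : ℝ) : Plane :=
  rotate α (‖normalUpper a β z‖⁻¹ • normalUpper a β z)

/-- `n⁻(z, α)`: the inwards unit normal to the lower curve, rotated by `α` clockwise. -/
def reflLower (a β z α : ℝ) : Plane :=
  rotate (-α) (‖normalLower a β z‖⁻¹ • normalLower a β z)

/-! ### The Markov chain -/

/-- The law `ℙ_x` of the trajectory `(ξ₀, ξ₁, …)` of the time-homogeneous Markov chain on `S` with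
one-step transition kernel `κ`, started at `ξ₀ = x`. -/
def pathLaw {S : Set Plane} (κ : Kernel S S) [IsMarkovKernel κ] (x : S) : Measure (ℕ → S) :=
  Kernel.traj (X := fun _ : ℕ => S)
    (fun n => κ.comap (fun h : ((i : Finset.Iic n) → S) => h ⟨n, Finset.mem_Iic.2 le_rfl⟩)
      (measurable_pi_apply _)) 0 (fun _ => x)

/-- The chain started at `x` is recurrent: for some finite `r₀`, almost surely
`liminf ‖ξ_n‖ ≤ r₀`. -/
def Recurrent {S : Set Plane} (κ : Kernel S S) [IsMarkovKernel κ] (x : S) : Prop :=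
  ∃ r₀ : ℝ, 0 ≤ r₀ ∧ ∀ᵐ ξ ∂(pathLaw κ x),
    liminf (fun n => ‖(ξ n : Plane)‖ₑ) atTop ≤ ENNReal.ofReal r₀

/-- The chain started at `x` is transient: almost surely `‖ξ_n‖ → ∞`. -/
def Transient {S : Set Plane} (κ : Kernel S S) [IsMarkovKernel κ] (x : S) : Prop :=
  ∀ᵐ ξ ∂(pathLaw κ x), Tendsto (fun n => ‖(ξ n : Plane)‖) atTop atTop

/-- `𝔼_x Δ`, the mean of the increment `Δ = ξ₁ - ξ₀` from the state `x`. -/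
def meanIncrement {S : Set Plane} (κ : Kernel S S) (x : S) : Plane :=
  ∫ y, ((y : Plane) - (x : Plane)) ∂(κ x)

/-- `𝔼_x (Δ Δᵀ)`, the matrix of second moments of the increment from the state `x`. -/
def secondMoment {S : Set Plane} (κ : Kernel S S) (x : S) : Matrix (Fin 2) (Fin 2) ℝ :=
  Matrix.of fun i j => ∫ y, ((y : Plane) - (x : Plane)) i * ((y : Plane) - (x : Plane)) j ∂(κ x)

/-- The operator norm of a `2 × 2` matrix with respect to the Euclidean norm. -/
def matOpNorm (A : Matrix (Fin 2) (Fin 2) ℝ) : ℝ :=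
  ‖Matrix.toEuclideanCLM (n := Fin 2) (𝕜 := ℝ) A‖

/-! ### The assumptions -/

/-- (N): from every starting point, `limsup ‖ξ_n‖ = ∞` almost surely. -/
def NonConfinement {S : Set Plane} (κ : Kernel S S) [IsMarkovKernel κ] : Prop :=
  ∀ x : S, ∀ᵐ ξ ∂(pathLaw κ x), limsup (fun n => ‖(ξ n : Plane)‖ₑ) atTop = ∞

/-- (M_p): for some `p > 2`, the `p`-th moments of the increments are bounded uniformly over the
state space. -/
def BoundedMoments {S : Set Plane} (κ : Kernel S S) : Prop :=
  ∃ p : ℝ, 2 < p ∧ ∃ C : ℝ, ∀ x : S,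
    ∫⁻ y, ‖(y : Plane) - (x : Plane)‖ₑ ^ p ∂(κ x) ≤ ENNReal.ofReal C

/-- (D): `sup {‖𝔼_x Δ‖ : x ∈ S_I, ‖x‖ ≥ r} = o(r⁻¹)` as `r → ∞`. -/
def ZeroDrift {S : Set Plane} (κ : Kernel S S) (DB : Set Plane) : Prop :=
  ∀ δ : ℝ, 0 < δ → ∃ R : ℝ, 0 < R ∧ ∀ r : ℝ, R ≤ r →
    ∀ x : S, (x : Plane) ∉ DB → r ≤ ‖(x : Plane)‖ → ‖meanIncrement κ x‖ ≤ δ * r⁻¹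

/-- (D₊): for some `ε > 0`, `sup {‖𝔼_x Δ‖ : x ∈ S_I, ‖x‖ ≥ r} = O(r^{-1-ε})` as `r → ∞`. -/
def ZeroDriftPlus {S : Set Plane} (κ : Kernel S S) (DB : Set Plane) : Prop :=
  ∃ ε : ℝ, 0 < ε ∧ ∃ C R : ℝ, 0 < R ∧ ∀ r : ℝ, R ≤ r →
    ∀ x : S, (x : Plane) ∉ DB → r ≤ ‖(x : Plane)‖ → ‖meanIncrement κ x‖ ≤ C * r ^ (-1 - ε)

/-- (R) on the upper boundary part, with reflection angle `α`: there is a function `μ` with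
`liminf μ(x) > 0` as `‖x‖ → ∞`, and
`sup {‖𝔼_x Δ - μ(x) n⁺(x₁, α)‖ : x ∈ S_B⁺, ‖x‖ ≥ r} = O(r⁻¹)`. -/
def ReflectionUpper {S : Set Plane} (κ : Kernel S S) (DB : Set Plane) (a β α : ℝ) : Prop :=
  ∃ μ : S → ℝ,
    (∃ c R : ℝ, 0 < c ∧
      ∀ x : S, (x : Plane) ∈ upperPart DB → R ≤ ‖(x : Plane)‖ → c ≤ μ x) ∧
    ∃ C R : ℝ, 0 < R ∧ ∀ r : ℝ, R ≤ r →
      ∀ x : S, (x : Plane) ∈ upperPart DB → r ≤ ‖(x : Plane)‖ →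
        ‖meanIncrement κ x - μ x • reflUpper a β ((x : Plane) 0) α‖ ≤ C * r⁻¹

/-- (R) on the lower boundary part, with reflection angle `α`. -/
def ReflectionLower {S : Set Plane} (κ : Kernel S S) (DB : Set Plane) (a β α : ℝ) : Prop :=
  ∃ μ : S → ℝ,
    (∃ c R : ℝ, 0 < c ∧
      ∀ x : S, (x : Plane) ∈ lowerPart DB → R ≤ ‖(x : Plane)‖ → c ≤ μ x) ∧
    ∃ C R : ℝ, 0 < R ∧ ∀ r : ℝ, R ≤ r →
      ∀ x : S, (x : Plane) ∈ lowerPart DB → r ≤ ‖(x : Plane)‖ →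
        ‖meanIncrement κ x - μ x • reflLower a β ((x : Plane) 0) α‖ ≤ C * r⁻¹

/-- (C) with limit matrix `Cov`:
`sup {‖𝔼_x (Δ Δᵀ) - Cov‖_op : x ∈ S_I, ‖x‖ ≥ r} → 0` as `r → ∞`. -/
def CovarianceLimit {S : Set Plane} (κ : Kernel S S) (DB : Set Plane)
    (Cov : Matrix (Fin 2) (Fin 2) ℝ) : Prop :=
  ∀ δ : ℝ, 0 < δ → ∃ R : ℝ, ∀ x : S, (x : Plane) ∉ DB → R ≤ ‖(x : Plane)‖ →
    matOpNorm (secondMoment κ x - Cov) ≤ δ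

/-- (C₊) with limit matrix `Cov`: for some `ε > 0`,
`sup {‖𝔼_x (Δ Δᵀ) - Cov‖_op : x ∈ S_I, ‖x‖ ≥ r} = O(r^{-ε})` as `r → ∞`. -/
def CovarianceLimitPlus {S : Set Plane} (κ : Kernel S S) (DB : Set Plane)
    (Cov : Matrix (Fin 2) (Fin 2) ℝ) : Prop :=
  ∃ ε : ℝ, 0 < ε ∧ ∃ C R : ℝ, 0 < R ∧ ∀ r : ℝ, R ≤ r →
    ∀ x : S, (x : Plane) ∉ DB → r ≤ ‖(x : Plane)‖ →
      matOpNorm (secondMoment κ x - Cov) ≤ C * r ^ (-ε)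

/-- The critical exponent
`β_c = σ₁²/σ₂² + ((σ₂² - σ₁²)/σ₂²) sin² α + (ρ/σ₂²) sin 2α`, where `σ₁²`, `σ₂²` are the diagonal
entries of `Cov` and `ρ` is the off-diagonal entry. -/
def betaC (Cov : Matrix (Fin 2) (Fin 2) ℝ) (α : ℝ) : ℝ :=
  Cov 0 0 / Cov 1 1 + (Cov 1 1 - Cov 0 0) / Cov 1 1 * Real.sin α ^ 2
    + Cov 0 1 / Cov 1 1 * Real.sin (2 * α)

end CurvilinearWedge

end

/-! Each regime is settled by a Lyapunov function `f` of the position that is superharmonic for the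
chain outside a ball. With (N), `recurrent_of_superharmonic` gives recurrence when `f → ∞`, and
`transient_of_superharmonic` gives transience when `f` tends to `0` but is bounded below by a
positive constant on each ball. Both rest on the maximal inequality `measure_exit_le`.
Superharmonicity comes from second-order expansions whose remainder is integrated against a `q`-th
moment, `2 < q ≤ 3`. In the interior the Hessian paired with `Σ` decides the sign. At the boundary
second moments are merely bounded, so the gradient along the reflection vector must be negative by
more than the second-order terms.

Sublinear curves. Put `ℓ = x₁ cos α + x₂ sin α`. Because `α⁻ = -α`, both reflection vectors are
normals rotated by the same angle, and the inner product of `∇ℓ` with the unnormalised vector is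
just the slope `a b x₁^(b-1)`. Thus `log ℓ` has boundary drift proportional to `a b x₁^(b-2) / cos
α`. Adding `A₀ x₂² / x₁²` contributes `-2 cos α · a x₁^b · A₀ x₁^(-2)`, so `A₀ = β / (2 cos² α)`
cancels the drift on a curve of exponent `β`. In the interior the two terms leave `-(β_c - β) σ₂² /
(2 cos² α) · x₁^(-2)`, since the quadratic form of `Σ` in the direction `(cos α, sin α)` is `β_c
σ₂²` (`betaC_mul`); this is where the threshold comes from. Subtracting `ℓ^(-δ)`, with a transverse
term of its own, makes the boundary drift strictly negative and also settles `β = β_c`, by a gain of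
order `x₁^(-2-δ)` that beats the errors in (D₊) and (C₊). For transience `ℓ^(-γ)` replaces the
logarithm, with a transverse coefficient built from some `k` strictly between `β_c` and `β`. When
the exponents of the curves differ, a small term `B x₂ x₁^(e-2+s)` supplies the missing negative
drift on the flatter curve. The template is `Potential`;
`Potential.Admissible.superharmonic_outside_ball` reduces superharmonicity to three one-variable
inequalities.

Superlinear curves. Seen from far away the domain is a half-plane whose boundary hugs the vertical
axis, and both reflection directions tend to `(cos α, sin α)`. A linear map to `ℂ`
(`exists_isotropic`) makes the covariance isotropic and preserves the right half-plane; let `v` be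
the image of that direction. The function is `Re (v⁻¹ (log ζ - ζ^(-w))) - |ζ|^(-δ)`. Its first part
is harmonic. Along `v`, the logarithm has derivative `Re (1/ζ)`, tiny near the imaginary axis, while
`-ζ^(-w)` contributes `w Re ζ^(-w-1)`, which is negative there (`logPot_boundary_drift`). The last
term is strictly superharmonic and absorbs the interior errors (`logPot_interior_drift`). Since `Re
v⁻¹ > 0`, the function tends to infinity, and the chain is recurrent. -/

noncomputable section

namespace CurvilinearWedge

/-! ### Markov property, maximal inequality and Lyapunov criteria on path space -/

section

variable {S : Set Plane} (κ : Kernel S S) [IsMarkovKernel κ]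

/-- Events determined by the trajectory up to time `n`. -/
abbrev past (S : Set Plane) (n : ℕ) : MeasurableSpace (ℕ → S) :=
  Filtration.piLE (X := fun _ : ℕ => S) n

instance (x : S) : IsProbabilityMeasure (pathLaw κ x) := by
  unfold pathLaw; infer_instance

lemma past_mono {n m : ℕ} (h : n ≤ m) : past S n ≤ past S m :=
  (Filtration.piLE (X := fun _ : ℕ => S)).mono h

lemma past_le (n : ℕ) : past S n ≤ (inferInstance : MeasurableSpace (ℕ → S)) :=
  (Filtration.piLE (X := fun _ : ℕ => S)).le n

lemma measurable_past_eval {n m : ℕ} (h : m ≤ n) :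
    Measurable[past S n] (fun ξ : ℕ → S => ξ m) := by
  have : (fun ξ : ℕ → S => ξ m) =
      (fun h' : ((i : Finset.Iic n) → S) => h' ⟨m, Finset.mem_Iic.2 h⟩) ∘
        Preorder.frestrictLe (π := fun _ : ℕ => S) n := rfl
  rw [this, past, Filtration.piLE_eq_comap_frestrictLe]
  exact (measurable_pi_apply _).comp (comap_measurable _)

/-- The Markov property over one step. -/
lemma setLIntegral_next (x : S) (n : ℕ) {A : Set (ℕ → S)} (hA : MeasurableSet[past S n] A)
    {g : S → ℝ≥0∞} (hg : Measurable g) :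
    ∫⁻ ξ in A, g (ξ (n + 1)) ∂(pathLaw κ x) = ∫⁻ ξ in A, ∫⁻ y, g y ∂(κ (ξ n)) ∂(pathLaw κ x) := by
  have hA' := past_le n _ hA
  rw [past, Filtration.piLE_eq_comap_frestrictLe] at hA
  obtain ⟨B, hB, rfl⟩ := hA
  set K : (n : ℕ) → Kernel ((i : Finset.Iic n) → S) S := fun n =>
    κ.comap (fun h : ((i : Finset.Iic n) → S) => h ⟨n, Finset.mem_Iic.2 le_rfl⟩)
      (measurable_pi_apply _) with hK
  -- Disintegration over the history up to time `n`: the path law is a finite trajectory followed by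
  -- its continuation. Given the history, the event `A` is decided and only the law of the next
  -- coordinate matters.
  have key : ∀ F : (ℕ → S) → ℝ≥0∞, Measurable F → ∫⁻ ξ, F ξ ∂(pathLaw κ x) =
      ∫⁻ h, ∫⁻ ξ, F ξ ∂(Kernel.traj (X := fun _ : ℕ => S) K n h)
        ∂(Kernel.partialTraj (X := fun _ : ℕ => S) K 0 n (fun _ => x)) := by
    intro F hF
    change ∫⁻ ξ, F ξ ∂(Kernel.traj (X := fun _ : ℕ => S) K 0 (fun _ => x)) = _
    rw [← Kernel.traj_comp_partialTraj (X := fun _ : ℕ => S) (κ := K) (zero_le (a := n)),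
      Kernel.lintegral_comp _ _ _ hF]
  have hm1 : Measurable fun ξ : ℕ → S => g (ξ (n + 1)) := hg.comp (measurable_pi_apply _)
  have hm2 : Measurable fun ξ : ℕ → S => ∫⁻ y, g y ∂(κ (ξ n)) :=
    (hg.lintegral_kernel (κ := κ)).comp (measurable_pi_apply n)
  rw [← lintegral_indicator hA', ← lintegral_indicator hA', key _ (hm1.indicator hA'),
    key _ (hm2.indicator hA')]
  refine lintegral_congr fun h => ?_
  have hr : ∀ ξ : ℕ → S, Preorder.frestrictLe (π := fun _ : ℕ => S) n
      (Function.updateFinset ξ (Finset.Iic n) h) = h := by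
    intro ξ; ext i; simp [Function.updateFinset]
  rw [Kernel.lintegral_traj (X := fun _ : ℕ => S) h (hm1.indicator hA'),
    Kernel.lintegral_traj (X := fun _ : ℕ => S) h (hm2.indicator hA')]
  by_cases hh : h ∈ B
  · have e1 : ∀ ξ : ℕ → S, Function.updateFinset ξ (Finset.Iic n) h ∈
        Preorder.frestrictLe (π := fun _ : ℕ => S) n ⁻¹' B := fun ξ => by
      rw [Set.mem_preimage, hr]; exact hh
    simp only [Set.indicator_of_mem (e1 _)]
    have e2 : ∀ ξ : ℕ → S, Function.updateFinset ξ (Finset.Iic n) h (n + 1) = ξ (n + 1) := by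
      intro ξ; simp [Function.updateFinset]
    have e3 : ∀ ξ : ℕ → S, Function.updateFinset ξ (Finset.Iic n) h n =
        h ⟨n, Finset.mem_Iic.2 le_rfl⟩ := by
      intro ξ; simp [Function.updateFinset]
    simp only [e2, e3]
    rw [lintegral_const, measure_univ, mul_one]
    have := Kernel.map_traj_succ_self (X := fun _ : ℕ => S) (κ := K) (a := n)
    have h3 : (Kernel.traj (X := fun _ : ℕ => S) K n h).map (fun ξ => ξ (n + 1)) = K n h := by
      rw [← this, Kernel.map_apply _ (measurable_pi_apply _)]
    rw [← lintegral_map (f := g) (g := fun ξ : ℕ → S => ξ (n + 1)) hg (measurable_pi_apply _), h3]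
    rfl
  · have e1 : ∀ ξ : ℕ → S, Function.updateFinset ξ (Finset.Iic n) h ∉
        Preorder.frestrictLe (π := fun _ : ℕ => S) n ⁻¹' B := fun ξ => by
      rw [Set.mem_preimage, hr]; exact hh
    simp only [Set.indicator_of_notMem (e1 _)]

/-- A maximal inequality for a function which is superharmonic on `G`. -/
lemma measure_exit_le (x : S) {f : S → ℝ≥0∞} (hf : Measurable f) {G : Set S}
    (hG : MeasurableSet G) (hsup : ∀ y ∈ G, ∫⁻ z, f z ∂(κ y) ≤ f y) (M : ℝ≥0∞) (m : ℕ) :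
    ∀ (n : ℕ) (A : Set (ℕ → S)), MeasurableSet[past S n] A →
      M * pathLaw κ x {ξ ∈ A | ∃ j, n ≤ j ∧ j ≤ n + m ∧ M ≤ f (ξ j) ∧
        ∀ i, n ≤ i → i < j → ξ i ∈ G} ≤ ∫⁻ ξ in A, f (ξ n) ∂(pathLaw κ x) := by
  -- Induction on the horizon takes the place of optional stopping. The time `n` and the event `A`
  -- stay general because the hypothesis is applied at time `n + 1` to a smaller event.
  induction m with
  | zero =>
    intro n A hA
    have hA' := past_le n _ hA
    have hfn : Measurable fun ξ : ℕ → S => f (ξ n) := hf.comp (measurable_pi_apply n)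
    refine le_trans ?_ (mul_meas_ge_le_lintegral₀ hfn.aemeasurable.restrict M)
    refine mul_le_mul' le_rfl ?_
    rw [Measure.restrict_apply (measurableSet_le measurable_const hfn)]
    refine measure_mono ?_
    rintro ξ ⟨h1, j, h2, h3, h4, -⟩
    obtain rfl : j = n := by omega
    exact ⟨h4, h1⟩
  | succ m ih =>
    intro n A hA
    have hA' := past_le n _ hA
    have hfn : Measurable fun ξ : ℕ → S => f (ξ n) := hf.comp (measurable_pi_apply n)
    have hev := measurable_past_eval (S := S) (le_refl n)
    -- On `A1` the level is already reached at time `n`. On `A2` it is not, and the chain sits in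
    -- `G`, where superharmonicity pays for one more step. Other paths of `A` cannot belong to the
    -- event.
    set A1 : Set (ℕ → S) := A ∩ {ξ | M ≤ f (ξ n)} with hA1
    set A2 : Set (ℕ → S) := (A \ {ξ | M ≤ f (ξ n)}) ∩ {ξ | ξ n ∈ G} with hA2
    have hB : MeasurableSet[past S n] {ξ : ℕ → S | M ≤ f (ξ n)} :=
      hev (measurableSet_le measurable_const hf)
    have hA1m : MeasurableSet[past S n] A1 := MeasurableSet.inter hA hB
    have hA2m : MeasurableSet[past S n] A2 := MeasurableSet.inter (MeasurableSet.diff hA hB) (hev hG)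
    have h1 := ih (n + 1) A2 (past_mono n.le_succ _ hA2m)
    rw [setLIntegral_next κ x n hA2m hf] at h1
    have h2 : ∫⁻ ξ in A2, ∫⁻ y, f y ∂(κ (ξ n)) ∂(pathLaw κ x) ≤
        ∫⁻ ξ in A2, f (ξ n) ∂(pathLaw κ x) :=
      setLIntegral_mono hfn fun ξ hξ => hsup _ hξ.2
    have h3 : M * pathLaw κ x A1 ≤ ∫⁻ ξ in A1, f (ξ n) ∂(pathLaw κ x) := by
      rw [← setLIntegral_const]
      exact setLIntegral_mono hfn fun ξ hξ => hξ.2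
    have hdis : Disjoint A1 A2 := by
      rw [Set.disjoint_left]; rintro ξ ⟨_, h⟩ ⟨⟨_, h'⟩, _⟩; exact h' h
    calc _ ≤ M * (pathLaw κ x A1 + pathLaw κ x {ξ ∈ A2 | ∃ j, n + 1 ≤ j ∧ j ≤ n + 1 + m ∧
            M ≤ f (ξ j) ∧ ∀ i, n + 1 ≤ i → i < j → ξ i ∈ G}) := by
          gcongr
          refine (measure_mono ?_).trans (measure_union_le _ _)
          rintro ξ ⟨hξ, j, hj1, hj2, hj3, hj4⟩
          by_cases hc : M ≤ f (ξ n)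
          · exact Or.inl ⟨hξ, hc⟩
          · have hjn : n < j := lt_of_le_of_ne hj1 (by rintro rfl; exact hc hj3)
            exact Or.inr ⟨⟨⟨hξ, hc⟩, hj4 n le_rfl hjn⟩, j, hjn, by omega, hj3,
              fun i hi hi' => hj4 i (by omega) hi'⟩
      _ ≤ ∫⁻ ξ in A1, f (ξ n) ∂(pathLaw κ x) + ∫⁻ ξ in A2, f (ξ n) ∂(pathLaw κ x) := by
          rw [mul_add]; exact add_le_add h3 (h1.trans h2)
      _ = ∫⁻ ξ in A1 ∪ A2, f (ξ n) ∂(pathLaw κ x) := by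
          rw [lintegral_union (past_le n _ hA2m) hdis]
      _ ≤ _ := lintegral_mono_set (by
          rintro ξ (h | h)
          · exact h.1
          · exact h.1.1)

/-- The maximal inequality with an infinite time horizon. -/
lemma measure_exit_le_of_infinite (x : S) {f : S → ℝ≥0∞} (hf : Measurable f) {G : Set S}
    (hG : MeasurableSet G) (hsup : ∀ y ∈ G, ∫⁻ z, f z ∂(κ y) ≤ f y) (M : ℝ≥0∞)
    (n : ℕ) {A : Set (ℕ → S)} (hA : MeasurableSet[past S n] A) :
      M * pathLaw κ x {ξ ∈ A | ∃ j, n ≤ j ∧ M ≤ f (ξ j) ∧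
        ∀ i, n ≤ i → i < j → ξ i ∈ G} ≤ ∫⁻ ξ in A, f (ξ n) ∂(pathLaw κ x) := by
  have h0 : {ξ ∈ A | ∃ j, n ≤ j ∧ M ≤ f (ξ j) ∧ ∀ i, n ≤ i → i < j → ξ i ∈ G} =
      ⋃ m : ℕ, {ξ ∈ A | ∃ j, n ≤ j ∧ j ≤ n + m ∧ M ≤ f (ξ j) ∧
        ∀ i, n ≤ i → i < j → ξ i ∈ G} := by
    ext ξ
    simp only [Set.mem_ofPred_eq, Set.mem_iUnion]
    constructor
    · rintro ⟨h, j, h1, h2, h3⟩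
      exact ⟨j, h, j, h1, by omega, h2, h3⟩
    · rintro ⟨m, h, j, h1, h2, h3⟩
      exact ⟨h, j, h1, h3⟩
  have hmono : Monotone fun m : ℕ => {ξ ∈ A | ∃ j, n ≤ j ∧ j ≤ n + m ∧ M ≤ f (ξ j) ∧
        ∀ i, n ≤ i → i < j → ξ i ∈ G} := by
    rintro a b hab ξ ⟨h, j, h1, h2, h3⟩
    exact ⟨h, j, h1, by omega, h3⟩
  rw [h0, hmono.measure_iUnion, ENNReal.mul_iSup]
  exact iSup_le fun m => measure_exit_le κ x hf hG hsup M m n A hA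

lemma frequently_norm_ge {ξ : ℕ → S} (h : limsup (fun n => ‖(ξ n : Plane)‖ₑ) atTop = ∞) (r : ℝ)
    (n : ℕ) : ∃ j, n ≤ j ∧ r ≤ ‖(ξ j : Plane)‖ := by
  have h1 : ENNReal.ofReal r < limsup (fun n => ‖(ξ n : Plane)‖ₑ) atTop := by
    rw [h]; exact ENNReal.ofReal_lt_top
  have h2 := frequently_lt_of_lt_limsup (by isBoundedDefault) h1
  obtain ⟨j, hj, hj'⟩ := (frequently_atTop.1 h2) n
  refine ⟨j, hj, ?_⟩
  rw [← ofReal_norm] at hj'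
  exact (lt_of_not_ge fun h => absurd (ENNReal.ofReal_le_ofReal h) (not_le.2 hj')).le

/-- A Lyapunov function tending to infinity, superharmonic far out, gives recurrence. -/
lemma recurrent_of_superharmonic (hN : NonConfinement κ) (x : S) {f : S → ℝ} (hf : Measurable f)
    (hfin : ∀ K : ℝ, ∃ r : ℝ, ∀ y : S, r ≤ ‖(y : Plane)‖ → K ≤ f y) (R : ℝ)
    (hsup : ∀ y : S, R < ‖(y : Plane)‖ →
      ∫⁻ z, ENNReal.ofReal (f z) ∂(κ y) ≤ ENNReal.ofReal (f y)) : Recurrent κ x := by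
  set g : S → ℝ≥0∞ := fun y => ENNReal.ofReal (f y) with hg
  have hgm : Measurable g := ENNReal.measurable_ofReal.comp hf
  have hnm : Measurable fun y : S => ‖(y : Plane)‖ := measurable_subtype_coe.norm
  set G : Set S := {y | R < ‖(y : Plane)‖} with hG
  have hGm : MeasurableSet G := measurableSet_lt measurable_const hnm
  -- An unbounded path that stays in `G` from time `n` on passes every level `M` of `g` without
  -- leaving `G`. From a value at most `K` this has probability at most `K / M`; then `M → ∞`.
  have hzero : ∀ n K : ℕ, pathLaw κ x {ξ | g (ξ n) ≤ K ∧ (∀ j, n ≤ j → ξ j ∈ G) ∧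
      limsup (fun n => ‖(ξ n : Plane)‖ₑ) atTop = ∞} = 0 := by
    intro n K
    set A : Set (ℕ → S) := {ξ | g (ξ n) ≤ K} with hA
    have hAm : MeasurableSet[past S n] A :=
      (measurable_past_eval le_rfl) (measurableSet_le hgm measurable_const)
    set E := {ξ : ℕ → S | g (ξ n) ≤ K ∧ (∀ j, n ≤ j → ξ j ∈ G) ∧
      limsup (fun n => ‖(ξ n : Plane)‖ₑ) atTop = ∞} with hE
    have hb : ∀ M : ℕ, (M : ℝ≥0∞) * pathLaw κ x E ≤ K := by
      intro M
      refine le_trans ?_ ((measure_exit_le_of_infinite κ x hgm hGm hsup M n hAm).trans ?_)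
      · refine mul_le_mul' le_rfl (measure_mono ?_)
        rintro ξ ⟨h1, h2, h3⟩
        obtain ⟨r, hr⟩ := hfin M
        obtain ⟨j, hj, hj'⟩ := frequently_norm_ge h3 r n
        refine ⟨h1, j, hj, ?_, fun i hi _ => h2 i hi⟩
        rw [hg, ← ENNReal.ofReal_natCast]
        exact ENNReal.ofReal_le_ofReal (hr _ hj')
      · calc _ ≤ ∫⁻ ξ in A, (K : ℝ≥0∞) ∂(pathLaw κ x) :=
              setLIntegral_mono measurable_const fun ξ hξ => hξ
          _ ≤ K := by
              rw [setLIntegral_const]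
              exact mul_le_of_le_one_right' prob_le_one
    by_contra h0
    have h1 : ∀ M : ℕ, (M : ℝ≥0∞) ≤ K / pathLaw κ x E := fun M => by
      rw [ENNReal.le_div_iff_mul_le (Or.inl h0) (Or.inl (measure_ne_top _ _))]
      exact hb M
    have h2 : (K : ℝ≥0∞) / pathLaw κ x E < ∞ :=
      ENNReal.div_lt_top (ENNReal.natCast_ne_top K) h0
    obtain ⟨M, hM⟩ := ENNReal.exists_nat_gt h2.ne
    exact absurd (h1 M) (not_le.2 hM)
  refine ⟨max R 0, le_max_right _ _, ?_⟩
  have hae : ∀ᵐ ξ ∂(pathLaw κ x), ∀ n K : ℕ, ¬ (g (ξ n) ≤ K ∧ (∀ j, n ≤ j → ξ j ∈ G) ∧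
      limsup (fun n => ‖(ξ n : Plane)‖ₑ) atTop = ∞) := by
    rw [ae_all_iff]; intro n
    rw [ae_all_iff]; intro K
    rw [ae_iff]
    simpa only [not_not] using hzero n K
  filter_upwards [hae, hN x] with ξ h1 h2
  refine liminf_le_of_frequently_le ?_ (by isBoundedDefault)
  rw [frequently_atTop]
  intro n
  by_contra! h3
  obtain ⟨K, hK⟩ := ENNReal.exists_nat_gt (r := g (ξ n)) ENNReal.ofReal_ne_top
  refine h1 n K ⟨hK.le, fun j hj => ?_, h2⟩
  have h4 := h3 j hj
  rw [← ofReal_norm] at h4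
  have h5 := (ENNReal.ofReal_lt_ofReal_iff_of_nonneg (le_max_right _ _)).1 h4
  exact (le_max_left _ _).trans_lt h5

/-- A positive Lyapunov function tending to zero, superharmonic far out, gives transience. -/
lemma transient_of_superharmonic (hN : NonConfinement κ) (x : S) {f : S → ℝ} (hf : Measurable f)
    (hpos : ∀ r : ℝ, ∃ m : ℝ, 0 < m ∧ ∀ y : S, ‖(y : Plane)‖ ≤ r → m ≤ f y)
    (hzero : ∀ ε : ℝ, 0 < ε → ∃ r : ℝ, ∀ y : S, r ≤ ‖(y : Plane)‖ → f y ≤ ε) (R : ℝ)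
    (hsup : ∀ y : S, R < ‖(y : Plane)‖ →
      ∫⁻ z, ENNReal.ofReal (f z) ∂(κ y) ≤ ENNReal.ofReal (f y)) : Transient κ x := by
  set g : S → ℝ≥0∞ := fun y => ENNReal.ofReal (f y) with hg
  have hgm : Measurable g := ENNReal.measurable_ofReal.comp hf
  have hnm : Measurable fun y : S => ‖(y : Plane)‖ := measurable_subtype_coe.norm
  set G : Set S := {y | R < ‖(y : Plane)‖} with hG
  have hGm : MeasurableSet G := measurableSet_lt measurable_const hnm
  have hnull : ∀ N : ℕ, pathLaw κ x {ξ | (∀ n, ∃ j, n ≤ j ∧ ‖(ξ j : Plane)‖ ≤ N) ∧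
      limsup (fun n => ‖(ξ n : Plane)‖ₑ) atTop = ∞} = 0 := by
    intro N
    -- The radius is `max R N`, not `N`, so that before first returning to this ball the chain is
    -- outside the ball of radius `R`, where `f` is superharmonic.
    obtain ⟨m, hm, hm'⟩ := hpos (max R N)
    set E := {ξ : ℕ → S | (∀ n, ∃ j, n ≤ j ∧ ‖(ξ j : Plane)‖ ≤ N) ∧
      limsup (fun n => ‖(ξ n : Plane)‖ₑ) atTop = ∞} with hE
    have hb : ∀ ε : ℝ, 0 < ε → ENNReal.ofReal m * pathLaw κ x E ≤ ENNReal.ofReal ε := by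
      intro ε hε
      obtain ⟨r, hr⟩ := hzero ε hε
      -- Decomposition by the first time the norm reaches `r`. There `f ≤ ε`, so a later return has
      -- probability at most `ε / m`. The events are disjoint, hence their probabilities sum to at
      -- most `1`.
      set A : ℕ → Set (ℕ → S) := fun n =>
        {ξ | r ≤ ‖(ξ n : Plane)‖ ∧ ∀ i < n, ‖(ξ i : Plane)‖ < r} with hA
      have hAm : ∀ n, MeasurableSet[past S n] (A n) := by
        intro n
        have h1 : MeasurableSet[past S n] {ξ : ℕ → S | r ≤ ‖(ξ n : Plane)‖} :=
          (measurable_past_eval (S := S) le_rfl) (measurableSet_le measurable_const hnm)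
        have h2 : ∀ i, MeasurableSet[past S n] {ξ : ℕ → S | i < n → ‖(ξ i : Plane)‖ < r} := by
          intro i
          by_cases hi : i < n
          · simp only [hi, true_imp_iff]
            exact (measurable_past_eval (S := S) hi.le) (measurableSet_lt hnm measurable_const)
          · simp only [hi, false_imp_iff]
            exact MeasurableSet.univ
        have h3 : A n = {ξ : ℕ → S | r ≤ ‖(ξ n : Plane)‖} ∩
            ⋂ i, {ξ : ℕ → S | i < n → ‖(ξ i : Plane)‖ < r} := by
          ext ξ; simp [hA]
        rw [h3]
        exact MeasurableSet.inter h1 (MeasurableSet.iInter h2)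
      have hAd : Pairwise (Function.onFun Disjoint A) := by
        intro a b hab
        rw [Function.onFun, Set.disjoint_left]
        rintro ξ ⟨h1, h2⟩ ⟨h3, h4⟩
        rcases lt_or_gt_of_ne hab with h | h
        · exact absurd (h4 _ h) (not_lt.2 h1)
        · exact absurd (h2 _ h) (not_lt.2 h3)
      have hcov : E ⊆ ⋃ n, {ξ ∈ A n | ∃ j, n ≤ j ∧ ENNReal.ofReal m ≤ g (ξ j) ∧
          ∀ i, n ≤ i → i < j → ξ i ∈ G} := by
        rintro ξ ⟨h1, h2⟩
        have h3 : ∃ n, r ≤ ‖(ξ n : Plane)‖ := by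
          obtain ⟨j, -, hj⟩ := frequently_norm_ge h2 r 0
          exact ⟨j, hj⟩
        classical
        refine Set.mem_iUnion.2 ⟨Nat.find h3, ⟨Nat.find_spec h3, fun i hi =>
          not_le.1 (Nat.find_min h3 hi)⟩, ?_⟩
        have h4 : ∃ j, Nat.find h3 ≤ j ∧ ‖(ξ j : Plane)‖ ≤ max R N := by
          obtain ⟨j, hj, hj'⟩ := h1 (Nat.find h3)
          exact ⟨j, hj, hj'.trans (le_max_right _ _)⟩
        obtain ⟨h5, h6⟩ := Nat.find_spec h4
        refine ⟨Nat.find h4, h5, ENNReal.ofReal_le_ofReal (hm' _ h6), fun i hi hi' => ?_⟩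
        have h7 := Nat.find_min h4 hi'
        push Not at h7
        exact (le_max_left _ _).trans_lt (h7 hi)
      calc ENNReal.ofReal m * pathLaw κ x E
          ≤ ENNReal.ofReal m * ∑' n, pathLaw κ x {ξ ∈ A n | ∃ j, n ≤ j ∧
            ENNReal.ofReal m ≤ g (ξ j) ∧ ∀ i, n ≤ i → i < j → ξ i ∈ G} :=
            mul_le_mul' le_rfl ((measure_mono hcov).trans (measure_iUnion_le _))
        _ = ∑' n, ENNReal.ofReal m * pathLaw κ x {ξ ∈ A n | ∃ j, n ≤ j ∧
            ENNReal.ofReal m ≤ g (ξ j) ∧ ∀ i, n ≤ i → i < j → ξ i ∈ G} := by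
            rw [ENNReal.tsum_mul_left]
        _ ≤ ∑' n, ENNReal.ofReal ε * pathLaw κ x (A n) := by
            refine ENNReal.tsum_le_tsum fun n =>
              (measure_exit_le_of_infinite κ x hgm hGm hsup _ n (hAm n)).trans ?_
            rw [← setLIntegral_const]
            exact setLIntegral_mono measurable_const fun ξ hξ =>
              ENNReal.ofReal_le_ofReal (hr _ hξ.1)
        _ = ENNReal.ofReal ε * pathLaw κ x (⋃ n, A n) := by
            rw [ENNReal.tsum_mul_left, measure_iUnion hAd fun n => past_le n _ (hAm n)]
        _ ≤ ENNReal.ofReal ε := mul_le_of_le_one_right' prob_le_one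
    have h1 : ENNReal.ofReal m * pathLaw κ x E ≤ 0 := by
      refine ENNReal.le_of_forall_pos_le_add fun ε hε _ => ?_
      rw [zero_add]
      simpa using hb ε (by exact_mod_cast hε)
    have h2 := le_antisymm h1 bot_le
    rcases mul_eq_zero.1 h2 with h | h
    · exact absurd (ENNReal.ofReal_eq_zero.1 h) (not_le.2 hm)
    · exact h
  have hae : ∀ᵐ ξ ∂(pathLaw κ x), ∀ N : ℕ, ¬ ((∀ n, ∃ j, n ≤ j ∧ ‖(ξ j : Plane)‖ ≤ N) ∧
      limsup (fun n => ‖(ξ n : Plane)‖ₑ) atTop = ∞) := by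
    rw [ae_all_iff]; intro N
    rw [ae_iff]
    simpa only [not_not] using hnull N
  filter_upwards [hae, hN x] with ξ h1 h2
  rw [tendsto_atTop]
  intro b
  obtain ⟨N, hN'⟩ := exists_nat_ge b
  by_contra h3
  rw [eventually_atTop] at h3
  push Not at h3
  exact h1 N ⟨fun n => (h3 n).imp fun j hj => ⟨hj.1, hj.2.le.trans hN'⟩, h2⟩

end

/-! ### Moments of the increments and the expected change of a function -/

/-- The `q`-th moments of the increments are finite and bounded by `M`. -/
def MomentBound {S : Set Plane} (κ : Kernel S S) (q M : ℝ) : Prop :=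
  ∀ x : S, Integrable (fun y : S => ‖(y : Plane) - (x : Plane)‖ ^ q) (κ x) ∧
    ∫ y, ‖(y : Plane) - (x : Plane)‖ ^ q ∂(κ x) ≤ M

section
variable {S : Set Plane} {κ : Kernel S S}

lemma measurable_increment (x : S) : Measurable fun y : S => (y : Plane) - (x : Plane) :=
  measurable_subtype_coe.sub_const _

lemma rpow_le_one_add_rpow {t a b : ℝ} (ht : 0 ≤ t) (ha : 0 ≤ a) (hab : a ≤ b) :
    t ^ a ≤ 1 + t ^ b := by
  rcases le_total t 1 with h | h
  · have h1 := Real.rpow_le_one ht h ha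
    have h2 := Real.rpow_nonneg ht b
    linarith
  · have h1 := Real.rpow_le_rpow_of_exponent_le h hab
    linarith

/-- The exponent is lowered to `min p 3`: with `q ≤ 3`, cubic Taylor remainders of small relative
jumps are dominated by the `q`-th power, and `q > 2` still makes the remainder smaller than the
second-order terms. -/
lemma exists_momentBound [IsMarkovKernel κ] (h : BoundedMoments κ) :
    ∃ q M : ℝ, 2 < q ∧ q ≤ 3 ∧ 0 ≤ M ∧ MomentBound κ q M := by
  obtain ⟨p, hp, C, hC⟩ := h
  refine ⟨min p 3, 1 + max C 0, lt_min hp (by norm_num), min_le_right _ _, by positivity,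
    fun x => ?_⟩
  have hn : Measurable fun y : S => ‖(y : Plane) - (x : Plane)‖ := (measurable_increment x).norm
  have hp0 : (0 : ℝ) ≤ p := by linarith
  have hip : Integrable (fun y : S => ‖(y : Plane) - (x : Plane)‖ ^ p) (κ x) := by
    refine ⟨(hn.pow_const p).aestronglyMeasurable, ?_⟩
    refine lt_of_le_of_lt ?_ ((hC x).trans_lt ENNReal.ofReal_lt_top)
    refine lintegral_mono fun y => ?_
    rw [Real.enorm_of_nonneg (by positivity), ← ofReal_norm,
      ENNReal.ofReal_rpow_of_nonneg (norm_nonneg _) hp0]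
  have hCp : ∫ y, ‖(y : Plane) - (x : Plane)‖ ^ p ∂(κ x) ≤ max C 0 := by
    rw [integral_eq_lintegral_of_nonneg_ae (Eventually.of_forall fun y => by positivity)
      hip.1]
    refine ENNReal.toReal_le_of_le_ofReal (le_max_right _ _) ?_
    refine le_trans (lintegral_mono fun y => ?_)
      ((hC x).trans (ENNReal.ofReal_le_ofReal (le_max_left _ _)))
    rw [← ofReal_norm, ENNReal.ofReal_rpow_of_nonneg (norm_nonneg _) hp0]
  have hle : ∀ y : S, ‖(y : Plane) - (x : Plane)‖ ^ (min p 3) ≤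
      1 + ‖(y : Plane) - (x : Plane)‖ ^ p := fun y =>
    rpow_le_one_add_rpow (norm_nonneg _) (le_min hp0 (by norm_num)) (min_le_left _ _)
  have hi : Integrable (fun y : S => ‖(y : Plane) - (x : Plane)‖ ^ (min p 3)) (κ x) := by
    refine ((integrable_const (1 : ℝ)).add hip).mono' (hn.pow_const _).aestronglyMeasurable
      (Eventually.of_forall fun y => ?_)
    rw [Real.norm_of_nonneg (by positivity)]
    exact hle y
  refine ⟨hi, ?_⟩
  calc _ ≤ ∫ y, (1 + ‖(y : Plane) - (x : Plane)‖ ^ p) ∂(κ x) :=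
        integral_mono hi ((integrable_const (1 : ℝ)).add hip) hle
    _ = 1 + ∫ y, ‖(y : Plane) - (x : Plane)‖ ^ p ∂(κ x) := by
        rw [integral_add (integrable_const _) hip]; simp
    _ ≤ _ := by linarith

lemma abs_apply_le_norm (v : Plane) (i : Fin 2) : |v i| ≤ ‖v‖ := by
  simpa using PiLp.norm_apply_le v i

variable [IsMarkovKernel κ] {q M : ℝ}

lemma MomentBound.integrable_of_le (hM : MomentBound κ q M) (x : S) {g : S → ℝ}
    (hg : Measurable g) {C : ℝ} (h : ∀ y : S, |g y| ≤ C * (1 + ‖(y : Plane) - (x : Plane)‖ ^ q)) :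
    Integrable g (κ x) :=
  (((integrable_const (1 : ℝ)).add (hM x).1).const_mul C).mono' hg.aestronglyMeasurable
    (Eventually.of_forall h)

lemma measurable_increment_apply (x : S) (i : Fin 2) :
    Measurable fun y : S => ((y : Plane) - (x : Plane)) i :=
  (EuclideanSpace.proj (𝕜 := ℝ) i).continuous.measurable.comp (measurable_increment x)

lemma MomentBound.integrable_apply (hM : MomentBound κ q M) (hq : 2 < q) (x : S) (i : Fin 2) :
    Integrable (fun y : S => ((y : Plane) - (x : Plane)) i) (κ x) := by
  refine hM.integrable_of_le x (measurable_increment_apply x i) (C := 1) fun y => ?_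
  rw [one_mul]
  refine (abs_apply_le_norm _ i).trans ?_
  simpa using rpow_le_one_add_rpow (norm_nonneg ((y : Plane) - (x : Plane)))
    zero_le_one (by linarith : (1 : ℝ) ≤ q)

lemma abs_apply_mul_apply_le (v : Plane) (i j : Fin 2) (hq : 2 < q) :
    |v i * v j| ≤ 1 + ‖v‖ ^ q := by
  rw [abs_mul]
  refine (mul_le_mul (abs_apply_le_norm v i) (abs_apply_le_norm v j) (abs_nonneg _)
    (norm_nonneg _)).trans ?_
  have := rpow_le_one_add_rpow (norm_nonneg v) zero_le_two hq.le
  rw [Real.rpow_two] at this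
  nlinarith

lemma MomentBound.integrable_mul (hM : MomentBound κ q M) (hq : 2 < q) (x : S) (i j : Fin 2) :
    Integrable (fun y : S => ((y : Plane) - (x : Plane)) i * ((y : Plane) - (x : Plane)) j)
      (κ x) := by
  refine hM.integrable_of_le x
    ((measurable_increment_apply x i).mul (measurable_increment_apply x j)) (C := 1) fun y => ?_
  rw [one_mul]
  exact abs_apply_mul_apply_le _ i j hq

lemma MomentBound.integral_one_add (hM : MomentBound κ q M) (x : S) :
    ∫ y, (1 + ‖(y : Plane) - (x : Plane)‖ ^ q) ∂(κ x) ≤ 1 + M := by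
  rw [integral_add (integrable_const _) (hM x).1]
  simpa using (hM x).2

lemma MomentBound.abs_secondMoment_le (hM : MomentBound κ q M) (hq : 2 < q) (x : S)
    (i j : Fin 2) : |secondMoment κ x i j| ≤ 1 + M := by
  rw [secondMoment, Matrix.of_apply]
  refine (abs_integral_le_integral_abs).trans ((integral_mono (hM.integrable_mul hq x i j).abs
    ((integrable_const (1 : ℝ)).add (hM x).1) fun y => ?_).trans (hM.integral_one_add x))
  exact abs_apply_mul_apply_le _ i j hq

lemma MomentBound.meanIncrement_apply (hM : MomentBound κ q M) (hq : 2 < q) (x : S)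
    (i : Fin 2) : meanIncrement κ x i = ∫ y, ((y : Plane) - (x : Plane)) i ∂(κ x) := by
  have hint : Integrable (fun y : S => (y : Plane) - (x : Plane)) (κ x) := by
    refine (((integrable_const (1 : ℝ)).add (hM x).1)).mono'
      (measurable_increment x).aestronglyMeasurable (Eventually.of_forall fun y => ?_)
    simpa using rpow_le_one_add_rpow (norm_nonneg ((y : Plane) - (x : Plane)))
      zero_le_one (by linarith : (1 : ℝ) ≤ q)
  exact ((EuclideanSpace.proj (𝕜 := ℝ) i).integral_comp_comm hint).symm

/-- One-step drift of a nonnegative function with a quadratic upper expansion. -/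
lemma MomentBound.lintegral_le (hM : MomentBound κ q M) (hq : 2 < q) (x : S) {f : S → ℝ}
    (hf0 : ∀ y, 0 ≤ f y) {b₀ b₁ q₀ q₁ q₂ E : ℝ} (hE : 0 ≤ E)
    (h : ∀ y : S, f y ≤ f x + (b₀ * ((y : Plane) - (x : Plane)) 0
      + b₁ * ((y : Plane) - (x : Plane)) 1
      + q₀ * (((y : Plane) - (x : Plane)) 0 * ((y : Plane) - (x : Plane)) 0)
      + q₁ * (((y : Plane) - (x : Plane)) 0 * ((y : Plane) - (x : Plane)) 1)
      + q₂ * (((y : Plane) - (x : Plane)) 1 * ((y : Plane) - (x : Plane)) 1))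
      + E * (1 + ‖(y : Plane) - (x : Plane)‖ ^ q)) :
    ∫⁻ y, ENNReal.ofReal (f y) ∂(κ x) ≤ ENNReal.ofReal (f x + (b₀ * meanIncrement κ x 0
      + b₁ * meanIncrement κ x 1 + q₀ * secondMoment κ x 0 0 + q₁ * secondMoment κ x 0 1
      + q₂ * secondMoment κ x 1 1) + E * (1 + M)) := by
  have i0 := (hM.integrable_apply hq x 0).const_mul b₀
  have i1 := (hM.integrable_apply hq x 1).const_mul b₁
  have i2 := (hM.integrable_mul hq x 0 0).const_mul q₀
  have i3 := (hM.integrable_mul hq x 0 1).const_mul q₁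
  have i4 := (hM.integrable_mul hq x 1 1).const_mul q₂
  have i5 : Integrable (fun y : S => E * (1 + ‖(y : Plane) - (x : Plane)‖ ^ q)) (κ x) :=
    ((integrable_const (μ := κ x) (1 : ℝ)).add (hM x).1).const_mul E
  have i6 : Integrable (fun y : S => b₀ * ((y : Plane) - (x : Plane)) 0
      + b₁ * ((y : Plane) - (x : Plane)) 1
      + q₀ * (((y : Plane) - (x : Plane)) 0 * ((y : Plane) - (x : Plane)) 0)
      + q₁ * (((y : Plane) - (x : Plane)) 0 * ((y : Plane) - (x : Plane)) 1)
      + q₂ * (((y : Plane) - (x : Plane)) 1 * ((y : Plane) - (x : Plane)) 1)) (κ x) :=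
    (((i0.add i1).add i2).add i3).add i4
  have i7 : Integrable (fun y : S => f x + (b₀ * ((y : Plane) - (x : Plane)) 0
      + b₁ * ((y : Plane) - (x : Plane)) 1
      + q₀ * (((y : Plane) - (x : Plane)) 0 * ((y : Plane) - (x : Plane)) 0)
      + q₁ * (((y : Plane) - (x : Plane)) 0 * ((y : Plane) - (x : Plane)) 1)
      + q₂ * (((y : Plane) - (x : Plane)) 1 * ((y : Plane) - (x : Plane)) 1))
      + E * (1 + ‖(y : Plane) - (x : Plane)‖ ^ q)) (κ x) :=
    ((integrable_const (μ := κ x) (f x)).add i6).add i5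
  refine (lintegral_mono fun y => ENNReal.ofReal_le_ofReal (h y)).trans ?_
  rw [← ofReal_integral_eq_lintegral_ofReal i7
    (Eventually.of_forall fun y => (hf0 y).trans (h y))]
  refine ENNReal.ofReal_le_ofReal ?_
  have e5 : ∫ y, E * (1 + ‖(y : Plane) - (x : Plane)‖ ^ q) ∂(κ x) ≤ E * (1 + M) := by
    rw [integral_const_mul]
    exact mul_le_mul_of_nonneg_left (hM.integral_one_add x) hE
  rw [integral_add (by exact (integrable_const (μ := κ x) (f x)).add i6) i5,
    integral_add (integrable_const (μ := κ x) (f x)) i6,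
    integral_add (by exact ((i0.add i1).add i2).add i3) i4,
    integral_add (by exact (i0.add i1).add i2) i3, integral_add (by exact i0.add i1) i2, integral_add i0 i1, integral_const_mul, integral_const_mul,
    integral_const_mul, integral_const_mul, integral_const_mul, hM.meanIncrement_apply hq,
    hM.meanIncrement_apply hq]
  simp only [integral_const, probReal_univ, one_smul]
  have h00 : secondMoment κ x 0 0 =
    ∫ y, ((y : Plane) - (x : Plane)) 0 * ((y : Plane) - (x : Plane)) 0 ∂(κ x) := rfl
  have h01 : secondMoment κ x 0 1 =
    ∫ y, ((y : Plane) - (x : Plane)) 0 * ((y : Plane) - (x : Plane)) 1 ∂(κ x) := rfl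
  have h11 : secondMoment κ x 1 1 =
    ∫ y, ((y : Plane) - (x : Plane)) 1 * ((y : Plane) - (x : Plane)) 1 ∂(κ x) := rfl
  rw [h00, h01, h11]
  linarith

/-- The entries of a matrix are bounded by its operator norm. -/
lemma abs_apply_le_matOpNorm (A : Matrix (Fin 2) (Fin 2) ℝ) (i j : Fin 2) :
    |A i j| ≤ matOpNorm A := by
  have h1 := (Matrix.toEuclideanCLM (n := Fin 2) (𝕜 := ℝ) A).le_opNorm (EuclideanSpace.single j 1)
  rw [PiLp.norm_single, norm_one, mul_one] at h1
  refine le_trans ?_ ((abs_apply_le_norm _ i).trans h1)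
  rw [Matrix.ofLp_toEuclideanCLM]
  simp

end

/-! ### Expansions -/

lemma norm_log_one_add_sub_le {z : ℂ} (hz : ‖z‖ ≤ 1 / 2) :
    ‖Complex.log (1 + z) - (z - z ^ 2 / 2)‖ ≤ ‖z‖ ^ 3 := by
  have h := Complex.norm_log_sub_logTaylor_le 2 (z := z) (by linarith)
  have e : Complex.logTaylor (2 + 1) z = z - z ^ 2 / 2 := by
    simp [Complex.logTaylor_succ, Complex.logTaylor_zero]; ring
  rw [e] at h
  refine h.trans ?_
  have h1 : (1 - ‖z‖)⁻¹ ≤ 2 := by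
    rw [inv_le_comm₀ (by linarith) (by norm_num)]; linarith
  have h2 : 0 ≤ ‖z‖ ^ 3 := by positivity
  norm_num
  nlinarith

/-- Expansion of `exp (a L)` with `L = log (1 + z)`: the exponential is expanded to second order in
`L`, and `L` is then replaced by `z - z²/2` in the linear term and by `z` in the quadratic one. The
real expansions below are special cases. -/
lemma exists_norm_one_add_cpow_sub_le (a : ℝ) : ∃ C : ℝ, 0 ≤ C ∧ ∀ z : ℂ, ‖z‖ ≤ 1 / 2 →
    ‖(1 + z) ^ (a : ℂ) - (1 + a * z + a * (a - 1) / 2 * z ^ 2)‖ ≤ C * ‖z‖ ^ 3 := by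
  set b := |a| with hb
  have hb0 : 0 ≤ b := abs_nonneg a
  refine ⟨(b * (3 / 2)) ^ 3 * Real.exp b + (b + b ^ 2 * 2), by positivity, fun z hz => ?_⟩
  have h1z : (1 + z) ≠ 0 := by
    intro h
    have : ‖z‖ = 1 := by rw [← norm_neg, show -z = 1 by linear_combination -h]; simp
    linarith
  set L := Complex.log (1 + z) with hL
  have hL1 : ‖L‖ ≤ 3 / 2 * ‖z‖ := Complex.norm_log_one_add_half_le_self hz
  have hL2 : ‖L - (z - z ^ 2 / 2)‖ ≤ ‖z‖ ^ 3 := norm_log_one_add_sub_le hz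
  have hL3 : ‖L - z‖ ≤ ‖z‖ ^ 2 := by
    calc ‖L - z‖ = ‖(L - (z - z ^ 2 / 2)) - z ^ 2 / 2‖ := by ring_nf
      _ ≤ ‖z‖ ^ 3 + ‖z‖ ^ 2 / 2 := by
        refine (norm_sub_le _ _).trans ?_
        gcongr
        simp
      _ ≤ _ := by nlinarith [norm_nonneg z, sq_nonneg ‖z‖]
  have hexp := Complex.norm_exp_sub_sum_le_norm_mul_exp (a * L) 3
  have hna : ‖(a : ℂ)‖ = b := by simp [hb]
  have hnaL : ‖(a : ℂ) * L‖ ≤ b * (3 / 2) * ‖z‖ := by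
    rw [norm_mul, hna, mul_assoc]; gcongr
  have hexp' : ‖Complex.exp (a * L) - (1 + a * L + (a * L) ^ 2 / 2)‖ ≤
      (b * (3 / 2)) ^ 3 * Real.exp b * ‖z‖ ^ 3 := by
    have e : ∑ m ∈ Finset.range 3, ((a : ℂ) * L) ^ m / (m.factorial : ℂ) =
        1 + a * L + (a * L) ^ 2 / 2 := by
      simp [Finset.sum_range_succ, Nat.factorial]
    rw [e] at hexp
    refine hexp.trans ?_
    calc ‖(a : ℂ) * L‖ ^ 3 * Real.exp ‖(a : ℂ) * L‖
        ≤ (b * (3 / 2) * ‖z‖) ^ 3 * Real.exp b := by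
          gcongr
          refine hnaL.trans ?_
          nlinarith [norm_nonneg z]
      _ = _ := by ring
  have h2 : ‖(a : ℂ) * (L - (z - z ^ 2 / 2))‖ ≤ b * ‖z‖ ^ 3 := by
    rw [norm_mul, hna]; gcongr
  -- This is `a² (L² - z²) / 2`, the cost of replacing `L` by `z` in the quadratic term.
  have h3 : ‖(a : ℂ) ^ 2 / 2 * ((L - z) * (L + z))‖ ≤ b ^ 2 * 2 * ‖z‖ ^ 3 := by
    rw [norm_mul, norm_mul, norm_div, norm_pow, hna]
    have : ‖L + z‖ ≤ 5 / 2 * ‖z‖ := (norm_add_le _ _).trans (by linarith)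
    calc b ^ 2 / ‖(2 : ℂ)‖ * (‖L - z‖ * ‖L + z‖) ≤ b ^ 2 / 2 * (‖z‖ ^ 2 * (5 / 2 * ‖z‖)) := by
          simp only [Complex.norm_ofNat]; gcongr
      _ ≤ _ := by
          have : 0 ≤ b ^ 2 * ‖z‖ ^ 3 := by positivity
          nlinarith
  rw [Complex.cpow_def_of_ne_zero h1z, ← hL, mul_comm L]
  calc _ = ‖(Complex.exp (a * L) - (1 + a * L + (a * L) ^ 2 / 2)) +
        ((a : ℂ) * (L - (z - z ^ 2 / 2)) + (a : ℂ) ^ 2 / 2 * ((L - z) * (L + z)))‖ := by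
        congr 1; ring
    _ ≤ (b * (3 / 2)) ^ 3 * Real.exp b * ‖z‖ ^ 3 + (b * ‖z‖ ^ 3 + b ^ 2 * 2 * ‖z‖ ^ 3) :=
        (norm_add_le _ _).trans (add_le_add hexp' ((norm_add_le _ _).trans (add_le_add h2 h3)))
    _ = _ := by ring

lemma exists_abs_one_add_rpow_sub_le (a : ℝ) : ∃ C : ℝ, 0 ≤ C ∧ ∀ t : ℝ, |t| ≤ 1 / 2 →
    |(1 + t) ^ a - (1 + a * t + a * (a - 1) / 2 * t ^ 2)| ≤ C * |t| ^ 3 := by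
  obtain ⟨C, hC, h⟩ := exists_norm_one_add_cpow_sub_le a
  refine ⟨C, hC, fun t ht => ?_⟩
  have h1 := h t (by simpa using ht)
  have h2 : (0 : ℝ) ≤ 1 + t := by linarith [neg_abs_le t]
  have e : ((1 + (t : ℂ)) ^ (a : ℂ) - (1 + a * t + a * (a - 1) / 2 * t ^ 2)) =
      (((1 + t) ^ a - (1 + a * t + a * (a - 1) / 2 * t ^ 2) : ℝ) : ℂ) := by
    push_cast [Complex.ofReal_cpow h2]; ring
  rw [e, Complex.norm_real, Complex.norm_real] at h1
  simpa using h1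

lemma exists_abs_one_add_rpow_sub_linear_le (a : ℝ) : ∃ C : ℝ, 0 ≤ C ∧ ∀ t : ℝ, |t| ≤ 1 / 2 →
    |(1 + t) ^ a - (1 + a * t)| ≤ C * |t| ^ 2 := by
  obtain ⟨C, hC, h⟩ := exists_abs_one_add_rpow_sub_le a
  refine ⟨C + |a * (a - 1) / 2|, by positivity, fun t ht => ?_⟩
  calc |(1 + t) ^ a - (1 + a * t)| = |((1 + t) ^ a - (1 + a * t + a * (a - 1) / 2 * t ^ 2)) +
        a * (a - 1) / 2 * t ^ 2| := by ring_nf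
    _ ≤ C * |t| ^ 3 + |a * (a - 1) / 2| * |t| ^ 2 := by
        refine (abs_add_le _ _).trans (add_le_add (h t ht) ?_)
        rw [abs_mul, abs_pow]
    _ ≤ _ := by
        have : |t| ^ 3 ≤ |t| ^ 2 := pow_le_pow_of_le_one (abs_nonneg t) (by linarith) (by norm_num)
        nlinarith

lemma exists_abs_one_add_rpow_sub_one_le (a : ℝ) : ∃ C : ℝ, 0 ≤ C ∧ ∀ t : ℝ, |t| ≤ 1 / 2 →
    |(1 + t) ^ a - 1| ≤ C * |t| := by
  obtain ⟨C, hC, h⟩ := exists_abs_one_add_rpow_sub_linear_le a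
  refine ⟨C + |a|, by positivity, fun t ht => ?_⟩
  calc |(1 + t) ^ a - 1| = |((1 + t) ^ a - (1 + a * t)) + a * t| := by ring_nf
    _ ≤ C * |t| ^ 2 + |a| * |t| := by
        refine (abs_add_le _ _).trans (add_le_add (h t ht) ?_)
        rw [abs_mul]
    _ ≤ _ := by
        have : |t| ^ 2 ≤ |t| := by nlinarith [abs_nonneg t]
        nlinarith

lemma abs_log_one_add_sub_le {t : ℝ} (ht : |t| ≤ 1 / 2) :
    |Real.log (1 + t) - (t - t ^ 2 / 2)| ≤ |t| ^ 3 := by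
  have h1 := norm_log_one_add_sub_le (z := t) (by simpa using ht)
  have h2 : (0 : ℝ) ≤ 1 + t := by linarith [neg_abs_le t]
  have e : Complex.log (1 + (t : ℂ)) - (t - t ^ 2 / 2) =
      ((Real.log (1 + t) - (t - t ^ 2 / 2) : ℝ) : ℂ) := by
    push_cast [Complex.ofReal_log h2]; ring
  rw [e, Complex.norm_real, Complex.norm_real] at h1
  simpa using h1

/-! ### Comparison of powers -/

lemma eventually_mul_rpow_le {e e' : ℝ} (h : e < e') (C : ℝ) {c : ℝ} (hc : 0 < c) :
    ∀ᶠ z : ℝ in atTop, C * z ^ e ≤ c * z ^ e' := by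
  have h1 : Tendsto (fun z : ℝ => z ^ (e' - e)) atTop atTop :=
    tendsto_rpow_atTop (by linarith)
  filter_upwards [h1.eventually_ge_atTop (C / c), eventually_gt_atTop 0] with z hz hz0
  have h2 : z ^ e' = z ^ e * z ^ (e' - e) := by rw [← Real.rpow_add hz0]; ring_nf
  rw [div_le_iff₀ hc] at hz
  have h3 := Real.rpow_pos_of_pos hz0 e
  rw [h2]
  nlinarith

/-! ### A nearly harmonic function in the right half-plane -/

/-- Both factors lie in the open right half-plane, so their arguments add up to less than `π` in
absolute value and no branch is crossed, even if the product leaves the half-plane. -/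
lemma log_mul_one_add {ζ τ : ℂ} (hζ : 0 < ζ.re) (hτ : ‖τ‖ ≤ 1 / 2) :
    ζ ≠ 0 ∧ 1 + τ ≠ 0 ∧ Complex.log (ζ * (1 + τ)) = Complex.log ζ + Complex.log (1 + τ) := by
  have h1 : 0 < (1 + τ).re := by
    have := (abs_le.1 (Complex.abs_re_le_norm τ)).1
    simp; linarith
  have hζ0 : ζ ≠ 0 := by rintro rfl; simp at hζ
  have h10 : 1 + τ ≠ 0 := by intro h; rw [h] at h1; simp at h1
  refine ⟨hζ0, h10, (Complex.log_mul_eq_add_log_iff hζ0 h10).2 ?_⟩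
  have a1 := abs_lt.1 (Complex.abs_arg_lt_pi_div_two_iff.2 (Or.inl hζ))
  have a2 := abs_lt.1 (Complex.abs_arg_lt_pi_div_two_iff.2 (Or.inl h1))
  constructor <;> linarith [a1.1, a1.2, a2.1, a2.2]

lemma mul_one_add_cpow {ζ τ : ℂ} (hζ : 0 < ζ.re) (hτ : ‖τ‖ ≤ 1 / 2) (a : ℂ) :
    (ζ * (1 + τ)) ^ a = ζ ^ a * (1 + τ) ^ a := by
  obtain ⟨h1, h2, h3⟩ := log_mul_one_add hζ hτ
  rw [Complex.cpow_def_of_ne_zero (mul_ne_zero h1 h2), h3, Complex.cpow_def_of_ne_zero h1,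
    Complex.cpow_def_of_ne_zero h2, ← Complex.exp_add]
  ring_nf

/-- The left side expands `‖(1 + τ)^(-δ/2)‖²`. Apart from real parts of `τ` and `τ²`, the square of
the linear term leaves `δ²/4 ‖τ‖²`, which is the strict subharmonicity of `‖ζ‖^(-δ)`. -/
lemma exists_norm_one_add_rpow_ge (δ : ℝ) : ∃ C : ℝ, 0 ≤ C ∧ ∀ τ : ℂ, ‖τ‖ ≤ 1 / 2 →
    1 - δ * τ.re + δ / 2 * (δ / 2 + 1) * (τ ^ 2).re + δ ^ 2 / 4 * ‖τ‖ ^ 2 - C * ‖τ‖ ^ 3 ≤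
      ‖1 + τ‖ ^ (-δ) := by
  obtain ⟨C, hC, h⟩ := exists_norm_one_add_cpow_sub_le (-δ / 2)
  set a : ℝ := -δ / 2 with ha
  set b : ℝ := a * (a - 1) / 2 with hb
  refine ⟨2 * (1 + |a| + |b|) * C + 2 * |a| * |b|, by positivity, fun τ hτ => ?_⟩
  set X : ℂ := (1 + τ) ^ (a : ℂ) with hX
  set p : ℂ := a * τ + b * τ ^ 2 with hp
  have h1 : ‖X - (1 + p)‖ ≤ C * ‖τ‖ ^ 3 := by
    have := h τ hτ
    convert this using 2
    rw [hp, hb]; push_cast; ring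
  have hn : ‖1 + τ‖ ^ (-δ) = ‖X‖ ^ 2 := by
    rw [hX, Complex.norm_cpow_real, ← Real.rpow_natCast, ← Real.rpow_mul (norm_nonneg _), ha]
    congr 1; push_cast; ring
  have hn0 := norm_nonneg τ
  have hp1 : ‖1 + p‖ ≤ 1 + |a| + |b| := by
    refine (norm_add_le _ _).trans ?_
    rw [norm_one, add_assoc]
    gcongr
    refine (norm_add_le _ _).trans ?_
    rw [norm_mul, norm_mul, norm_pow, Complex.norm_real, Complex.norm_real, Real.norm_eq_abs,
      Real.norm_eq_abs]
    gcongr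
    · exact mul_le_of_le_one_right (abs_nonneg _) (by linarith)
    · exact mul_le_of_le_one_right (abs_nonneg _) (by nlinarith)
  have h2 : ‖1 + p‖ ^ 2 - 2 * ((1 + |a| + |b|) * (C * ‖τ‖ ^ 3)) ≤ ‖X‖ ^ 2 := by
    have h3 : ‖1 + p‖ - C * ‖τ‖ ^ 3 ≤ ‖X‖ := by
      have := norm_sub_norm_le (1 + p) X
      rw [norm_sub_rev] at this
      linarith
    have h4 : 0 ≤ C * ‖τ‖ ^ 3 := by positivity
    have h6 := norm_nonneg (1 + p)
    have h7 := mul_le_mul_of_nonneg_right hp1 h4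
    by_cases h5 : 0 ≤ ‖1 + p‖ - C * ‖τ‖ ^ 3
    · nlinarith [norm_nonneg X]
    · nlinarith [sq_nonneg ‖X‖]
  have h3 : ‖1 + p‖ ^ 2 = 1 + 2 * p.re + ‖p‖ ^ 2 := by
    rw [← Complex.normSq_eq_norm_sq, ← Complex.normSq_eq_norm_sq, Complex.normSq_apply,
      Complex.normSq_apply]
    simp; ring
  have h4 : p.re = a * τ.re + b * (τ ^ 2).re := by
    simp only [hp, Complex.add_re, Complex.re_ofReal_mul]
  have h5 : a ^ 2 * ‖τ‖ ^ 2 - 2 * |a| * |b| * ‖τ‖ ^ 3 ≤ ‖p‖ ^ 2 := by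
    have h6 : |a| * ‖τ‖ - |b| * ‖τ‖ ^ 2 ≤ ‖p‖ := by
      have := norm_sub_norm_le ((a : ℂ) * τ) (-((b : ℂ) * τ ^ 2))
      rw [sub_neg_eq_add, norm_neg, norm_mul, norm_mul, norm_pow, Complex.norm_real,
        Complex.norm_real, Real.norm_eq_abs, Real.norm_eq_abs] at this
      exact this
    have ea : a ^ 2 = |a| ^ 2 := (sq_abs a).symm
    have h7 : 0 ≤ |a| * ‖τ‖ := by positivity
    have h8 : 0 ≤ |b| * ‖τ‖ ^ 2 := by positivity
    rw [ea]
    by_cases h9 : 0 ≤ |a| * ‖τ‖ - |b| * ‖τ‖ ^ 2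
    · nlinarith [norm_nonneg p]
    · nlinarith [sq_nonneg ‖p‖]
  rw [hn]
  have ea : a ^ 2 = δ ^ 2 / 4 := by rw [ha]; ring
  have eb : 2 * b = δ / 2 * (δ / 2 + 1) := by rw [hb, ha]; ring
  rw [ea] at h5
  have e1 : 2 * p.re = - δ * τ.re + δ / 2 * (δ / 2 + 1) * (τ ^ 2).re := by
    rw [h4, ← eb, ha]; ring
  nlinarith

/-- `Re (c (log ζ - ζ^{-w})) - |ζ|^{-δ}`. -/
def logPot (c : ℂ) (w δ : ℝ) (ζ : ℂ) : ℝ :=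
  (c * (Complex.log ζ - ζ ^ ((-w : ℝ) : ℂ))).re - ‖ζ‖ ^ (-δ)

/-- The first-order coefficient of `logPot` in the relative increment. -/
def logPotLin (c : ℂ) (w δ : ℝ) (ζ : ℂ) : ℂ :=
  c * (1 + w * ζ ^ ((-w : ℝ) : ℂ)) + ((δ * ‖ζ‖ ^ (-δ) : ℝ) : ℂ)

/-- The second-order coefficient of `logPot` in the relative increment. -/
def logPotQuad (c : ℂ) (w δ : ℝ) (ζ : ℂ) : ℂ :=
  -c / 2 - c * (w * (w + 1) / 2) * ζ ^ ((-w : ℝ) : ℂ)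
    - ((δ / 2 * (δ / 2 + 1) * ‖ζ‖ ^ (-δ) : ℝ) : ℂ)

lemma norm_cpow_neg_le_one {w : ℝ} (hw : 0 ≤ w) {ζ : ℂ} (hζ : 1 ≤ ‖ζ‖) :
    ‖ζ ^ ((-w : ℝ) : ℂ)‖ ≤ 1 := by
  rw [Complex.norm_cpow_real]
  exact Real.rpow_le_one_of_one_le_of_nonpos hζ (by linarith)

/-- Writing the new point as `ζ (1 + τ)` makes every term homogeneous in the relative increment `τ`,
with coefficients bounded for `‖ζ‖ ≥ 1`; hence one constant serves all `ζ`. -/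
lemma logPot_local (c : ℂ) {w δ : ℝ} (hw : 0 ≤ w) (hδ : 0 ≤ δ) : ∃ C : ℝ, 0 ≤ C ∧
    ∀ ζ τ : ℂ, 0 < ζ.re → 1 ≤ ‖ζ‖ → ‖τ‖ ≤ 1 / 2 →
      logPot c w δ (ζ * (1 + τ)) ≤ logPot c w δ ζ + ((logPotLin c w δ ζ * τ).re
        + (logPotQuad c w δ ζ * τ ^ 2).re - δ ^ 2 / 4 * ‖ζ‖ ^ (-δ) * ‖τ‖ ^ 2) + C * ‖τ‖ ^ 3 := by
  obtain ⟨C1, hC1, h1⟩ := exists_norm_one_add_cpow_sub_le (-w)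
  obtain ⟨C2, hC2, h2⟩ := exists_norm_one_add_rpow_ge δ
  refine ⟨‖c‖ * (1 + C1) + C2, by positivity, fun ζ τ hζ hζ1 hτ => ?_⟩
  set r1 : ℂ := Complex.log (1 + τ) - (τ - τ ^ 2 / 2) with hr1
  set r2 : ℂ := (1 + τ) ^ ((-w : ℝ) : ℂ) - (1 + ((-w : ℝ) : ℂ) * τ
    + ((-w : ℝ) : ℂ) * (((-w : ℝ) : ℂ) - 1) / 2 * τ ^ 2) with hr2
  have hr1' : ‖r1‖ ≤ ‖τ‖ ^ 3 := norm_log_one_add_sub_le hτ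
  have hr2' : ‖r2‖ ≤ C1 * ‖τ‖ ^ 3 := h1 τ hτ
  have hX1 := norm_cpow_neg_le_one hw hζ1
  set X : ℂ := ζ ^ ((-w : ℝ) : ℂ) with hX
  set n : ℝ := ‖ζ‖ ^ (-δ) with hn
  have hn0 : 0 ≤ n := by positivity
  have hn1 : n ≤ 1 := Real.rpow_le_one_of_one_le_of_nonpos hζ1 (by linarith)
  have hT : 0 ≤ ‖τ‖ ^ 3 := by positivity
  have e1 : logPot c w δ (ζ * (1 + τ)) =
      (c * (Complex.log ζ - X)).re + (c * (τ - τ ^ 2 / 2) + c * w * X * τ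
        - c * (w * (w + 1) / 2) * X * τ ^ 2).re + (c * (r1 - X * r2)).re
        - n * ‖1 + τ‖ ^ (-δ) := by
    rw [logPot, (log_mul_one_add hζ hτ).2.2, mul_one_add_cpow hζ hτ, norm_mul,
      Real.mul_rpow (norm_nonneg _) (norm_nonneg _), ← Complex.add_re, ← Complex.add_re]
    congr 2
    rw [hr1, hr2, ← hX]
    push_cast
    ring
  have e2 : (c * (r1 - X * r2)).re ≤ ‖c‖ * (1 + C1) * ‖τ‖ ^ 3 := by
    refine (Complex.re_le_norm _).trans ?_
    rw [norm_mul, mul_assoc]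
    gcongr
    refine (norm_sub_le _ _).trans ?_
    rw [norm_mul]
    have : ‖X‖ * ‖r2‖ ≤ 1 * (C1 * ‖τ‖ ^ 3) := by gcongr
    linarith
  have e3 := mul_le_mul_of_nonneg_left (h2 τ hτ) hn0
  have e4 : n * (C2 * ‖τ‖ ^ 3) ≤ C2 * ‖τ‖ ^ 3 := mul_le_of_le_one_left (by positivity) hn1
  have e5 : (logPotLin c w δ ζ * τ).re + (logPotQuad c w δ ζ * τ ^ 2).re =
      (c * (τ - τ ^ 2 / 2) + c * w * X * τ - c * (w * (w + 1) / 2) * X * τ ^ 2).re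
        + n * (δ * τ.re - δ / 2 * (δ / 2 + 1) * (τ ^ 2).re) := by
    have : n * (δ * τ.re - δ / 2 * (δ / 2 + 1) * (τ ^ 2).re) =
        (((δ * n : ℝ) : ℂ) * τ - ((δ / 2 * (δ / 2 + 1) * n : ℝ) : ℂ) * τ ^ 2).re := by
      rw [Complex.sub_re, Complex.re_ofReal_mul, Complex.re_ofReal_mul]; ring
    rw [this, ← Complex.add_re, ← Complex.add_re, logPotLin, logPotQuad, ← hX, ← hn]
    congr 1; ring
  rw [e1, e5, logPot, ← hX, ← hn]
  nlinarith

/-- The argument of `ζ` is bounded by `π`, so the imaginary part of `c` costs only a constant and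
the growth is that of `c.re * log ‖ζ‖`. -/
lemma logPot_bounds (c : ℂ) {w δ : ℝ} (hw : 0 ≤ w) (hδ : 0 ≤ δ) {ζ : ℂ} (hζ : 1 ≤ ‖ζ‖) :
    c.re * Real.log ‖ζ‖ - (‖c‖ * (Real.pi + 1) + 1) ≤ logPot c w δ ζ ∧
      logPot c w δ ζ ≤ c.re * Real.log ‖ζ‖ + (‖c‖ * (Real.pi + 1) + 1) := by
  have h1 := norm_cpow_neg_le_one hw hζ
  have h2 : 0 ≤ ‖ζ‖ ^ (-δ) := by positivity
  have h3 : ‖ζ‖ ^ (-δ) ≤ 1 := Real.rpow_le_one_of_one_le_of_nonpos hζ (by linarith)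
  have h4 : |(c * (Complex.log ζ - ζ ^ ((-w : ℝ) : ℂ))).re - c.re * Real.log ‖ζ‖| ≤
      ‖c‖ * (Real.pi + 1) := by
    have e : (c * (Complex.log ζ - ζ ^ ((-w : ℝ) : ℂ))).re - c.re * Real.log ‖ζ‖ =
        -(c.im * ζ.arg) - (c * ζ ^ ((-w : ℝ) : ℂ)).re := by
      rw [mul_sub, Complex.sub_re, Complex.mul_re c (Complex.log ζ), Complex.log_re,
        Complex.log_im]
      ring
    rw [e]
    refine (abs_sub _ _).trans ?_
    rw [abs_neg, abs_mul, mul_add, mul_one]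
    gcongr
    · exact Complex.abs_im_le_norm c
    · exact Complex.abs_arg_le_pi ζ
    · refine (Complex.abs_re_le_norm _).trans ?_
      rw [norm_mul]
      exact mul_le_of_le_one_right (norm_nonneg _) h1
  rw [logPot]
  constructor <;> linarith [(abs_le.1 h4).1, (abs_le.1 h4).2]

lemma norm_logPotLin_le (c : ℂ) {w δ : ℝ} (hw : 0 ≤ w) (hδ : 0 ≤ δ) {ζ : ℂ} (hζ : 1 ≤ ‖ζ‖) :
    ‖logPotLin c w δ ζ‖ ≤ ‖c‖ * (1 + w) + δ := by
  have h1 := norm_cpow_neg_le_one hw hζ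
  have h3 : ‖ζ‖ ^ (-δ) ≤ 1 := Real.rpow_le_one_of_one_le_of_nonpos hζ (by linarith)
  refine (norm_add_le _ _).trans ?_
  rw [norm_mul, Complex.norm_real, Real.norm_of_nonneg (by positivity)]
  refine add_le_add (mul_le_mul_of_nonneg_left ((norm_add_le _ _).trans ?_) (norm_nonneg _))
    (mul_le_of_le_one_right hδ h3)
  rw [norm_one, norm_mul, Complex.norm_real, Real.norm_of_nonneg hw]
  gcongr
  exact mul_le_of_le_one_right hw h1

lemma norm_logPotQuad_le (c : ℂ) {w δ : ℝ} (hw : 0 ≤ w) (hδ : 0 ≤ δ) {ζ : ℂ} (hζ : 1 ≤ ‖ζ‖) :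
    ‖logPotQuad c w δ ζ‖ ≤ ‖c‖ * (1 + w * (w + 1)) + δ * (δ + 1) := by
  have h1 := norm_cpow_neg_le_one hw hζ
  have h3 : ‖ζ‖ ^ (-δ) ≤ 1 := Real.rpow_le_one_of_one_le_of_nonpos hζ (by linarith)
  refine (norm_sub_le _ _).trans (add_le_add ((norm_sub_le _ _).trans ?_) ?_)
  · have e : ((w : ℂ) * (w + 1) / 2) = ((w * (w + 1) / 2 : ℝ) : ℂ) := by push_cast; ring
    rw [e, norm_mul, norm_mul, norm_div, norm_neg, Complex.norm_real,
      Real.norm_of_nonneg (by positivity), Complex.norm_ofNat]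
    have h4 : ‖c‖ * (w * (w + 1) / 2) * ‖ζ ^ ((-w : ℝ) : ℂ)‖ ≤ ‖c‖ * (w * (w + 1) / 2) :=
      mul_le_of_le_one_right (by positivity) h1
    have h5 : 0 ≤ ‖c‖ * (w * (w + 1)) := by positivity
    nlinarith [norm_nonneg c]
  · rw [Complex.norm_real, Real.norm_of_nonneg (by positivity)]
    refine (mul_le_of_le_one_right (by positivity) h3).trans ?_
    nlinarith

/-- `logPot` away from the origin, extended by zero. -/
def logPotCut (c : ℂ) (w δ R : ℝ) (ζ : ℂ) : ℝ := if R ≤ ‖ζ‖ then logPot c w δ ζ else 0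

lemma sq_le_four_mul_rpow {t q : ℝ} (ht : 1 / 2 < t) (hq : 2 < q) (hq3 : q ≤ 3) :
    t ^ 2 ≤ 4 * t ^ q := by
  have e1 : t ^ q = t ^ 2 * t ^ (q - 2) := by
    rw [← Real.rpow_natCast, ← Real.rpow_add (by linarith)]; congr 1; push_cast; ring
  have e2 : (1 / 4 : ℝ) ≤ t ^ (q - 2) := by
    calc (1 / 4 : ℝ) ≤ (1 / 2) ^ (1 : ℝ) := by norm_num
      _ ≤ (1 / 2) ^ (q - 2) :=
        Real.rpow_le_rpow_of_exponent_ge (by norm_num) (by norm_num) (by linarith)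
      _ ≤ _ := Real.rpow_le_rpow (by norm_num) ht.le (by linarith)
  have := mul_le_mul_of_nonneg_left e2 (sq_nonneg t)
  rw [e1]; linarith

lemma cube_le_rpow {t q : ℝ} (h0 : 0 ≤ t) (h1 : t ≤ 1) (hq : 2 < q) (hq3 : q ≤ 3) :
    t ^ 3 ≤ t ^ q := by
  rcases eq_or_lt_of_le h0 with h | h
  · rw [← h, Real.zero_rpow (by linarith)]; norm_num
  · rw [← Real.rpow_natCast]
    exact Real.rpow_le_rpow_of_exponent_ge h h1 (by simpa using hq3)

/-- Small relative jumps are covered by the local expansion. For `‖τ‖ > 1/2` every term, including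
the logarithmic growth of the function itself, is at most of second degree in `‖τ‖`, hence absorbed
by `‖τ‖^q`. -/
lemma logPotCut_global {c : ℂ} (hc : 0 < c.re) {w δ q : ℝ} (hw : 0 ≤ w) (hδ : 0 ≤ δ)
    (hq : 2 < q) (hq3 : q ≤ 3) : ∃ R C : ℝ, 1 ≤ R ∧ 0 ≤ C ∧ (∀ ζ, 0 ≤ logPotCut c w δ R ζ) ∧
    ∀ ζ τ : ℂ, 0 < ζ.re → 2 * R ≤ ‖ζ‖ →
      logPotCut c w δ R (ζ * (1 + τ)) ≤ logPotCut c w δ R ζ + ((logPotLin c w δ ζ * τ).re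
        + (logPotQuad c w δ ζ * τ ^ 2).re - δ ^ 2 / 4 * ‖ζ‖ ^ (-δ) * ‖τ‖ ^ 2) + C * ‖τ‖ ^ q := by
  obtain ⟨C1, hC1, h1⟩ := logPot_local c hw hδ
  set B : ℝ := ‖c‖ * (Real.pi + 1) + 1 with hB
  have hB0 : 0 ≤ B := by positivity
  set K1 : ℝ := ‖c‖ * (1 + w) + δ with hK1
  set K2 : ℝ := ‖c‖ * (1 + w * (w + 1)) + δ * (δ + 1) with hK2
  have hK10 : 0 ≤ K1 := by positivity
  have hK20 : 0 ≤ K2 := by positivity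
  -- Beyond this radius the lower bound `c.re * log ‖ζ‖ - B` is nonnegative, so extension by zero
  -- keeps the function nonnegative. Starting from `‖ζ‖ ≥ 2 R`, a jump with `‖τ‖ ≤ 1/2` cannot cross
  -- the cut.
  set R : ℝ := Real.exp (B / c.re) with hR
  have hR1 : 1 ≤ R := Real.one_le_exp (by positivity)
  have hpos : ∀ ζ : ℂ, R ≤ ‖ζ‖ → 0 ≤ logPot c w δ ζ := by
    intro ζ hζ
    have h2 := (logPot_bounds c hw hδ (hR1.trans hζ)).1
    have h3 : B / c.re ≤ Real.log ‖ζ‖ := by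
      rw [Real.le_log_iff_exp_le (by linarith)]; exact hζ
    rw [div_le_iff₀ hc] at h3
    linarith
  have hpos' : ∀ ζ, 0 ≤ logPotCut c w δ R ζ := by
    intro ζ
    rw [logPotCut]
    split_ifs with h
    · exact hpos ζ h
    · exact le_rfl
  refine ⟨R, C1 + (8 * c.re + 32 * B + 8 * K1 + 4 * K2 + δ ^ 2), hR1, by positivity, hpos',
    fun ζ τ hζ hζR => ?_⟩
  have hζ1 : 1 ≤ ‖ζ‖ := by linarith
  have hn0 : 0 ≤ ‖ζ‖ ^ (-δ) := by positivity
  have hn1 : ‖ζ‖ ^ (-δ) ≤ 1 := Real.rpow_le_one_of_one_le_of_nonpos hζ1 (by linarith)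
  have hcutζ : logPotCut c w δ R ζ = logPot c w δ ζ := if_pos (by linarith)
  have ht0 := norm_nonneg τ
  have htq : 0 ≤ ‖τ‖ ^ q := by positivity
  rcases le_or_gt ‖τ‖ (1 / 2) with hτ | hτ
  · have h2 : R ≤ ‖ζ * (1 + τ)‖ := by
      rw [norm_mul]
      have h3 : 1 / 2 ≤ ‖1 + τ‖ := by
        have := norm_sub_norm_le (1 : ℂ) (-τ)
        rw [norm_neg, norm_one, sub_neg_eq_add] at this
        linarith
      have h4 := mul_le_mul hζR h3 (by norm_num) (by linarith)
      linarith
    rw [hcutζ, logPotCut, if_pos h2]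
    refine (h1 ζ τ hζ hζ1 hτ).trans ?_
    have h3 : ‖τ‖ ^ 3 ≤ ‖τ‖ ^ q := cube_le_rpow ht0 (by linarith) hq hq3
    have h5 : C1 * ‖τ‖ ^ 3 ≤ (C1 + (8 * c.re + 32 * B + 8 * K1 + 4 * K2 + δ ^ 2)) * ‖τ‖ ^ q := by
      gcongr
      exact le_add_of_nonneg_right (by positivity)
    linarith
  · have hsq : ‖τ‖ ^ 2 ≤ 4 * ‖τ‖ ^ q := sq_le_four_mul_rpow hτ hq hq3
    have hlin : ‖τ‖ ≤ 2 * ‖τ‖ ^ 2 := by nlinarith only [hτ]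
    have hone : 1 ≤ 4 * ‖τ‖ ^ 2 := by nlinarith only [hτ]
    have b1 : -(K1 * ‖τ‖) ≤ (logPotLin c w δ ζ * τ).re := by
      have := (abs_le.1 (Complex.abs_re_le_norm (logPotLin c w δ ζ * τ))).1
      rw [norm_mul] at this
      have h5 := mul_le_mul_of_nonneg_right (norm_logPotLin_le c hw hδ hζ1) ht0
      linarith
    have b2 : -(K2 * ‖τ‖ ^ 2) ≤ (logPotQuad c w δ ζ * τ ^ 2).re := by
      have := (abs_le.1 (Complex.abs_re_le_norm (logPotQuad c w δ ζ * τ ^ 2))).1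
      rw [norm_mul, norm_pow] at this
      have h5 := mul_le_mul_of_nonneg_right (norm_logPotQuad_le c hw hδ hζ1) (sq_nonneg ‖τ‖)
      linarith
    have b3 : δ ^ 2 / 4 * ‖ζ‖ ^ (-δ) * ‖τ‖ ^ 2 ≤ δ ^ 2 / 4 * ‖τ‖ ^ 2 := by
      have : δ ^ 2 / 4 * ‖ζ‖ ^ (-δ) ≤ δ ^ 2 / 4 := mul_le_of_le_one_right (by positivity) hn1
      nlinarith [sq_nonneg ‖τ‖]
    have b4 : logPotCut c w δ R (ζ * (1 + τ)) ≤ logPotCut c w δ R ζ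
        + (c.re * ‖τ‖ + 2 * B) := by
      by_cases h2 : R ≤ ‖ζ * (1 + τ)‖
      · have h3 := (logPot_bounds c hw hδ (hR1.trans h2)).2
        have h4 := (logPot_bounds c hw hδ hζ1).1
        have h5 : Real.log ‖ζ * (1 + τ)‖ ≤ Real.log ‖ζ‖ + ‖τ‖ := by
          have h6 : ‖ζ * (1 + τ)‖ ≤ ‖ζ‖ * (1 + ‖τ‖) := by
            rw [norm_mul]; gcongr
            exact (norm_add_le _ _).trans (by simp)
          refine (Real.log_le_log (by linarith) h6).trans ?_
          rw [Real.log_mul (by linarith) (by linarith)]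
          have := Real.log_le_sub_one_of_pos (by linarith : 0 < 1 + ‖τ‖)
          linarith
        have h7 := mul_le_mul_of_nonneg_left h5 hc.le
        rw [hcutζ, logPotCut, if_pos h2]
        linarith
      · have h3 := hpos' ζ
        rw [logPotCut, if_neg h2]
        positivity
    have hB1 := mul_le_mul_of_nonneg_left hone (by positivity : 0 ≤ 2 * B)
    have hcc := mul_le_mul_of_nonneg_left hlin hc.le
    have hK := mul_le_mul_of_nonneg_left hlin hK10
    have hfin : (2 * c.re + 8 * B + 2 * K1 + K2 + δ ^ 2 / 4) * ‖τ‖ ^ 2 ≤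
        (C1 + (8 * c.re + 32 * B + 8 * K1 + 4 * K2 + δ ^ 2)) * ‖τ‖ ^ q := by
      have h0 : 0 ≤ 2 * c.re + 8 * B + 2 * K1 + K2 + δ ^ 2 / 4 := by positivity
      have h1 := mul_le_mul_of_nonneg_left hsq h0
      have h2 : 0 ≤ C1 * ‖τ‖ ^ q := by positivity
      linarith
    linarith

/-! ### Drift of the nearly harmonic function -/

/-- A real-linear map from the plane to `ℂ`. -/
def toC (t₁ t₂ : ℂ) (x : Plane) : ℂ := t₁ * x 0 + t₂ * x 1

/-- The complex second moment of `toC t₁ t₂` of a vector with second-moment matrix `A`. -/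
def sqMoment (t₁ t₂ : ℂ) (A : Matrix (Fin 2) (Fin 2) ℝ) : ℂ :=
  t₁ ^ 2 * A 0 0 + 2 * (t₁ * t₂) * A 0 1 + t₂ ^ 2 * A 1 1

/-- The absolute second moment of `toC t₁ t₂` of a vector with second-moment matrix `A`. -/
def absMoment (t₁ t₂ : ℂ) (A : Matrix (Fin 2) (Fin 2) ℝ) : ℝ :=
  ‖t₁‖ ^ 2 * A 0 0 + 2 * (t₁ * (starRingEnd ℂ) t₂).re * A 0 1 + ‖t₂‖ ^ 2 * A 1 1

lemma norm_toC_le (t₁ t₂ : ℂ) (x : Plane) : ‖toC t₁ t₂ x‖ ≤ (‖t₁‖ + ‖t₂‖) * ‖x‖ := by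
  refine (norm_add_le _ _).trans ?_
  rw [norm_mul, norm_mul, Complex.norm_real, Complex.norm_real, add_mul]
  gcongr
  · exact abs_apply_le_norm x 0
  · exact abs_apply_le_norm x 1

lemma measurable_toC (t₁ t₂ : ℂ) : Measurable (toC t₁ t₂) := by
  have h : ∀ i : Fin 2, Measurable fun x : Plane => x i := fun i =>
    (EuclideanSpace.proj (𝕜 := ℝ) i).continuous.measurable
  exact ((Complex.measurable_ofReal.comp (h 0)).const_mul t₁).add
    ((Complex.measurable_ofReal.comp (h 1)).const_mul t₂)

lemma measurable_logPotCut (c : ℂ) (w δ R : ℝ) : Measurable (logPotCut c w δ R) := by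
  refine Measurable.ite (measurableSet_le measurable_const measurable_norm) ?_ measurable_const
  refine Measurable.sub (Complex.measurable_re.comp (Measurable.const_mul
    (Complex.measurable_log.sub (measurable_id.pow_const _)) c)) (measurable_norm.pow_const _)

lemma normSq_add_real (t₁ t₂ : ℂ) (a b : ℝ) : ‖t₁ * a + t₂ * b‖ ^ 2 =
    ‖t₁‖ ^ 2 * (a * a) + 2 * (t₁ * (starRingEnd ℂ) t₂).re * (a * b) + ‖t₂‖ ^ 2 * (b * b) := by
  simp only [← Complex.normSq_eq_norm_sq, Complex.normSq_apply]
  simp; ring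

section
variable {S : Set Plane} {κ : Kernel S S} [IsMarkovKernel κ] {q M : ℝ}

/-- The global bound is integrated with `τ = toC Δ / ζ`: the means of `τ`, `τ²` and `‖τ‖²` are the
drift, `sqMoment` and `absMoment` up to powers of `ζ`, and the remainder is of order `‖ζ‖^(-q)`. -/
lemma logPotCut_drift (hM : MomentBound κ q M) (hM0 : 0 ≤ M) (hq : 2 < q) (hq3 : q ≤ 3)
    (t₁ t₂ : ℂ) {c : ℂ} (hc : 0 < c.re) {w δ : ℝ} (hw : 0 ≤ w) (hδ : 0 ≤ δ) :
    ∃ R C : ℝ, 1 ≤ R ∧ 0 ≤ C ∧ (∀ ζ, 0 ≤ logPotCut c w δ R ζ) ∧ ∀ (x : S) (ζ : ℂ),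
      ζ = toC t₁ t₂ x → 0 < ζ.re → 2 * R ≤ ‖ζ‖ →
      ∫⁻ y, ENNReal.ofReal (logPotCut c w δ R (toC t₁ t₂ y)) ∂(κ x) ≤
        ENNReal.ofReal (logPotCut c w δ R ζ +
          ((logPotLin c w δ ζ / ζ * toC t₁ t₂ (meanIncrement κ x)).re
          + (logPotQuad c w δ ζ / ζ ^ 2 * sqMoment t₁ t₂ (secondMoment κ x)).re
          - δ ^ 2 / 4 * (‖ζ‖ ^ (-δ) / ‖ζ‖ ^ 2) * absMoment t₁ t₂ (secondMoment κ x))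
          + C * ‖ζ‖ ^ (-q)) := by
  obtain ⟨R, C, hR, hC, hpos, h⟩ := logPotCut_global hc hw hδ hq hq3
  set K := (‖t₁‖ + ‖t₂‖) with hK
  refine ⟨R, C * K ^ q * (1 + M), hR, by positivity, hpos, fun x ζ hζx hζ hζR => ?_⟩
  have hζ0 : ζ ≠ 0 := by rintro rfl; simp at hζ
  have hn : 0 < ‖ζ‖ := norm_pos_iff.2 hζ0
  set A1 := logPotLin c w δ ζ with hA1
  set A2 := logPotQuad c w δ ζ with hA2
  set k := δ ^ 2 / 4 * (‖ζ‖ ^ (-δ) / ‖ζ‖ ^ 2) with hk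
  have key := hM.lintegral_le hq x (f := fun y : S => logPotCut c w δ R (toC t₁ t₂ y))
    (fun y => hpos _) (b₀ := (A1 / ζ * t₁).re) (b₁ := (A1 / ζ * t₂).re)
    (q₀ := (A2 / ζ ^ 2 * t₁ ^ 2).re - k * ‖t₁‖ ^ 2)
    (q₁ := (A2 / ζ ^ 2 * (2 * (t₁ * t₂))).re - k * (2 * (t₁ * (starRingEnd ℂ) t₂).re))
    (q₂ := (A2 / ζ ^ 2 * t₂ ^ 2).re - k * ‖t₂‖ ^ 2) (E := C * K ^ q * ‖ζ‖ ^ (-q))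
    (by positivity) ?_
  · refine key.trans (ENNReal.ofReal_le_ofReal (le_of_eq ?_))
    have e1 : (A1 / ζ * toC t₁ t₂ (meanIncrement κ x)).re =
        (A1 / ζ * t₁).re * meanIncrement κ x 0 + (A1 / ζ * t₂).re * meanIncrement κ x 1 := by
      rw [toC, ← Complex.re_mul_ofReal, ← Complex.re_mul_ofReal, ← Complex.add_re]
      congr 1; ring
    have e2 : (A2 / ζ ^ 2 * sqMoment t₁ t₂ (secondMoment κ x)).re =
        (A2 / ζ ^ 2 * t₁ ^ 2).re * secondMoment κ x 0 0 +
        (A2 / ζ ^ 2 * (2 * (t₁ * t₂))).re * secondMoment κ x 0 1 +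
        (A2 / ζ ^ 2 * t₂ ^ 2).re * secondMoment κ x 1 1 := by
      rw [sqMoment, ← Complex.re_mul_ofReal, ← Complex.re_mul_ofReal, ← Complex.re_mul_ofReal,
        ← Complex.add_re, ← Complex.add_re]
      congr 1; ring
    simp only [e1, e2, absMoment, ← hζx]
    ring
  · intro y
    set Δ : Plane := (y : Plane) - (x : Plane) with hΔ
    set τ : ℂ := (t₁ * Δ 0 + t₂ * Δ 1) / ζ with hτ
    have hy : toC t₁ t₂ y = ζ * (1 + τ) := by
      rw [mul_add, mul_one, hτ, mul_div_cancel₀ _ hζ0, hζx, toC, toC, hΔ]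
      simp only [PiLp.sub_apply]
      push_cast; ring
    have h1 := h ζ τ hζ hζR
    simp only [hy, ← hζx]
    refine h1.trans ?_
    have e1 : (A1 * τ).re = (A1 / ζ * t₁).re * Δ 0 + (A1 / ζ * t₂).re * Δ 1 := by
      rw [← Complex.re_mul_ofReal, ← Complex.re_mul_ofReal, ← Complex.add_re, hτ]
      congr 1; ring
    have e2 : (A2 * τ ^ 2).re = (A2 / ζ ^ 2 * t₁ ^ 2).re * (Δ 0 * Δ 0) +
        (A2 / ζ ^ 2 * (2 * (t₁ * t₂))).re * (Δ 0 * Δ 1) +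
        (A2 / ζ ^ 2 * t₂ ^ 2).re * (Δ 1 * Δ 1) := by
      rw [← Complex.re_mul_ofReal, ← Complex.re_mul_ofReal, ← Complex.re_mul_ofReal,
        ← Complex.add_re, ← Complex.add_re, hτ]
      congr 1; push_cast; ring
    have e3 : δ ^ 2 / 4 * ‖ζ‖ ^ (-δ) * ‖τ‖ ^ 2 = k * (‖t₁‖ ^ 2 * (Δ 0 * Δ 0) +
        2 * (t₁ * (starRingEnd ℂ) t₂).re * (Δ 0 * Δ 1) + ‖t₂‖ ^ 2 * (Δ 1 * Δ 1)) := by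
      rw [← normSq_add_real, hτ, norm_div, hk]; ring
    have e4 : C * ‖τ‖ ^ q ≤ C * K ^ q * ‖ζ‖ ^ (-q) * (1 + ‖Δ‖ ^ q) := by
      have h2 : ‖τ‖ ≤ K * ‖Δ‖ * ‖ζ‖⁻¹ := by
        rw [hτ, norm_div, div_eq_mul_inv]
        gcongr
        exact norm_toC_le t₁ t₂ Δ
      have h3 : ‖τ‖ ^ q ≤ K ^ q * ‖Δ‖ ^ q * ‖ζ‖ ^ (-q) := by
        refine (Real.rpow_le_rpow (norm_nonneg _) h2 (by linarith)).trans (le_of_eq ?_)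
        rw [Real.mul_rpow (by positivity) (by positivity), Real.mul_rpow (by positivity)
          (by positivity), Real.inv_rpow hn.le, Real.rpow_neg hn.le]
      have h4 : 0 ≤ C * (K ^ q * ‖ζ‖ ^ (-q)) := by positivity
      have := mul_le_mul_of_nonneg_left h3 hC
      linarith
    rw [e1, e2, e3]
    linarith

end

/-- Far out near the imaginary axis, `Re (ζ^{-w} / ζ)` is strictly negative. -/
lemma exists_re_cpow_div_le {w : ℝ} (hw : 0 < w) (hw1 : w < 1) : ∃ ε c : ℝ, 0 < ε ∧ 0 < c ∧
    ∀ ζ : ℂ, 0 < ζ.re → ζ.re ≤ ε * ‖ζ‖ →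
      (ζ ^ ((-w : ℝ) : ℂ) / ζ).re ≤ -c * (‖ζ‖ ^ (-w) / ‖ζ‖) := by
  have hpi := Real.pi_pos
  -- Dividing by `1 + w/2` puts `φ₀` below `π/2` but `(1 + w) φ₀` above it, so the cosine of `(1 +
  -- w)` times the argument is bounded away from zero, and negative, outside the cone of half-angle
  -- `φ₀`.
  set φ₀ : ℝ := (Real.pi / 2) / (1 + w / 2) with hφ
  have hφ0 : 0 < φ₀ := by positivity
  have hφ1 : φ₀ < Real.pi / 2 := by rw [hφ, div_lt_iff₀ (by positivity)]; nlinarith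
  have hφ2 : Real.pi / 2 < (1 + w) * φ₀ := by
    rw [hφ, mul_div_assoc', lt_div_iff₀ (by positivity)]; nlinarith
  have hφ3 : (1 + w) * φ₀ < Real.pi := by nlinarith
  refine ⟨Real.cos φ₀, -Real.cos ((1 + w) * φ₀), Real.cos_pos_of_mem_Ioo ⟨by linarith, hφ1⟩,
    neg_pos.2 (Real.cos_neg_of_pi_div_two_lt_of_lt hφ2 (by linarith)), fun ζ hζ hζ' => ?_⟩
  have hζ0 : ζ ≠ 0 := by rintro rfl; simp at hζ
  have hn : 0 < ‖ζ‖ := norm_pos_iff.2 hζ0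
  have harg' := Complex.abs_arg_lt_pi_div_two_iff.2 (Or.inl hζ)
  have hcos : Real.cos |ζ.arg| ≤ Real.cos φ₀ := by
    rw [Real.cos_abs, Complex.cos_arg hζ0, div_le_iff₀ hn]; exact hζ'
  have hge : φ₀ ≤ |ζ.arg| := by
    by_contra! h
    exact absurd hcos (not_le.2 (Real.cos_lt_cos_of_nonneg_of_le_pi (abs_nonneg _)
      (by linarith) h))
  have e1 : ζ ^ ((-w : ℝ) : ℂ) / ζ = ζ ^ ((-(1 + w) : ℝ) : ℂ) := by
    rw [div_eq_mul_inv, ← Complex.cpow_neg_one, ← Complex.cpow_add _ _ hζ0]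
    congr 1; push_cast; ring
  have e2 : (ζ ^ ((-(1 + w) : ℝ) : ℂ)).re = ‖ζ‖ ^ (-(1 + w)) * Real.cos ((1 + w) * |ζ.arg|) := by
    rw [Complex.cpow_ofReal_re]
    congr 1
    rw [← Real.cos_abs, abs_mul, abs_neg, abs_of_pos (by linarith : 0 < 1 + w), mul_comm]
  have e3 : ‖ζ‖ ^ (-w) / ‖ζ‖ = ‖ζ‖ ^ (-(1 + w)) := by
    rw [div_eq_mul_inv, ← Real.rpow_neg_one, ← Real.rpow_add hn]; congr 1; ring
  have e4 : Real.cos ((1 + w) * |ζ.arg|) ≤ Real.cos ((1 + w) * φ₀) := by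
    refine Real.cos_le_cos_of_nonneg_of_le_pi (by positivity) ?_ (by gcongr)
    nlinarith
  rw [e1, e2, e3, neg_neg, mul_comm (Real.cos _)]
  gcongr

lemma sqMoment_sub (t₁ t₂ : ℂ) (A B : Matrix (Fin 2) (Fin 2) ℝ) :
    sqMoment t₁ t₂ (A - B) = sqMoment t₁ t₂ A - sqMoment t₁ t₂ B := by
  simp only [sqMoment, Matrix.sub_apply]; push_cast; ring

lemma absMoment_sub (t₁ t₂ : ℂ) (A B : Matrix (Fin 2) (Fin 2) ℝ) :
    absMoment t₁ t₂ (A - B) = absMoment t₁ t₂ A - absMoment t₁ t₂ B := by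
  simp only [absMoment, Matrix.sub_apply]; ring

lemma norm_sqMoment_le (t₁ t₂ : ℂ) {A : Matrix (Fin 2) (Fin 2) ℝ} {e : ℝ}
    (h : ∀ i j, |A i j| ≤ e) : ‖sqMoment t₁ t₂ A‖ ≤ (‖t₁‖ + ‖t₂‖) ^ 2 * e := by
  have h1 : ‖t₁ ^ 2 * (A 0 0 : ℂ)‖ ≤ ‖t₁‖ ^ 2 * e := by
    rw [norm_mul, norm_pow, Complex.norm_real]; gcongr; exact h 0 0
  have h2 : ‖2 * (t₁ * t₂) * (A 0 1 : ℂ)‖ ≤ 2 * (‖t₁‖ * ‖t₂‖) * e := by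
    rw [norm_mul, norm_mul, norm_mul, Complex.norm_real, Complex.norm_ofNat]; gcongr; exact h 0 1
  have h3 : ‖t₂ ^ 2 * (A 1 1 : ℂ)‖ ≤ ‖t₂‖ ^ 2 * e := by
    rw [norm_mul, norm_pow, Complex.norm_real]; gcongr; exact h 1 1
  have := norm_add₃_le (a := t₁ ^ 2 * (A 0 0 : ℂ)) (b := 2 * (t₁ * t₂) * (A 0 1 : ℂ))
    (c := t₂ ^ 2 * (A 1 1 : ℂ))
  rw [sqMoment]
  linarith

lemma abs_absMoment_le (t₁ t₂ : ℂ) {A : Matrix (Fin 2) (Fin 2) ℝ} {e : ℝ}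
    (h : ∀ i j, |A i j| ≤ e) : |absMoment t₁ t₂ A| ≤ (‖t₁‖ + ‖t₂‖) ^ 2 * e := by
  have h1 : |‖t₁‖ ^ 2 * A 0 0| ≤ ‖t₁‖ ^ 2 * e := by
    rw [abs_mul, abs_of_nonneg (by positivity : 0 ≤ ‖t₁‖ ^ 2)]; gcongr; exact h 0 0
  have h2 : |2 * (t₁ * (starRingEnd ℂ) t₂).re * A 0 1| ≤ 2 * (‖t₁‖ * ‖t₂‖) * e := by
    have := Complex.abs_re_le_norm (t₁ * (starRingEnd ℂ) t₂)
    rw [norm_mul, Complex.norm_conj] at this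
    rw [abs_mul, abs_mul, abs_two]; gcongr; exact h 0 1
  have h3 : |‖t₂‖ ^ 2 * A 1 1| ≤ ‖t₂‖ ^ 2 * e := by
    rw [abs_mul, abs_of_nonneg (by positivity : 0 ≤ ‖t₂‖ ^ 2)]; gcongr; exact h 1 1
  have := abs_add_three (‖t₁‖ ^ 2 * A 0 0) (2 * (t₁ * (starRingEnd ℂ) t₂).re * A 0 1)
    (‖t₂‖ ^ 2 * A 1 1)
  rw [absMoment]
  linarith

/-- The drift of the nearly harmonic function is negative at the boundary. -/
lemma logPot_boundary_drift {v : ℂ} (hv : v ≠ 0) {w δ θ : ℝ} (hw : 0 < w) (hw1 : w < 1)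
    (hwδ : w < δ) (hwθ : w < 1 - θ) {μ₀ : ℝ} (hμ₀ : 0 < μ₀) (K C : ℝ) :
    ∀ᶠ ρ : ℝ in atTop, ∀ (ζ m : ℂ) (μ : ℝ), ‖ζ‖ = ρ → 0 < ζ.re → ζ.re ≤ K * ρ ^ θ → μ₀ ≤ μ →
      ‖m - μ * v‖ ≤ K * ρ⁻¹ + μ * (K * ρ ^ (θ - 1)) →
      (logPotLin v⁻¹ w δ ζ / ζ * m).re + C * ρ ^ (-2 : ℝ) ≤ 0 := by
  obtain ⟨ε, c, hε, hc, hneg⟩ := exists_re_cpow_div_le hw hw1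
  have hδ : 0 < δ := hw.trans hwδ
  set L := ‖v⁻¹‖ * (1 + w) + δ with hL
  have hL0 : 0 ≤ L := by positivity
  -- The main term has order `ρ^(-w-1)`. It beats `ρ^(θ-2)` since `w < 1 - θ`, `ρ^(-δ-1)` since `w <
  -- δ`, and `ρ^(-2)` since `w < 1`; the first power comparison puts `ζ` near the imaginary axis.
  filter_upwards [eventually_ge_atTop 1,
    eventually_mul_rpow_le (show θ < 1 by linarith) K hε,
    eventually_mul_rpow_le (show θ - 2 < -w - 1 by linarith) (K + L * K)
      (show 0 < w * c / 4 by positivity),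
    eventually_mul_rpow_le (show -δ - 1 < -w - 1 by linarith) (δ * ‖v‖)
      (show 0 < w * c / 4 by positivity),
    eventually_mul_rpow_le (show (-2 : ℝ) < -w - 1 by linarith) (L * K + C)
      (show 0 < μ₀ * (w * c / 2) by positivity)] with ρ h1 h2 h3 h4 h5 ζ m μ hρ hζ hζθ hμ hm
  have hρ0 : 0 < ρ := by linarith
  have hζ0 : ζ ≠ 0 := by rintro rfl; simp at hζ
  have hμ0 : 0 < μ := hμ₀.trans_le hμ
  have hA := norm_logPotLin_le v⁻¹ hw.le hδ.le (ζ := ζ) (by rw [hρ]; exact h1)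
  set A := logPotLin v⁻¹ w δ ζ with hAdef
  have p1 : ρ ^ (-δ - 1) = ρ ^ (-δ) / ρ := by rw [Real.rpow_sub_one hρ0.ne']
  have p2 : ρ ^ (-w - 1) = ρ ^ (-w) / ρ := by rw [Real.rpow_sub_one hρ0.ne']
  have p3 : ρ ^ (-2 : ℝ) = ρ⁻¹ * ρ⁻¹ := by
    rw [← Real.rpow_neg_one, ← Real.rpow_add hρ0]; norm_num
  have p4 : ρ ^ (θ - 2) = ρ⁻¹ * ρ ^ (θ - 1) := by
    rw [← Real.rpow_neg_one, ← Real.rpow_add hρ0]; congr 1; ring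
  have p5 : ρ ^ (θ - 2) = ρ ^ θ / ρ ^ 2 := by
    rw [Real.rpow_sub hρ0]; norm_num
  -- the contribution of the deviation of the drift from its direction
  have e1 : (A / ζ * (m - μ * v)).re ≤ L * K * ρ ^ (-2 : ℝ) + μ * (L * K * ρ ^ (θ - 2)) := by
    refine (Complex.re_le_norm _).trans ?_
    rw [norm_mul, norm_div, hρ]
    calc ‖A‖ / ρ * ‖m - μ * v‖ ≤ L / ρ * (K * ρ⁻¹ + μ * (K * ρ ^ (θ - 1))) := by gcongr
      _ = _ := by rw [p3, p4, div_eq_mul_inv]; ring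
  have e2 : (A / ζ * v).re ≤ K * ρ ^ (θ - 2) - w * c * ρ ^ (-w - 1) + δ * ‖v‖ * ρ ^ (-δ - 1) := by
    -- The choice `c = v⁻¹` turns the logarithmic part into `1/ζ`, whose real part is `ζ.re / ρ²`
    -- and hence small near the imaginary axis.
    have e3 : A / ζ * v = ζ⁻¹ + w * (ζ ^ ((-w : ℝ) : ℂ) / ζ) + ((δ * ρ ^ (-δ) : ℝ) : ℂ) * (v / ζ) := by
      rw [hAdef, logPotLin, hρ]; field_simp
    rw [e3, Complex.add_re, Complex.add_re, Complex.re_ofReal_mul, Complex.re_ofReal_mul]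
    have f1 : (ζ⁻¹).re ≤ K * ρ ^ (θ - 2) := by
      rw [Complex.inv_re, Complex.normSq_eq_norm_sq, hρ, p5, mul_div_assoc']
      gcongr
    have f2 : w * (ζ ^ ((-w : ℝ) : ℂ) / ζ).re ≤ -(w * c * ρ ^ (-w - 1)) := by
      have := hneg ζ hζ (by rw [hρ]; rw [Real.rpow_one] at h2; exact hζθ.trans h2)
      rw [hρ] at this
      rw [p2]
      nlinarith
    have f3 : δ * ρ ^ (-δ) * (v / ζ).re ≤ δ * ‖v‖ * ρ ^ (-δ - 1) := by
      have : (v / ζ).re ≤ ‖v‖ / ρ := by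
        refine (Complex.re_le_norm _).trans ?_
        rw [norm_div, hρ]
      calc _ ≤ δ * ρ ^ (-δ) * (‖v‖ / ρ) := by gcongr
        _ = _ := by rw [p1]; ring
    linarith
  have e4 : (A / ζ * m).re = (A / ζ * (m - μ * v)).re + μ * (A / ζ * v).re := by
    rw [← Complex.re_ofReal_mul, ← Complex.add_re]; congr 1; ring
  rw [e4]
  have hX : 0 ≤ ρ ^ (-w - 1) := by positivity
  -- Errors proportional to `μ` are absorbed into `μ` times the main term before `μ₀` is used, so no
  -- upper bound on `μ` is needed.
  have g1 : μ * (A / ζ * v).re + μ * (L * K * ρ ^ (θ - 2)) ≤ -(μ * (w * c / 2 * ρ ^ (-w - 1))) := by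
    have : (A / ζ * v).re + L * K * ρ ^ (θ - 2) ≤ -(w * c / 2 * ρ ^ (-w - 1)) := by linarith
    have := mul_le_mul_of_nonneg_left this hμ0.le
    linarith
  have g2 : μ₀ * (w * c / 2 * ρ ^ (-w - 1)) ≤ μ * (w * c / 2 * ρ ^ (-w - 1)) := by gcongr
  linarith

/-- The drift of the nearly harmonic function is negative in the interior. -/
lemma logPot_interior_drift {c t₁ t₂ : ℂ} {A : Matrix (Fin 2) (Fin 2) ℝ}
    (hsq : sqMoment t₁ t₂ A = 0) (habs : 0 < absMoment t₁ t₂ A) {w δ ε q : ℝ} (hw : 0 ≤ w)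
    (hδ : 0 < δ) (hδε : δ < ε) (hδq : 2 + δ < q) (K C : ℝ) :
    ∀ᶠ ρ : ℝ in atTop, ∀ (ζ m : ℂ) (B : Matrix (Fin 2) (Fin 2) ℝ), ‖ζ‖ = ρ →
      ‖m‖ ≤ K * ρ ^ (-1 - ε) → (∀ i j, |(B - A) i j| ≤ K * ρ ^ (-ε)) →
      (logPotLin c w δ ζ / ζ * m).re + (logPotQuad c w δ ζ / ζ ^ 2 * sqMoment t₁ t₂ B).re
        - δ ^ 2 / 4 * (‖ζ‖ ^ (-δ) / ‖ζ‖ ^ 2) * absMoment t₁ t₂ B + C * ρ ^ (-q) ≤ 0 := by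
  set L := ‖c‖ * (1 + w) + δ with hL
  set L' := ‖c‖ * (1 + w * (w + 1)) + δ * (δ + 1) with hL'
  set T := (‖t₁‖ + ‖t₂‖) ^ 2 with hT
  set v := absMoment t₁ t₂ A with hv
  -- The negative term of order `ρ^(-2-δ)` has to beat the drift and covariance errors `ρ^(-2-ε)`
  -- and the Taylor remainder `ρ^(-q)`.
  filter_upwards [eventually_ge_atTop 1,
    eventually_mul_rpow_le (show -2 - ε < -2 - δ by linarith) (L * K + L' * (T * K))
      (show 0 < δ ^ 2 / 4 * v / 4 by positivity),
    eventually_mul_rpow_le (show -q < -2 - δ by linarith) C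
      (show 0 < δ ^ 2 / 4 * v / 4 by positivity),
    eventually_mul_rpow_le (show -ε < 0 by linarith) (T * K) (show 0 < v / 2 by positivity)]
    with ρ h1 h2 h3 h4 ζ m B hρ hm hB
  have hρ0 : 0 < ρ := by linarith
  have hA1 := norm_logPotLin_le c hw hδ.le (ζ := ζ) (by rw [hρ]; exact h1)
  have hA2 := norm_logPotQuad_le c hw hδ.le (ζ := ζ) (by rw [hρ]; exact h1)
  have p1 : ρ ^ (-2 - ε) = ρ⁻¹ * ρ ^ (-1 - ε) := by
    rw [← Real.rpow_neg_one, ← Real.rpow_add hρ0]; congr 1; ring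
  have p2 : ρ ^ (-2 - ε) = ρ ^ (-ε) / ρ ^ 2 := by
    rw [show -2 - ε = -ε - 2 by ring, Real.rpow_sub hρ0]; norm_num
  have p3 : ρ ^ (-2 - δ) = ρ ^ (-δ) / ρ ^ 2 := by
    rw [show -2 - δ = -δ - 2 by ring, Real.rpow_sub hρ0]; norm_num
  have e1 : (logPotLin c w δ ζ / ζ * m).re ≤ L * K * ρ ^ (-2 - ε) := by
    refine (Complex.re_le_norm _).trans ?_
    rw [norm_mul, norm_div, hρ]
    calc ‖logPotLin c w δ ζ‖ / ρ * ‖m‖ ≤ L / ρ * (K * ρ ^ (-1 - ε)) := by gcongr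
      _ = _ := by rw [p1, div_eq_mul_inv]; ring
  have e2 : (logPotQuad c w δ ζ / ζ ^ 2 * sqMoment t₁ t₂ B).re ≤ L' * (T * K) * ρ ^ (-2 - ε) := by
    refine (Complex.re_le_norm _).trans ?_
    have h5 := norm_sqMoment_le t₁ t₂ hB
    rw [sqMoment_sub, hsq, sub_zero] at h5
    rw [norm_mul, norm_div, norm_pow, hρ]
    calc ‖logPotQuad c w δ ζ‖ / ρ ^ 2 * ‖sqMoment t₁ t₂ B‖ ≤
          L' / ρ ^ 2 * (T * (K * ρ ^ (-ε))) := by gcongr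
      _ = _ := by rw [p2]; ring
  have e3 : v / 2 ≤ absMoment t₁ t₂ B := by
    have h5 := (abs_le.1 (abs_absMoment_le t₁ t₂ hB)).1
    rw [absMoment_sub] at h5
    rw [Real.rpow_zero] at h4
    linarith
  have e4 : δ ^ 2 / 4 * v / 2 * ρ ^ (-2 - δ) ≤
      δ ^ 2 / 4 * (‖ζ‖ ^ (-δ) / ‖ζ‖ ^ 2) * absMoment t₁ t₂ B := by
    rw [hρ, ← p3]
    have h6 : 0 ≤ δ ^ 2 / 4 * ρ ^ (-2 - δ) := by positivity
    have := mul_le_mul_of_nonneg_left e3 h6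
    linarith
  linarith

/-- At the boundary no limiting covariance is assumed, so the second-order part is bounded crudely
by a multiple of `‖ζ‖^(-2)`; the boundary drift of order `‖ζ‖^(-w-1)` is larger. -/
lemma logPotQuad_term_le {c t₁ t₂ : ℂ} {w δ : ℝ} (hw : 0 ≤ w) (hδ : 0 ≤ δ)
    {B : Matrix (Fin 2) (Fin 2) ℝ} {e : ℝ} (he : 0 ≤ e) (hB : ∀ i j, |B i j| ≤ e) {ζ : ℂ}
    (hζ : 1 ≤ ‖ζ‖) :
    (logPotQuad c w δ ζ / ζ ^ 2 * sqMoment t₁ t₂ B).re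
        - δ ^ 2 / 4 * (‖ζ‖ ^ (-δ) / ‖ζ‖ ^ 2) * absMoment t₁ t₂ B ≤
      (‖c‖ * (1 + w * (w + 1)) + δ * (δ + 1) + δ ^ 2 / 4) * ((‖t₁‖ + ‖t₂‖) ^ 2 * e)
        * ‖ζ‖ ^ (-2 : ℝ) := by
  set T := (‖t₁‖ + ‖t₂‖) ^ 2 * e with hT
  have hT0 : 0 ≤ T := by positivity
  have hn : 0 < ‖ζ‖ := by linarith
  have hA2 := norm_logPotQuad_le c hw hδ hζ
  set L' := ‖c‖ * (1 + w * (w + 1)) + δ * (δ + 1) with hL'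
  have p : ‖ζ‖ ^ (-2 : ℝ) = (‖ζ‖ ^ 2)⁻¹ := by rw [Real.rpow_neg hn.le]; norm_num
  have e1 : (logPotQuad c w δ ζ / ζ ^ 2 * sqMoment t₁ t₂ B).re ≤ L' * T * ‖ζ‖ ^ (-2 : ℝ) := by
    refine (Complex.re_le_norm _).trans ?_
    rw [norm_mul, norm_div, norm_pow, p]
    calc ‖logPotQuad c w δ ζ‖ / ‖ζ‖ ^ 2 * ‖sqMoment t₁ t₂ B‖ ≤ L' / ‖ζ‖ ^ 2 * T := by
          gcongr; exact norm_sqMoment_le t₁ t₂ hB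
      _ = _ := by rw [div_eq_mul_inv]; ring
  have e2 : -(δ ^ 2 / 4 * T * ‖ζ‖ ^ (-2 : ℝ)) ≤
      δ ^ 2 / 4 * (‖ζ‖ ^ (-δ) / ‖ζ‖ ^ 2) * absMoment t₁ t₂ B := by
    have h1 := (abs_le.1 (abs_absMoment_le t₁ t₂ hB)).1
    have h2 : ‖ζ‖ ^ (-δ) ≤ 1 := Real.rpow_le_one_of_one_le_of_nonpos hζ (by linarith)
    have h3 : 0 ≤ δ ^ 2 / 4 * (‖ζ‖ ^ (-δ) / ‖ζ‖ ^ 2) := by positivity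
    have h4 : δ ^ 2 / 4 * (‖ζ‖ ^ (-δ) / ‖ζ‖ ^ 2) ≤ δ ^ 2 / 4 * ‖ζ‖ ^ (-2 : ℝ) := by
      rw [p, div_eq_mul_inv]
      gcongr
      exact mul_le_of_le_one_left (by positivity) h2
    have h5 := mul_le_mul_of_nonneg_left h1 h3
    have h6 := mul_le_mul_of_nonneg_right h4 hT0
    linarith
  linarith

/-! ### Reflection vectors in coordinates -/

/-- The unnormalised reflection vector at the upper (`s = 1`) or lower (`s = -1`) curve, where `n`
is the slope of the curve. -/
def reflVec (s n α : ℝ) : Plane :=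
  !₂[Real.cos α * n + s * Real.sin α, Real.sin α * n - s * Real.cos α]

lemma reflUpper_eq (a β z α : ℝ) : reflUpper a β z α =
    (√((a * β * z ^ (β - 1)) ^ 2 + 1))⁻¹ • reflVec 1 (a * β * z ^ (β - 1)) α := by
  have h : ‖normalUpper a β z‖ = √((a * β * z ^ (β - 1)) ^ 2 + 1) := by
    rw [normalUpper, EuclideanSpace.norm_eq]; simp [Fin.sum_univ_two]
  rw [reflUpper, h]
  ext i
  fin_cases i <;> simp [rotate, reflVec, normalUpper] <;> ring

/-- A clockwise rotation by `-α` is an anticlockwise rotation by `α`: both sides are rotated alike,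
and only the sign of the vertical component of the normal distinguishes them. -/
lemma reflLower_neg_eq (a β z α : ℝ) : reflLower a β z (-α) =
    (√((a * β * z ^ (β - 1)) ^ 2 + 1))⁻¹ • reflVec (-1) (a * β * z ^ (β - 1)) α := by
  have h : ‖normalLower a β z‖ = √((a * β * z ^ (β - 1)) ^ 2 + 1) := by
    rw [normalLower, EuclideanSpace.norm_eq]; simp [Fin.sum_univ_two]
  rw [reflLower, h]
  ext i
  fin_cases i <;> simp [rotate, reflVec, normalLower] <;> ring

lemma norm_le_add_abs (x : Plane) : ‖x‖ ≤ |x 0| + |x 1| := by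
  rw [EuclideanSpace.norm_eq, Fin.sum_univ_two]
  refine Real.sqrt_le_iff.2 ⟨by positivity, ?_⟩
  simp only [Real.norm_eq_abs]
  nlinarith [abs_nonneg (x 0), abs_nonneg (x 1)]

/-- A steep reflection vector is almost horizontal before rotation. -/
lemma norm_toC_reflVec_sub_le (t₁ t₂ : ℂ) (α : ℝ) {s n : ℝ} (hs : |s| = 1) (hn : 0 < n) :
    ‖toC t₁ t₂ ((√(n ^ 2 + 1))⁻¹ • reflVec s n α) - (t₁ * Real.cos α + t₂ * Real.sin α)‖ ≤
      2 * (‖t₁‖ + ‖t₂‖) * n⁻¹ := by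
  set N := √(n ^ 2 + 1) with hN
  have h1 : n ≤ N := Real.le_sqrt_of_sq_le (by linarith)
  have h2 : N ≤ n + 1 := by
    rw [hN, Real.sqrt_le_iff]; exact ⟨by linarith, by nlinarith⟩
  have hN0 : 0 < N := hn.trans_le h1
  have h3 : N⁻¹ ≤ n⁻¹ := inv_anti₀ hn h1
  have h4 : |N⁻¹ * n - 1| ≤ n⁻¹ := by
    have e : N⁻¹ * n - 1 = -((N - n) * N⁻¹) := by field_simp; ring
    rw [e, abs_neg, abs_of_nonneg (mul_nonneg (by linarith) (by positivity))]
    calc (N - n) * N⁻¹ ≤ 1 * n⁻¹ := by gcongr; linarith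
      _ = _ := one_mul _
  have hc := Real.abs_cos_le_one α
  have hsi := Real.abs_sin_le_one α
  have e0 : |N⁻¹ * (Real.cos α * n + s * Real.sin α) - Real.cos α| ≤ 2 * n⁻¹ := by
    have e : N⁻¹ * (Real.cos α * n + s * Real.sin α) - Real.cos α =
      Real.cos α * (N⁻¹ * n - 1) + s * Real.sin α * N⁻¹ := by ring
    rw [e]
    refine (abs_add_le _ _).trans ?_
    rw [abs_mul, abs_mul, abs_mul, hs, one_mul, abs_of_pos (inv_pos.2 hN0)]
    have := mul_le_mul hc h4 (abs_nonneg _) zero_le_one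
    have := mul_le_mul hsi h3 (inv_pos.2 hN0).le zero_le_one
    linarith
  have e1 : |N⁻¹ * (Real.sin α * n - s * Real.cos α) - Real.sin α| ≤ 2 * n⁻¹ := by
    have e : N⁻¹ * (Real.sin α * n - s * Real.cos α) - Real.sin α =
      Real.sin α * (N⁻¹ * n - 1) - s * Real.cos α * N⁻¹ := by ring
    rw [e]
    refine (abs_sub _ _).trans ?_
    rw [abs_mul, abs_mul, abs_mul, hs, one_mul, abs_of_pos (inv_pos.2 hN0)]
    have := mul_le_mul hsi h4 (abs_nonneg _) zero_le_one
    have := mul_le_mul hc h3 (inv_pos.2 hN0).le zero_le_one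
    linarith
  have e2 : toC t₁ t₂ (N⁻¹ • reflVec s n α) - (t₁ * Real.cos α + t₂ * Real.sin α) =
      t₁ * ((N⁻¹ * (Real.cos α * n + s * Real.sin α) - Real.cos α : ℝ) : ℂ) +
      t₂ * ((N⁻¹ * (Real.sin α * n - s * Real.cos α) - Real.sin α : ℝ) : ℂ) := by
    simp only [toC, reflVec, PiLp.smul_apply, smul_eq_mul]
    simp
    ring
  rw [e2]
  refine (norm_add_le _ _).trans ?_
  rw [norm_mul, norm_mul, Complex.norm_real, Complex.norm_real, Real.norm_eq_abs, Real.norm_eq_abs]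
  have := mul_le_mul_of_nonneg_left e0 (norm_nonneg t₁)
  have := mul_le_mul_of_nonneg_left e1 (norm_nonneg t₂)
  linarith

/-! ### Points near the boundary of a superlinear domain -/

lemma le_rpow_of_mul_rpow_le {a β w s : ℝ} (ha : 0 < a) (hβ : 0 < β) (hw : 0 ≤ w)
    (h : a * w ^ β ≤ s) : w ≤ (s / a) ^ (1 / β) := by
  have h1 : w ^ β ≤ s / a := by rw [le_div_iff₀ ha]; linarith
  calc w = (w ^ β) ^ (1 / β) := by
        rw [← Real.rpow_mul hw, mul_one_div_cancel hβ.ne', Real.rpow_one]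
    _ ≤ _ := Real.rpow_le_rpow (by positivity) h1 (by positivity)

/-- Here `(z, t)` is a far point of a half of the domain, reflected if necessary, and `(w, u)` a
nearby exterior point. The exterior point is left of the axis, beyond the opposite curve, or beyond
the curve of this half. In the first two cases `z` is bounded; in the third `a₁ w^β₁ < 2 r`. So `z`
is at most of order `r^θ` and `t ≥ r/2`; then `z^β₁ ≥ r / (2 a₁)` makes the slope large. -/
lemma superlinear_side {a₁ a₂ β₁ β₂ B θ : ℝ} (ha₁ : 0 < a₁) (ha₂ : 0 < a₂) (hβ₁ : 1 < β₁)
    (hβ₂ : 1 < β₂) (hB : 0 ≤ B) (hθ₁ : 1 / β₁ ≤ θ) (hθ : θ < 1) :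
    ∃ C : ℝ, 0 ≤ C ∧ ∀ᶠ r : ℝ in atTop, ∀ z t w u : ℝ, 0 ≤ z → 0 ≤ t → r ≤ z + t → t ≤ r →
      t ≤ a₁ * z ^ β₁ → |z - w| ≤ B → |t - u| ≤ B →
      ¬ (0 ≤ w ∧ -(a₂ * w ^ β₂) ≤ u ∧ u ≤ a₁ * w ^ β₁) →
      0 < t ∧ 0 < z ∧ z ≤ C * r ^ θ ∧ (a₁ * β₁ * z ^ (β₁ - 1))⁻¹ ≤ C * r ^ (θ - 1) := by
  have hβ₁0 : 0 < β₁ := by linarith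
  have hβ₂0 : 0 < β₂ := by linarith
  have hθ0 : 0 < θ := lt_of_lt_of_le (by positivity) hθ₁
  set C₀ := (2 / a₁) ^ (1 / β₁) + (B / a₂) ^ (1 / β₂) + B with hC₀
  set C₁ := (a₁ * β₁)⁻¹ * (2 * a₁) ^ (1 - 1 / β₁) with hC₁
  have hC₀0 : 0 ≤ C₀ := by positivity
  have hC₁0 : 0 ≤ C₁ := by positivity
  refine ⟨C₀ + C₁, by positivity, ?_⟩
  filter_upwards [eventually_ge_atTop 1, eventually_ge_atTop B,
    eventually_mul_rpow_le hθ C₀ (show (0 : ℝ) < 1 / 2 by norm_num)] with r hr1 hrB hr2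
  intro z t w u hz ht hrz htr htz hzw htu hD
  have hr0 : 0 < r := by linarith
  rw [Real.rpow_one] at hr2
  have hrθ : 1 ≤ r ^ θ := Real.one_le_rpow hr1 hθ0.le
  have hzC : z ≤ C₀ * r ^ θ := by
    have hz1 : z ≤ w + B := by linarith [(abs_le.1 hzw).2]
    have hBr : B ≤ B * r ^ θ := le_mul_of_one_le_right hB hrθ
    have hA1 : 0 ≤ (2 / a₁) ^ (1 / β₁) := by positivity
    have hA2 : 0 ≤ (B / a₂) ^ (1 / β₂) := by positivity
    have hA1r : 0 ≤ (2 / a₁) ^ (1 / β₁) * r ^ θ := by positivity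
    have hA2r : (B / a₂) ^ (1 / β₂) ≤ (B / a₂) ^ (1 / β₂) * r ^ θ :=
      le_mul_of_one_le_right hA2 hrθ
    have hexp : C₀ * r ^ θ = (2 / a₁) ^ (1 / β₁) * r ^ θ + (B / a₂) ^ (1 / β₂) * r ^ θ
        + B * r ^ θ := by rw [hC₀]; ring
    rw [hexp]
    rcases lt_or_ge w 0 with hw | hw
    · linarith
    · by_cases hu : u ≤ a₁ * w ^ β₁
      · have hu2 : u < -(a₂ * w ^ β₂) := by
          by_contra! h; exact hD ⟨hw, h, hu⟩
        have h1 : a₂ * w ^ β₂ ≤ B := by linarith [(abs_le.1 htu).2]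
        have h2 := le_rpow_of_mul_rpow_le ha₂ hβ₂0 hw h1
        linarith
      · push Not at hu
        have h1 : a₁ * w ^ β₁ ≤ 2 * r := by linarith [(abs_le.1 htu).1]
        have h2 := le_rpow_of_mul_rpow_le ha₁ hβ₁0 hw h1
        have h3 : (2 * r / a₁) ^ (1 / β₁) ≤ (2 / a₁) ^ (1 / β₁) * r ^ θ := by
          rw [show 2 * r / a₁ = 2 / a₁ * r by ring, Real.mul_rpow (by positivity) hr0.le]
          gcongr
        linarith
  have ht2 : r / 2 ≤ t := by linarith
  have ht0 : 0 < t := by linarith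
  have hz0 : 0 < z := by
    rcases eq_or_lt_of_le hz with h | h
    · rw [← h, Real.zero_rpow hβ₁0.ne'] at htz; linarith
    · exact h
  refine ⟨ht0, hz0, hzC.trans ?_, ?_⟩
  · gcongr; linarith
  · have h1 : r / (2 * a₁) ≤ z ^ β₁ := by
      rw [div_le_iff₀ (by positivity)]; linarith
    have h2 : (r / (2 * a₁)) ^ (1 - 1 / β₁) ≤ z ^ (β₁ - 1) := by
      calc _ ≤ (z ^ β₁) ^ (1 - 1 / β₁) := by
            refine Real.rpow_le_rpow (by positivity) h1 ?_
            rw [sub_nonneg, div_le_one hβ₁0]; exact hβ₁.le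
        _ = _ := by rw [← Real.rpow_mul hz]; congr 1; field_simp
    have h3 : 0 < (r / (2 * a₁)) ^ (1 - 1 / β₁) := by positivity
    calc (a₁ * β₁ * z ^ (β₁ - 1))⁻¹ = (a₁ * β₁)⁻¹ * (z ^ (β₁ - 1))⁻¹ := mul_inv _ _
      _ ≤ (a₁ * β₁)⁻¹ * ((r / (2 * a₁)) ^ (1 - 1 / β₁))⁻¹ := by gcongr
      _ = C₁ * r ^ (1 / β₁ - 1) := by
          rw [Real.div_rpow hr0.le (by positivity), inv_div, hC₁,
            show 1 / β₁ - 1 = -(1 - 1 / β₁) by ring, Real.rpow_neg hr0.le, div_eq_mul_inv]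
          ring
      _ ≤ (C₀ + C₁) * r ^ (θ - 1) := by
          gcongr
          · linarith

lemma IsBoundaryPart.exists_near {ap am βp βm : ℝ} {DB : Set Plane}
    (h : IsBoundaryPart (domain ap am βp βm) DB) : ∃ B : ℝ, 0 ≤ B ∧ ∀ x ∈ DB,
      ∃ y : Plane, y ∉ domain ap am βp βm ∧ |x 0 - y 0| ≤ B ∧ |x 1 - y 1| ≤ B := by
  obtain ⟨-, B, hB, hd⟩ := h
  -- The extra `1` gives a strict inequality for the infimum distance, from which an actual exterior
  -- point can be extracted.
  refine ⟨B + 1, by linarith, fun x hx => ?_⟩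
  have hne : (domain ap am βp βm)ᶜ.Nonempty := by
    refine ⟨!₂[-1, 0], fun h => ?_⟩
    have := h.1
    norm_num at this
  obtain ⟨y, hy, hxy⟩ := (Metric.infDist_lt_iff hne).1 ((hd x hx).trans_lt (lt_add_one B))
  rw [dist_eq_norm] at hxy
  exact ⟨y, hy, (abs_apply_le_norm (x - y) 0).trans hxy.le,
    (abs_apply_le_norm (x - y) 1).trans hxy.le⟩

/-- In a domain with superlinear boundary curves, a far point of the boundary part is off the
horizontal axis, close to the vertical axis, and the curve there is steep. -/
lemma superlinear_boundary {ap am βp βm θ : ℝ} (hap : 0 < ap) (ham : 0 < am) (hβp : 1 < βp)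
    (hβm : 1 < βm) {DB : Set Plane} (hDB : IsBoundaryPart (domain ap am βp βm) DB)
    (hθp : 1 / βp ≤ θ) (hθm : 1 / βm ≤ θ) (hθ : θ < 1) :
    ∃ C : ℝ, 0 ≤ C ∧ ∀ᶠ r : ℝ in atTop, ∀ x ∈ DB, ‖x‖ = r → 0 < x 0 ∧ x 0 ≤ C * r ^ θ ∧
      ((0 < x 1 ∧ (ap * βp * x 0 ^ (βp - 1))⁻¹ ≤ C * r ^ (θ - 1)) ∨
        (x 1 < 0 ∧ (am * βm * x 0 ^ (βm - 1))⁻¹ ≤ C * r ^ (θ - 1))) := by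
  obtain ⟨B, hB, hnear⟩ := hDB.exists_near
  obtain ⟨C1, hC1, h1⟩ := superlinear_side hap ham hβp hβm hB hθp hθ
  obtain ⟨C2, hC2, h2⟩ := superlinear_side ham hap hβm hβp hB hθm hθ
  refine ⟨C1 + C2, by positivity, ?_⟩
  filter_upwards [h1, h2, eventually_gt_atTop 0] with r h1 h2 hr x hx hxr
  obtain ⟨hx0, hxl, hxu⟩ := hDB.1 hx
  obtain ⟨y, hy, hy0, hy1⟩ := hnear x hx
  have hn := norm_le_add_abs x
  have ha1 := abs_apply_le_norm x 1
  rw [abs_of_nonneg hx0] at hn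
  rw [hxr] at hn ha1
  have hrθ : 0 ≤ r ^ θ := by positivity
  have hrθ' : 0 ≤ r ^ (θ - 1) := by positivity
  simp only [bdry] at hxl hxu
  rcases le_total 0 (x 1) with ht | ht
  · rw [abs_of_nonneg ht] at hn ha1
    obtain ⟨g1, g2, g3, g4⟩ := h1 (x 0) (x 1) (y 0) (y 1) hx0 ht hn ha1 hxu hy0 hy1 hy
    exact ⟨g2, by nlinarith, Or.inl ⟨g1, by nlinarith⟩⟩
  · rw [abs_of_nonpos ht] at hn ha1
    have hy' : ¬ (0 ≤ y 0 ∧ -(ap * y 0 ^ βp) ≤ -y 1 ∧ -y 1 ≤ am * y 0 ^ βm) := fun h =>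
      hy ⟨h.1, by rw [bdry]; linarith [h.2.2], by rw [bdry]; linarith [h.2.1]⟩
    obtain ⟨g1, g2, g3, g4⟩ := h2 (x 0) (-x 1) (y 0) (-y 1) hx0 (by linarith) hn ha1
      (by linarith) hy0 (by rw [← abs_neg]; convert hy1 using 2; ring) hy'
    exact ⟨g2, by nlinarith, Or.inr ⟨by linarith, by nlinarith⟩⟩

lemma rpow_le_of_le_mul {r ρ k e : ℝ} (hρ : 0 < ρ) (hk : 0 < k) (h : ρ ≤ k * r)
    (he : e ≤ 0) : r ^ e ≤ k ^ (-e) * ρ ^ e := by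
  have h1 : ρ / k ≤ r := by rw [div_le_iff₀ hk]; linarith
  calc r ^ e ≤ (ρ / k) ^ e := Real.rpow_le_rpow_of_nonpos (by positivity) h1 he
    _ = _ := by rw [Real.div_rpow hρ.le hk.le, Real.rpow_neg hk.le, div_eq_mul_inv]; ring

lemma rpow_le_of_mul_le {r ρ k e : ℝ} (hr : 0 < r) (hk : 0 < k) (h : k * r ≤ ρ)
    (he : 0 ≤ e) : r ^ e ≤ k ^ (-e) * ρ ^ e := by
  have hρ : 0 < ρ := lt_of_lt_of_le (by positivity) h
  have h1 : r ≤ ρ / k := by rw [le_div_iff₀ hk]; linarith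
  calc r ^ e ≤ (ρ / k) ^ e := Real.rpow_le_rpow hr.le h1 he
    _ = _ := by rw [Real.div_rpow hρ.le hk.le, Real.rpow_neg hk.le, div_eq_mul_inv]; ring

/-- Since `t₂` is purely imaginary, the real part determines `x 0`; the remainder `t₂ * x 1` then
determines `x 1`. -/
lemma exists_mul_norm_le_toC {t₁ t₂ : ℂ} (h1 : 0 < t₁.re) (h2 : t₂.re = 0) (h3 : t₂ ≠ 0) :
    ∃ k : ℝ, 0 < k ∧ ∀ x : Plane, k * ‖x‖ ≤ ‖toC t₁ t₂ x‖ := by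
  have h3' : 0 < ‖t₂‖ := norm_pos_iff.2 h3
  set c := t₁.re⁻¹ + ‖t₂‖⁻¹ * (1 + ‖t₁‖ * t₁.re⁻¹) with hc
  have hc0 : 0 < c := by positivity
  refine ⟨c⁻¹, by positivity, fun x => ?_⟩
  rw [inv_mul_le_iff₀ hc0]
  have e1 : (toC t₁ t₂ x).re = t₁.re * x 0 := by simp [toC, h2]
  have e2 : |x 0| ≤ t₁.re⁻¹ * ‖toC t₁ t₂ x‖ := by
    rw [le_inv_mul_iff₀ h1]
    have := Complex.abs_re_le_norm (toC t₁ t₂ x)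
    rwa [e1, abs_mul, abs_of_pos h1] at this
  have e3 : |x 1| ≤ ‖t₂‖⁻¹ * (1 + ‖t₁‖ * t₁.re⁻¹) * ‖toC t₁ t₂ x‖ := by
    rw [mul_assoc, le_inv_mul_iff₀ h3']
    have h5 : t₂ * (x 1 : ℂ) = toC t₁ t₂ x - t₁ * (x 0 : ℂ) := by rw [toC]; ring
    have h6 : ‖t₂‖ * |x 1| = ‖toC t₁ t₂ x - t₁ * (x 0 : ℂ)‖ := by
      rw [← h5, norm_mul, Complex.norm_real, Real.norm_eq_abs]
    rw [h6]
    refine (norm_sub_le _ _).trans ?_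
    rw [norm_mul, Complex.norm_real, Real.norm_eq_abs]
    have := mul_le_mul_of_nonneg_left e2 (norm_nonneg t₁)
    linarith
  have := norm_le_add_abs x
  rw [hc]; linarith

lemma toC_sub_smul (t₁ t₂ : ℂ) (m n : Plane) (μ : ℝ) :
    toC t₁ t₂ (m - μ • n) = toC t₁ t₂ m - μ * toC t₁ t₂ n := by
  simp only [toC, PiLp.sub_apply, PiLp.smul_apply, smul_eq_mul]; push_cast; ring

/-- Pulling back an eventual property along a map comparable to the norm. -/
lemma eventually_of_norm_le {T : Plane → ℂ} {k : ℝ} (hk : 0 < k) (h : ∀ x, k * ‖x‖ ≤ ‖T x‖)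
    {P : ℝ → Prop} (hP : ∀ᶠ ρ in atTop, P ρ) : ∀ᶠ r : ℝ in atTop, ∀ x, ‖x‖ = r → P ‖T x‖ := by
  obtain ⟨ρ₀, hρ₀⟩ := eventually_atTop.1 hP
  filter_upwards [eventually_ge_atTop (ρ₀ / k)] with r hr x hx
  refine hρ₀ _ (le_trans ?_ (h x))
  rw [hx]
  rw [div_le_iff₀ hk] at hr
  linarith

/-- The mean drift at a far boundary point, in the complex coordinate. -/
lemma norm_toC_drift_sub_le (t₁ t₂ : ℂ) (α : ℝ) {k θ C C' r ρ n s μ : ℝ} (hk : 0 < k)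
    (hr : 0 < r) (hρ : 0 < ρ) (hρr : ρ ≤ k * r) (hθ : θ ≤ 1) (hs : |s| = 1) (hn : 0 < n)
    (hμ : 0 ≤ μ) (hn' : n⁻¹ ≤ C' * r ^ (θ - 1)) (hC' : 0 ≤ C') {m : Plane}
    (h : ‖m - μ • ((√(n ^ 2 + 1))⁻¹ • reflVec s n α)‖ ≤ C * r⁻¹) :
    ‖toC t₁ t₂ m - μ * (t₁ * Real.cos α + t₂ * Real.sin α)‖ ≤
      (‖t₁‖ + ‖t₂‖) * |C| * k * ρ⁻¹ +
        μ * (2 * (‖t₁‖ + ‖t₂‖) * C' * k ^ (1 - θ) * ρ ^ (θ - 1)) := by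
  set V := (√(n ^ 2 + 1))⁻¹ • reflVec s n α with hV
  set T := ‖t₁‖ + ‖t₂‖ with hT
  have e : toC t₁ t₂ m - μ * (t₁ * Real.cos α + t₂ * Real.sin α) =
      toC t₁ t₂ (m - μ • V) + μ * (toC t₁ t₂ V - (t₁ * Real.cos α + t₂ * Real.sin α)) := by
    rw [toC_sub_smul]; ring
  have h1 : r⁻¹ ≤ k * ρ⁻¹ := by
    have := rpow_le_of_le_mul hρ hk hρr (e := -1) (by norm_num)
    simpa [Real.rpow_neg_one] using this
  have h2 : r ^ (θ - 1) ≤ k ^ (1 - θ) * ρ ^ (θ - 1) := by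
    have := rpow_le_of_le_mul hρ hk hρr (e := θ - 1) (by linarith)
    rwa [neg_sub] at this
  rw [e]
  refine (norm_add_le _ _).trans (add_le_add ?_ ?_)
  · calc _ ≤ T * ‖m - μ • V‖ := norm_toC_le _ _ _
      _ ≤ T * (|C| * (k * ρ⁻¹)) := by
          gcongr
          refine h.trans ?_
          have : C * r⁻¹ ≤ |C| * r⁻¹ := by gcongr; exact le_abs_self C
          refine this.trans ?_
          gcongr
      _ = _ := by ring
  · rw [norm_mul, Complex.norm_real, Real.norm_of_nonneg hμ]
    gcongr
    calc _ ≤ 2 * T * n⁻¹ := norm_toC_reflVec_sub_le t₁ t₂ α hs hn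
      _ ≤ 2 * T * (C' * (k ^ (1 - θ) * ρ ^ (θ - 1))) := by
          gcongr
          exact hn'.trans (by gcongr)
      _ = _ := by ring

/-- The transformation of the plane that turns the covariance `A` into a multiple of the identity
and preserves the right half-plane. -/
lemma exists_isotropic {A : Matrix (Fin 2) (Fin 2) ℝ} (hA : A.PosDef) : ∃ t₁ t₂ : ℂ,
    0 < t₁.re ∧ t₂.re = 0 ∧ t₂ ≠ 0 ∧ sqMoment t₁ t₂ A = 0 ∧ 0 < absMoment t₁ t₂ A := by
  have h00 : 0 < A 0 0 := hA.diag_pos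
  have hsym : A 1 0 = A 0 1 := by simpa using hA.1.apply 0 1
  have hdet : 0 < A 0 0 * A 1 1 - A 0 1 * A 0 1 := by
    have := hA.det_pos
    rw [Matrix.det_fin_two, hsym] at this
    exact this
  set D := √(A 0 0 * A 1 1 - A 0 1 * A 0 1) with hD
  have hD0 : 0 < D := Real.sqrt_pos.2 hdet
  have hD2 : D ^ 2 = A 0 0 * A 1 1 - A 0 1 * A 0 1 := Real.sq_sqrt hdet.le
  -- The equation `sqMoment = 0` is quadratic in `t₁ / t₂` with roots `(-A 0 1 ± i D) / A 0 0`.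
  -- Scaling by `t₂ = i A 0 0` and choosing the sign with positive real part gives `t₁ = D - i A 0
  -- 1`.
  refine ⟨⟨D, -A 0 1⟩, ⟨0, A 0 0⟩, hD0, rfl, ?_, ?_, ?_⟩
  · intro h
    have := congrArg Complex.im h
    simp at this
    linarith
  · rw [sqMoment]
    apply Complex.ext
    · simp [pow_two]
      linear_combination A 0 0 * hD2
    · simp [pow_two]
      ring
  · have e : absMoment ⟨D, -A 0 1⟩ ⟨0, A 0 0⟩ A = 2 * A 0 0 * D ^ 2 := by
      rw [absMoment, ← Complex.normSq_eq_norm_sq, ← Complex.normSq_eq_norm_sq,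
        Complex.normSq_apply, Complex.normSq_apply]
      simp
      linear_combination -A 0 0 * hD2
    rw [e]; positivity

/-! ### Recurrence for superlinear curves -/

section

variable {S : Set Plane} {κ : Kernel S S}

/-- The unit reflection vector with `reflVec` as its direction. -/
def unitReflVec (s n α : ℝ) : Plane := (√(n ^ 2 + 1))⁻¹ • reflVec s n α

lemma ReflectionUpper.drift {DB : Set Plane} {a β α : ℝ}
    (h : ReflectionUpper κ DB a β α) : ∃ μ₀ C : ℝ, 0 < μ₀ ∧ ∀ᶠ r : ℝ in atTop, ∀ x : S,
      ‖(x : Plane)‖ = r → (x : Plane) ∈ DB → 0 < (x : Plane) 1 → ∃ μ : ℝ, μ₀ ≤ μ ∧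
        ‖meanIncrement κ x - μ • unitReflVec 1 (a * β * (x : Plane) 0 ^ (β - 1)) α‖ ≤
          C * r⁻¹ := by
  obtain ⟨μ, ⟨c, R, hc, h1⟩, C, R', hR', h2⟩ := h
  refine ⟨c, C, hc, ?_⟩
  filter_upwards [eventually_ge_atTop R, eventually_ge_atTop R'] with r hr hr' x hx hxD hx1
  refine ⟨μ x, h1 x ⟨hxD, hx1⟩ (by rw [hx]; exact hr), ?_⟩
  have := h2 r hr' x ⟨hxD, hx1⟩ hx.ge
  rwa [reflUpper_eq] at this

lemma ReflectionLower.drift {DB : Set Plane} {a β α : ℝ}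
    (h : ReflectionLower κ DB a β (-α)) : ∃ μ₀ C : ℝ, 0 < μ₀ ∧ ∀ᶠ r : ℝ in atTop, ∀ x : S,
      ‖(x : Plane)‖ = r → (x : Plane) ∈ DB → (x : Plane) 1 < 0 → ∃ μ : ℝ, μ₀ ≤ μ ∧
        ‖meanIncrement κ x - μ • unitReflVec (-1) (a * β * (x : Plane) 0 ^ (β - 1)) α‖ ≤
          C * r⁻¹ := by
  obtain ⟨μ, ⟨c, R, hc, h1⟩, C, R', hR', h2⟩ := h
  refine ⟨c, C, hc, ?_⟩
  filter_upwards [eventually_ge_atTop R, eventually_ge_atTop R'] with r hr hr' x hx hxD hx1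
  refine ⟨μ x, h1 x ⟨hxD, hx1⟩ (by rw [hx]; exact hr), ?_⟩
  have := h2 r hr' x ⟨hxD, hx1⟩ hx.ge
  rwa [reflLower_neg_eq] at this

/-- The quantitative interior assumptions with a common exponent. -/
lemma interior_plus {DB : Set Plane} {A : Matrix (Fin 2) (Fin 2) ℝ}
    (hD : ZeroDriftPlus κ DB) (hC : CovarianceLimitPlus κ DB A) : ∃ ε K : ℝ, 0 < ε ∧ 0 ≤ K ∧
      ∀ᶠ r : ℝ in atTop, ∀ x : S, ‖(x : Plane)‖ = r → (x : Plane) ∉ DB →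
        ‖meanIncrement κ x‖ ≤ K * r ^ (-1 - ε) ∧
        ∀ i j, |(secondMoment κ x - A) i j| ≤ K * r ^ (-ε) := by
  obtain ⟨ε₁, hε₁, C₁, R₁, -, h1⟩ := hD
  obtain ⟨ε₂, hε₂, C₂, R₂, -, h2⟩ := hC
  refine ⟨min ε₁ ε₂, |C₁| + |C₂|, lt_min hε₁ hε₂, by positivity, ?_⟩
  filter_upwards [eventually_ge_atTop R₁, eventually_ge_atTop R₂, eventually_ge_atTop 1]
    with r hr1 hr2 hr x hx hxD
  have hr0 : 0 < r := by linarith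
  constructor
  · refine (h1 r hr1 x hxD hx.ge).trans ?_
    have : r ^ (-1 - ε₁) ≤ r ^ (-1 - min ε₁ ε₂) :=
      Real.rpow_le_rpow_of_exponent_le hr (by linarith [min_le_left ε₁ ε₂])
    calc C₁ * r ^ (-1 - ε₁) ≤ (|C₁| + |C₂|) * r ^ (-1 - ε₁) := by
          gcongr; linarith [le_abs_self C₁, abs_nonneg C₂]
      _ ≤ _ := by gcongr
  · intro i j
    refine (abs_apply_le_matOpNorm _ i j).trans ((h2 r hr2 x hxD hx.ge).trans ?_)
    have : r ^ (-ε₂) ≤ r ^ (-min ε₁ ε₂) :=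
      Real.rpow_le_rpow_of_exponent_le hr (by linarith [min_le_right ε₁ ε₂])
    calc C₂ * r ^ (-ε₂) ≤ (|C₁| + |C₂|) * r ^ (-ε₂) := by
          gcongr; linarith [le_abs_self C₂, abs_nonneg C₁]
      _ ≤ _ := by gcongr

/-- Recurrence in a domain with superlinear boundary curves. -/
theorem recurrent_of_superlinear [IsMarkovKernel κ] {ap am βp βm : ℝ} (hap : 0 < ap)
    (ham : 0 < am) (hβp : 1 < βp)
    (hβm : 1 < βm) {DB : Set Plane} (hDB : IsBoundaryPart (domain ap am βp βm) DB)
    (hS : S ⊆ domain ap am βp βm) (x₀ : S) {α : ℝ} (hα : |α| < Real.pi / 2)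
    {A : Matrix (Fin 2) (Fin 2) ℝ} (hA : A.PosDef) (hN : NonConfinement κ)
    (hM : BoundedMoments κ) (hRp : ReflectionUpper κ DB ap βp α)
    (hRm : ReflectionLower κ DB am βm (-α)) (hD : ZeroDriftPlus κ DB)
    (hC : CovarianceLimitPlus κ DB A) : Recurrent κ x₀ := by
  obtain ⟨q, M, hq, hq3, hM0, hM⟩ := exists_momentBound hM
  obtain ⟨ε, Ki, hε, hKi, hint⟩ := interior_plus hD hC
  obtain ⟨μp, Cp, hμp, hup⟩ := hRp.drift
  obtain ⟨μm, Cm, hμm, hlow⟩ := hRm.drift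
  obtain ⟨t₁, t₂, ht₁, ht₂, ht₂0, hsq, habs⟩ := exists_isotropic hA
  obtain ⟨k, hk, hkn⟩ := exists_mul_norm_le_toC ht₁ ht₂ ht₂0
  set T := ‖t₁‖ + ‖t₂‖ with hT
  have hT0 : 0 < T := by have := norm_pos_iff.2 ht₂0; positivity
  have hcos : 0 < Real.cos α := Real.cos_pos_of_mem_Ioo (abs_lt.1 hα)
  -- Image of the common limit `(cos α, sin α)` of the two reflection directions. Its real part is
  -- positive because `|α| < π/2`, and then so is that of `v⁻¹`, the coefficient of the logarithm.
  set v : ℂ := t₁ * Real.cos α + t₂ * Real.sin α with hv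
  have hvre : 0 < v.re := by
    have : v.re = t₁.re * Real.cos α := by
      rw [hv, Complex.add_re, Complex.re_mul_ofReal, Complex.re_mul_ofReal, ht₂]; ring
    rw [this]; positivity
  have hv0 : v ≠ 0 := by intro h; rw [h] at hvre; simp at hvre
  have hc : 0 < (v⁻¹).re := by
    rw [Complex.inv_re]; exact div_pos hvre (Complex.normSq_pos.2 hv0)
  -- Inverting `x₂ = a x₁^β` gives `x₁` of order `|x₂|^(1/β)`; `θ` is the worse of the two sides.
  set θ := max (1 / βp) (1 / βm) with hθ
  have hθ1 : θ < 1 := by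
    refine max_lt ?_ ?_
    · rw [div_lt_one (by linarith)]; exact hβp
    · rw [div_lt_one (by linarith)]; exact hβm
  have hθ0 : 0 < θ := lt_of_lt_of_le (by positivity) (le_max_left _ _)
  obtain ⟨Cb, hCb, hbd⟩ := superlinear_boundary hap ham hβp hβm hDB (le_max_left _ _)
    (le_max_right _ _) hθ1
  -- Small enough that `ρ^(-2-δ)` dominates both the interior errors and the moment remainder.
  set δ := min ε (q - 2) / 2 with hδ
  have hδ0 : 0 < δ := half_pos (lt_min hε (by linarith))
  have hδε : δ < ε := by
    have := min_le_left ε (q - 2); linarith [lt_min hε (by linarith : 0 < q - 2)]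
  have hδq : 2 + δ < q := by
    have := min_le_right ε (q - 2); linarith [lt_min hε (by linarith : 0 < q - 2)]
  -- Small enough that the boundary gain `ρ^(-w-1)` dominates the gradient of `‖ζ‖^(-δ)` and the
  -- deviation of the true boundary from the axis.
  set w := min δ (1 - θ) / 2 with hw
  have hmin : 0 < min δ (1 - θ) := lt_min hδ0 (by linarith)
  have hw0 : 0 < w := half_pos hmin
  have hwδ : w < δ := by have := min_le_left δ (1 - θ); linarith
  have hwθ : w < 1 - θ := by have := min_le_right δ (1 - θ); linarith
  have hw1 : w < 1 := by linarith
  obtain ⟨R, C, hR, hC0, hpos, hdrift⟩ := logPotCut_drift hM hM0 hq hq3 t₁ t₂ hc hw0.le hδ0.le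
  set Cq := (‖v⁻¹‖ * (1 + w * (w + 1)) + δ * (δ + 1) + δ ^ 2 / 4) * ((‖t₁‖ + ‖t₂‖) ^ 2 * (1 + M))
    with hCq
  set Kb := t₁.re * Cb * k ^ (-θ) + T * |Cp| * T + T * |Cm| * T + 2 * T * Cb * T ^ (1 - θ) with hKb
  have hKb0 : 0 ≤ Kb := by positivity
  have hbdrift := logPot_boundary_drift hv0 hw0 hw1 hwδ hwθ (lt_min hμp hμm) Kb (Cq + C)
  set Ki' := T * (Ki * T ^ (1 + ε)) + Ki * T ^ ε with hKi'
  have hidrift := logPot_interior_drift (c := v⁻¹) hsq habs hw0.le hδ0 hδε hδq Ki' C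
  have hev : ∀ᶠ r : ℝ in atTop, ∀ x : S, ‖(x : Plane)‖ = r →
      ∫⁻ y, ENNReal.ofReal (logPotCut v⁻¹ w δ R (toC t₁ t₂ y)) ∂(κ x) ≤
        ENNReal.ofReal (logPotCut v⁻¹ w δ R (toC t₁ t₂ x)) := by
    filter_upwards [hint, hup, hlow, hbd, eventually_of_norm_le hk hkn hbdrift,
      eventually_of_norm_le hk hkn hidrift,
      eventually_of_norm_le hk hkn (eventually_ge_atTop (2 * R)), eventually_ge_atTop 1]
      with r hint hup hlow hbd hbdrift hidrift hRr hr1 x hx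
    have hr0 : 0 < r := by linarith
    set ζ := toC t₁ t₂ x with hζ
    have hρR : 2 * R ≤ ‖ζ‖ := hRr x hx
    have hρ1 : 1 ≤ ‖ζ‖ := by linarith
    have hρ0 : 0 < ‖ζ‖ := by linarith
    have hkr : k * r ≤ ‖ζ‖ := by have := hkn x; rwa [hx] at this
    have hρT : ‖ζ‖ ≤ T * r := by have := norm_toC_le t₁ t₂ x; rwa [hx] at this
    have hre : ζ.re = t₁.re * (x : Plane) 0 := by simp [hζ, toC, ht₂]
    obtain ⟨hx0, hxl, hxu⟩ := hS x.2
    have hx0' : 0 < (x : Plane) 0 := by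
      rcases eq_or_lt_of_le hx0 with h | h
      · rw [bdry, ← h, Real.zero_rpow (by linarith), mul_zero] at hxl hxu
        have h1 := norm_le_add_abs (x : Plane)
        rw [hx, ← h, le_antisymm hxu (by linarith)] at h1
        simp at h1
        linarith
      · exact h
    have hζre : 0 < ζ.re := by rw [hre]; positivity
    refine (hdrift x ζ hζ hζre hρR).trans (ENNReal.ofReal_le_ofReal ?_)
    by_cases hxD : (x : Plane) ∈ DB
    · obtain ⟨-, hb1, hb2⟩ := hbd x hxD hx
      have hquad := logPotQuad_term_le (c := v⁻¹) (t₁ := t₁) (t₂ := t₂) hw0.le hδ0.le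
        (by linarith : 0 ≤ 1 + M) (hM.abs_secondMoment_le hq x) hρ1
      have hqρ : C * ‖ζ‖ ^ (-q) ≤ C * ‖ζ‖ ^ (-2 : ℝ) := by
        gcongr
      have hζb : ζ.re ≤ Kb * ‖ζ‖ ^ θ := by
        have h1 := rpow_le_of_mul_le hr0 hk hkr hθ0.le
        have h2 : 0 ≤ T * |Cp| * T + T * |Cm| * T + 2 * T * Cb * T ^ (1 - θ) := by positivity
        calc ζ.re ≤ t₁.re * (Cb * (k ^ (-θ) * ‖ζ‖ ^ θ)) := by
              rw [hre]; gcongr; exact hb1.trans (by gcongr)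
          _ = t₁.re * Cb * k ^ (-θ) * ‖ζ‖ ^ θ := by ring
          _ ≤ _ := by gcongr; linarith
      have hm : ∃ μ, min μp μm ≤ μ ∧ ‖toC t₁ t₂ (meanIncrement κ x) - μ * v‖ ≤
          Kb * ‖ζ‖⁻¹ + μ * (Kb * ‖ζ‖ ^ (θ - 1)) := by
        have g0 : 0 ≤ t₁.re * Cb * k ^ (-θ) := by positivity
        have g1 : 0 ≤ T * |Cp| * T := by positivity
        have g2 : 0 ≤ T * |Cm| * T := by positivity
        have g3 : 0 ≤ 2 * T * Cb * T ^ (1 - θ) := by positivity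
        rcases hb2 with ⟨hx1, hn⟩ | ⟨hx1, hn⟩
        · obtain ⟨μ, hμ, hmu⟩ := hup x hx hxD hx1
          have hμ0 : 0 < μ := hμp.trans_le hμ
          refine ⟨μ, (min_le_left _ _).trans hμ, ?_⟩
          refine (norm_toC_drift_sub_le t₁ t₂ α hT0 hr0 hρ0 hρT hθ1.le (by norm_num)
            (by positivity) hμ0.le hn hCb hmu).trans ?_
          gcongr <;> linarith
        · obtain ⟨μ, hμ, hmu⟩ := hlow x hx hxD hx1
          have hμ0 : 0 < μ := hμm.trans_le hμ
          refine ⟨μ, (min_le_right _ _).trans hμ, ?_⟩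
          refine (norm_toC_drift_sub_le t₁ t₂ α hT0 hr0 hρ0 hρT hθ1.le (by norm_num)
            (by positivity) hμ0.le hn hCb hmu).trans ?_
          gcongr <;> linarith
      obtain ⟨μ, hμ, hmu⟩ := hm
      have := hbdrift x hx ζ _ μ rfl hζre hζb hμ hmu
      rw [← hζ, add_mul] at this
      rw [← hCq] at hquad
      linarith
    · obtain ⟨hi1, hi2⟩ := hint x hx hxD
      have h1 := rpow_le_of_le_mul hρ0 hT0 hρT (e := -1 - ε) (by linarith)
      have h2 := rpow_le_of_le_mul hρ0 hT0 hρT (e := -ε) (by linarith)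
      rw [neg_sub, sub_neg_eq_add, add_comm ε 1] at h1
      rw [neg_neg] at h2
      have g1 : 0 ≤ T * (Ki * T ^ (1 + ε)) := by positivity
      have g2 : 0 ≤ Ki * T ^ ε := by positivity
      have := hidrift x hx ζ (toC t₁ t₂ (meanIncrement κ x)) (secondMoment κ x) rfl ?_ ?_
      · linarith
      · calc _ ≤ T * (Ki * (T ^ (1 + ε) * ‖ζ‖ ^ (-1 - ε))) := by
              refine (norm_toC_le _ _ _).trans ?_
              gcongr
              exact hi1.trans (by gcongr)
          _ = T * (Ki * T ^ (1 + ε)) * ‖ζ‖ ^ (-1 - ε) := by ring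
          _ ≤ _ := by gcongr; linarith
      · intro i j
        calc _ ≤ Ki * (T ^ ε * ‖ζ‖ ^ (-ε)) := (hi2 i j).trans (by gcongr)
          _ = Ki * T ^ ε * ‖ζ‖ ^ (-ε) := by ring
          _ ≤ _ := by gcongr; linarith
  obtain ⟨R₁, hR₁⟩ := eventually_atTop.1 hev
  refine recurrent_of_superharmonic κ hN x₀ (f := fun y : S => logPotCut v⁻¹ w δ R (toC t₁ t₂ y))
    ((measurable_logPotCut _ _ _ _).comp ((measurable_toC t₁ t₂).comp measurable_subtype_coe))
    (fun K => ?_) R₁ fun y hy => hR₁ _ hy.le y rfl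
  set B := ‖v⁻¹‖ * (Real.pi + 1) + 1 with hB
  have hlog : ∀ᶠ ρ : ℝ in atTop, (K + B) / (v⁻¹).re ≤ Real.log ρ :=
    Real.tendsto_log_atTop.eventually_ge_atTop _
  obtain ⟨r, hr⟩ := eventually_atTop.1 (eventually_of_norm_le hk hkn
    (hlog.and (eventually_ge_atTop R)))
  refine ⟨r, fun y hy => ?_⟩
  obtain ⟨h1, h2⟩ := hr _ hy y rfl
  have h3 := (logPot_bounds v⁻¹ hw0.le hδ0.le (hR.trans h2)).1
  simp only [logPotCut, if_pos h2]
  rw [div_le_iff₀ hc] at h1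
  linarith

end

/-! ### Potentials of logarithmic and power type -/

lemma exists_rpow_le (a : ℝ) {k : ℝ} (hk : 0 < k) : ∃ C : ℝ, 0 ≤ C ∧ ∀ z l : ℝ, 0 < z →
    k * z ≤ l → l ≤ 2 * z → l ^ a ≤ C * z ^ a := by
  refine ⟨k ^ a + 2 ^ a, by positivity, fun z l hz h1 h2 => ?_⟩
  have hl : 0 < l := lt_of_lt_of_le (by positivity) h1
  have hza := Real.rpow_pos_of_pos hz a
  have hka := Real.rpow_pos_of_pos hk a
  have h2a := Real.rpow_pos_of_pos (zero_lt_two (α := ℝ)) a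
  rcases le_total 0 a with ha | ha
  · calc l ^ a ≤ (2 * z) ^ a := Real.rpow_le_rpow hl.le h2 ha
      _ = 2 ^ a * z ^ a := Real.mul_rpow zero_le_two hz.le
      _ ≤ _ := by gcongr; linarith
  · calc l ^ a ≤ (k * z) ^ a := Real.rpow_le_rpow_of_nonpos (by positivity) h1 ha
      _ = k ^ a * z ^ a := Real.mul_rpow hk.le hz.le
      _ ≤ _ := by gcongr; linarith

lemma abs_div_le_of_cone {k z l D d : ℝ} (hk : 0 < k) (hz : 0 < z) (hl : k * z ≤ l)
    (hD : |D| ≤ 2 * d) : |D / l| ≤ 2 / k * (d / z) := by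
  have hl0 : 0 < l := lt_of_lt_of_le (by positivity) hl
  have hd : 0 ≤ d := by linarith [abs_nonneg D]
  rw [abs_div, abs_of_pos hl0]
  calc |D| / l ≤ 2 * d / (k * z) := by gcongr
    _ = _ := by field_simp

/-- Scaling by `l` reduces this to `(1 + D / l)^a`. The cone `k z ≤ l ≤ 2 z` allows the error to be
expressed through `z` alone, uniformly in the transverse coordinate. -/
lemma exists_rpow_expansion (a : ℝ) {k : ℝ} (hk : 0 < k) : ∃ C : ℝ, 0 ≤ C ∧ ∀ z l D d : ℝ, 0 < z →
    k * z ≤ l → l ≤ 2 * z → |D| ≤ 2 * d → d ≤ k / 4 * z →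
    |(l + D) ^ a - l ^ a - (a * l ^ (a - 1) * D + a * (a - 1) * l ^ (a - 2) / 2 * D ^ 2)| ≤
      C * z ^ a * (d / z) ^ 3 := by
  obtain ⟨C, hC, h⟩ := exists_abs_one_add_rpow_sub_le a
  obtain ⟨C', hC', h'⟩ := exists_rpow_le a hk
  refine ⟨C' * C * (2 / k) ^ 3, by positivity, fun z l D d hz h1 h2 hD hd => ?_⟩
  have hl : 0 < l := lt_of_lt_of_le (by positivity) h1
  have hd0 : 0 ≤ d := by linarith [abs_nonneg D]
  have ht := abs_div_le_of_cone hk hz h1 hD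
  have ht2 : |D / l| ≤ 1 / 2 := by
    refine ht.trans ?_
    rw [div_mul_div_comm, div_le_iff₀ (by positivity)]
    linarith
  have h3 := h (D / l) ht2
  have e1 : l + D = l * (1 + D / l) := by field_simp
  have e2 : (l + D) ^ a = l ^ a * (1 + D / l) ^ a := by
    rw [e1, Real.mul_rpow hl.le (by linarith [neg_abs_le (D / l)])]
  have e3 : l ^ (a - 1) = l ^ a / l := by rw [Real.rpow_sub hl, Real.rpow_one]
  have e4 : l ^ (a - 2) = l ^ a / l ^ 2 := by
    rw [Real.rpow_sub hl, ← Real.rpow_natCast l 2]; norm_num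
  have e5 : (l + D) ^ a - l ^ a - (a * l ^ (a - 1) * D + a * (a - 1) * l ^ (a - 2) / 2 * D ^ 2) =
      l ^ a * ((1 + D / l) ^ a - (1 + a * (D / l) + a * (a - 1) / 2 * (D / l) ^ 2)) := by
    rw [e2, e3, e4]; field_simp; ring
  rw [e5, abs_mul, abs_of_pos (Real.rpow_pos_of_pos hl a)]
  have hza := Real.rpow_pos_of_pos hz a
  calc _ ≤ (C' * z ^ a) * (C * (2 / k * (d / z)) ^ 3) := by
        gcongr
        · exact h' z l hz h1 h2
        · exact h3.trans (by gcongr)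
    _ = _ := by ring

lemma log_expansion {k z l D d : ℝ} (hk : 0 < k) (hz : 0 < z)
    (h1 : k * z ≤ l) (hD : |D| ≤ 2 * d) (hd : d ≤ k / 4 * z) :
    |Real.log (l + D) - Real.log l - (l⁻¹ * D + -l ^ (-2 : ℝ) / 2 * D ^ 2)| ≤
      (2 / k) ^ 3 * (d / z) ^ 3 := by
  have hl : 0 < l := lt_of_lt_of_le (by positivity) h1
  have hd0 : 0 ≤ d := by linarith [abs_nonneg D]
  have ht := abs_div_le_of_cone hk hz h1 hD
  have ht2 : |D / l| ≤ 1 / 2 := by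
    refine ht.trans ?_
    rw [div_mul_div_comm, div_le_iff₀ (by positivity)]
    linarith
  have h3 := abs_log_one_add_sub_le ht2
  have e1 : l + D = l * (1 + D / l) := by field_simp
  have e2 : Real.log (l + D) = Real.log l + Real.log (1 + D / l) := by
    rw [e1, Real.log_mul hl.ne' (by linarith [neg_abs_le (D / l)])]
  have e4 : l ^ (-2 : ℝ) = (l ^ 2)⁻¹ := by
    rw [Real.rpow_neg hl.le, ← Real.rpow_natCast l 2]; norm_num
  have e5 : Real.log (l + D) - Real.log l - (l⁻¹ * D + -l ^ (-2 : ℝ) / 2 * D ^ 2) =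
      Real.log (1 + D / l) - (D / l - (D / l) ^ 2 / 2) := by
    rw [e2, e4]; field_simp; ring
  rw [e5]
  refine h3.trans ?_
  rw [← mul_pow]
  gcongr

/-- Of the second-order terms only `y²` is kept. The others contain `x` and carry a factor `|w| /
z`, which is a negative power of `z` in a sublinear domain, so they go into the error. -/
lemma exists_sq_mul_rpow_expansion (b : ℝ) : ∃ C : ℝ, 0 ≤ C ∧ ∀ z w x y d : ℝ, 0 < z →
    |x| ≤ d → |y| ≤ d → d ≤ 1 / 2 * z → |w| ≤ z →
    |(w + y) ^ 2 * (z + x) ^ b - w ^ 2 * z ^ b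
      - (b * w ^ 2 * z ^ (b - 1) * x + 2 * w * z ^ b * y + z ^ b * y ^ 2)| ≤
      C * z ^ b * (|w| / z) * d ^ 2 + C * z ^ (b + 2) * (d / z) ^ 3 := by
  obtain ⟨C₁, hC₁, h₁⟩ := exists_abs_one_add_rpow_sub_linear_le b
  obtain ⟨C₂, hC₂, h₂⟩ := exists_abs_one_add_rpow_sub_one_le b
  refine ⟨C₁ + 2 * C₂, by positivity, fun z w x y d hz hx hy hd hw => ?_⟩
  have hd0 : 0 ≤ d := (abs_nonneg _).trans hx
  have ht : |x / z| ≤ d / z := by rw [abs_div, abs_of_pos hz]; gcongr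
  have ht2 : |x / z| ≤ 1 / 2 := ht.trans (by rw [div_le_iff₀ hz]; exact hd)
  have e1 : (z + x) ^ b = z ^ b * (1 + x / z) ^ b := by
    rw [← Real.mul_rpow hz.le (by linarith [neg_abs_le (x / z)])]
    congr 1; field_simp
  have e2 : z ^ (b - 1) = z ^ b / z := by rw [Real.rpow_sub hz, Real.rpow_one]
  have e3 : z ^ (b + 2) = z ^ b * z ^ 2 := by
    rw [Real.rpow_add hz, ← Real.rpow_natCast z 2]; norm_num
  have e4 : (w + y) ^ 2 * (z + x) ^ b - w ^ 2 * z ^ b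
      - (b * w ^ 2 * z ^ (b - 1) * x + 2 * w * z ^ b * y + z ^ b * y ^ 2) =
      z ^ b * (w ^ 2 * ((1 + x / z) ^ b - (1 + b * (x / z))) +
        (2 * w * y + y ^ 2) * ((1 + x / z) ^ b - 1)) := by
    rw [e1, e2]; field_simp; ring
  have hzb := Real.rpow_pos_of_pos hz b
  rw [e4, abs_mul, abs_of_pos hzb, e3]
  have k1 : |w ^ 2 * ((1 + x / z) ^ b - (1 + b * (x / z)))| ≤ |w| * z * (C₁ * (d / z) ^ 2) := by
    rw [abs_mul, abs_pow, sq]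
    gcongr
    exact (h₁ _ ht2).trans (by gcongr)
  have k2 : |(2 * w * y + y ^ 2) * ((1 + x / z) ^ b - 1)| ≤
      (2 * |w| * d + d ^ 2) * (C₂ * (d / z)) := by
    rw [abs_mul]
    gcongr
    · refine (abs_add_le _ _).trans ?_
      rw [abs_mul, abs_mul, abs_two, abs_pow]
      gcongr
    · exact (h₂ _ ht2).trans (by gcongr)
  calc _ ≤ z ^ b * (|w| * z * (C₁ * (d / z) ^ 2) + (2 * |w| * d + d ^ 2) * (C₂ * (d / z))) := by
        gcongr
        exact (abs_add_le _ _).trans (add_le_add k1 k2)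
    _ = (C₁ + 2 * C₂) * z ^ b * (|w| / z) * d ^ 2 + C₂ * (z ^ b * z ^ 2) * (d / z) ^ 3 := by
        field_simp
        ring
    _ ≤ _ := by gcongr; linarith

lemma exists_mul_rpow_expansion (b : ℝ) : ∃ C : ℝ, 0 ≤ C ∧ ∀ z w x y d : ℝ, 0 < z →
    |x| ≤ d → |y| ≤ d → d ≤ 1 / 2 * z → |w| ≤ z →
    |(w + y) * (z + x) ^ b - w * z ^ b - (b * w * z ^ (b - 1) * x + z ^ b * y)| ≤
      C * z ^ (b - 1) * d ^ 2 := by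
  obtain ⟨C₁, hC₁, h₁⟩ := exists_abs_one_add_rpow_sub_linear_le b
  obtain ⟨C₂, hC₂, h₂⟩ := exists_abs_one_add_rpow_sub_one_le b
  refine ⟨C₁ + C₂, by positivity, fun z w x y d hz hx hy hd hw => ?_⟩
  have hd0 : 0 ≤ d := (abs_nonneg _).trans hx
  have ht : |x / z| ≤ d / z := by rw [abs_div, abs_of_pos hz]; gcongr
  have ht2 : |x / z| ≤ 1 / 2 := ht.trans (by rw [div_le_iff₀ hz]; exact hd)
  have e1 : (z + x) ^ b = z ^ b * (1 + x / z) ^ b := by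
    rw [← Real.mul_rpow hz.le (by linarith [neg_abs_le (x / z)])]
    congr 1; field_simp
  have e2 : z ^ (b - 1) = z ^ b / z := by rw [Real.rpow_sub hz, Real.rpow_one]
  have e4 : (w + y) * (z + x) ^ b - w * z ^ b - (b * w * z ^ (b - 1) * x + z ^ b * y) =
      z ^ b * (w * ((1 + x / z) ^ b - (1 + b * (x / z))) + y * ((1 + x / z) ^ b - 1)) := by
    rw [e1, e2]; field_simp; ring
  have hzb := Real.rpow_pos_of_pos hz b
  rw [e4, abs_mul, abs_of_pos hzb, e2]
  have k1 : |w * ((1 + x / z) ^ b - (1 + b * (x / z)))| ≤ z * (C₁ * (d / z) ^ 2) := by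
    rw [abs_mul]
    gcongr
    exact (h₁ _ ht2).trans (by gcongr)
  have k2 : |y * ((1 + x / z) ^ b - 1)| ≤ d * (C₂ * (d / z)) := by
    rw [abs_mul]
    gcongr
    exact (h₂ _ ht2).trans (by gcongr)
  calc _ ≤ z ^ b * (z * (C₁ * (d / z) ^ 2) + d * (C₂ * (d / z))) := by
        gcongr
        exact (abs_add_le _ _).trans (add_le_add k1 k2)
    _ = _ := by field_simp

/-- Parameters of the function
`c₀ log ℓ + c₁ ℓ^a + x₂² (A₀ x₁^{e-2} + A₁ x₁^{a-2}) + B x₂ x₁^{e-2+s}` with `ℓ = p x₁ + t x₂`. -/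
structure Potential where
  (c₀ c₁ a e A₀ A₁ B s p t : ℝ)

namespace Potential
variable (V : Potential)

/-- The linear functional `ℓ`. -/
def lin (z w : ℝ) : ℝ := V.p * z + V.t * w

/-- The value of the potential. -/
def val (z w : ℝ) : ℝ :=
  V.c₀ * Real.log (V.lin z w) + V.c₁ * V.lin z w ^ V.a
    + (V.A₀ * (w ^ 2 * z ^ (V.e - 2)) + V.A₁ * (w ^ 2 * z ^ (V.a - 2)))
    + V.B * (w * z ^ (V.e - 2 + V.s))

/-- The derivative of `c₀ log l + c₁ l^a`. -/
def radial (l : ℝ) : ℝ := V.c₀ * l⁻¹ + V.c₁ * (V.a * l ^ (V.a - 1))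

/-- Half of the second derivative of `c₀ log l + c₁ l^a`. -/
def radial₂ (l : ℝ) : ℝ :=
  V.c₀ * (-l ^ (-2 : ℝ) / 2) + V.c₁ * (V.a * (V.a - 1) * l ^ (V.a - 2) / 2)

/-- The coefficient of `x₂²`. -/
def transverse (z : ℝ) : ℝ := V.A₀ * z ^ (V.e - 2) + V.A₁ * z ^ (V.a - 2)

/-- The derivative of `val` in the first variable, up to the part of `ℓ`. -/
def slope (z w : ℝ) : ℝ :=
  V.A₀ * ((V.e - 2) * w ^ 2 * z ^ (V.e - 2 - 1)) + V.A₁ * ((V.a - 2) * w ^ 2 * z ^ (V.a - 2 - 1))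
    + V.B * ((V.e - 2 + V.s) * w * z ^ (V.e - 2 + V.s - 1))

/-- The partial derivative of `val` in the first variable. -/
def grad₀ (z w : ℝ) : ℝ := V.p * V.radial (V.lin z w) + V.slope z w

/-- The partial derivative of `val` in the second variable. -/
def grad₁ (z w : ℝ) : ℝ :=
  V.t * V.radial (V.lin z w) + (2 * w * V.transverse z + V.B * z ^ (V.e - 2 + V.s))

/-- The second-order Taylor polynomial of the increment of `val`, without the terms of lower
order in the second derivatives. -/
def taylor (z w x y : ℝ) : ℝ :=
  V.grad₀ z w * x + V.grad₁ z w * y + V.radial₂ (V.lin z w) * (V.p * x + V.t * y) ^ 2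
    + V.transverse z * y ^ 2

/-- Constraints on the parameters. -/
structure Admissible (β : ℝ) : Prop where
  p_pos : 0 < V.p
  p_le : V.p ≤ 1
  t_le : |V.t| ≤ 1
  c₀_eq : V.c₀ = 0 ∨ V.e = 0
  a_le : V.a ≤ V.e
  e_le : V.e ≤ 0
  s_pos : 0 < V.s
  s_le : V.s ≤ β
  β_lt : β < 1

variable {V} {β A : ℝ}

lemma exists_cone (hβ : β < 1) (A : ℝ) {p : ℝ} (hp : 0 < p) :
    ∃ Z : ℝ, 1 ≤ Z ∧ ∀ z w : ℝ, Z ≤ z → |w| ≤ A * z ^ β → |w| ≤ p / 2 * z := by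
  obtain ⟨Z, hZ⟩ := eventually_atTop.1 (eventually_mul_rpow_le hβ A (half_pos hp))
  refine ⟨max Z 1, le_max_right _ _, fun z w hz hw => hw.trans ?_⟩
  have := hZ z ((le_max_left _ _).trans hz)
  rwa [Real.rpow_one] at this

lemma Admissible.lin_bounds (h : V.Admissible β) {z w : ℝ} (hz : 0 < z)
    (hw : |w| ≤ V.p / 2 * z) : V.p / 2 * z ≤ V.lin z w ∧ V.lin z w ≤ 2 * z := by
  have h1 : |V.t * w| ≤ 1 * |w| := by rw [abs_mul]; gcongr; exact h.t_le
  have h2 := abs_le.1 h1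
  have h3 : V.p * z ≤ 1 * z := by gcongr; exact h.p_le
  have h4 := h.p_pos
  constructor <;> simp only [lin] <;> nlinarith

lemma div_cube_le {q d z : ℝ} (hq : 2 < q) (hq3 : q ≤ 3) (hd : 0 ≤ d) (hz : 0 < z) (h : d ≤ z) :
    (d / z) ^ 3 ≤ z ^ (-q) * d ^ q := by
  refine (cube_le_rpow (by positivity) ((div_le_one hz).2 h) hq hq3).trans ?_
  rw [Real.div_rpow hd hz.le, Real.rpow_neg hz.le]
  exact (by ring : d ^ q / z ^ q = (z ^ q)⁻¹ * d ^ q).le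

/-- The expansion of the potential for jumps that are small compared with the distance from the
origin. -/
lemma Admissible.exists_expansion (h : V.Admissible β) {q η : ℝ} (hq : 2 < q)
    (hq3 : q ≤ 3) (hηβ : η ≤ 1 - β) (hηq : 2 + η - V.e ≤ q) (hA : 0 ≤ A) :
    ∃ C Z : ℝ, 0 ≤ C ∧ 1 ≤ Z ∧ ∀ z w x y d : ℝ, Z ≤ z → |w| ≤ A * z ^ β → |x| ≤ d → |y| ≤ d →
      d ≤ V.p / 8 * z →
      |V.val (z + x) (w + y) - V.val z w - V.taylor z w x y| ≤
        C * z ^ (V.e - 2 - η) * (1 + d ^ q) := by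
  have hp := h.p_pos
  obtain ⟨Z, hZ1, hZ⟩ := exists_cone h.β_lt A hp
  obtain ⟨C₁, hC₁, h₁⟩ := exists_rpow_expansion V.a (half_pos hp)
  obtain ⟨C₂, hC₂, h₂⟩ := exists_sq_mul_rpow_expansion (V.e - 2)
  obtain ⟨C₃, hC₃, h₃⟩ := exists_sq_mul_rpow_expansion (V.a - 2)
  obtain ⟨C₄, hC₄, h₄⟩ := exists_mul_rpow_expansion (V.e - 2 + V.s)
  set C₀ : ℝ := (2 / (V.p / 2)) ^ 3
  have hC₀ : 0 ≤ C₀ := by positivity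
  refine ⟨|V.c₀| * C₀ + |V.c₁| * C₁ + |V.A₀| * (C₂ * A + C₂) + |V.A₁| * (C₃ * A + C₃)
    + |V.B| * C₄, Z, by positivity, hZ1, fun z w x y d hz hw hx hy hd => ?_⟩
  have hz1 : 1 ≤ z := hZ1.trans hz
  have hz0 : 0 < z := by linarith
  have hwp := hZ z w hz hw
  obtain ⟨hl1, hl2⟩ := h.lin_bounds hz0 hwp
  have hd0 : 0 ≤ d := (abs_nonneg _).trans hx
  have hp1 := h.p_le
  have hwz : |w| ≤ z := hwp.trans (by nlinarith)
  have hdz2 : d ≤ 1 / 2 * z := hd.trans (by nlinarith)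
  have hdz : d ≤ z := by linarith
  set D : ℝ := V.p * x + V.t * y
  have hD : |D| ≤ 2 * d := by
    have k1 : |V.p * x| ≤ 1 * d := by rw [abs_mul, abs_of_pos hp]; gcongr
    have k2 : |V.t * y| ≤ 1 * d := by rw [abs_mul]; gcongr; exact h.t_le
    have := abs_add_le (V.p * x) (V.t * y)
    simp only [D]; linarith
  have hlin : V.lin (z + x) (w + y) = V.lin z w + D := by simp only [lin, D]; ring
  have hdq : 0 ≤ d ^ q := by positivity
  set F : ℝ := z ^ (V.e - 2 - η) * (1 + d ^ q)
  -- A cubic relative remainder is at most `(d / z)^q`. The condition `2 + η - e ≤ q` says that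
  -- `z^(-q)` is no larger than `z^(e-2-η)`.
  have hcube : ∀ b, b ≤ V.e → z ^ b * (d / z) ^ 3 ≤ F := by
    intro b hb
    calc z ^ b * (d / z) ^ 3 ≤ z ^ b * (z ^ (-q) * d ^ q) := by
          gcongr; exact div_cube_le hq hq3 hd0 hz0 hdz
      _ = z ^ (b - q) * d ^ q := by rw [← mul_assoc, ← Real.rpow_add hz0]; ring_nf
      _ ≤ z ^ (V.e - 2 - η) * (1 + d ^ q) := by
          have : z ^ (b - q) ≤ z ^ (V.e - 2 - η) :=
            Real.rpow_le_rpow_of_exponent_le hz1 (by linarith [h.e_le])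
          gcongr
          linarith
  have hsq : d ^ 2 ≤ 1 + d ^ q := by
    rcases le_total d 1 with hd1 | hd1
    · nlinarith
    · have : d ^ 2 ≤ d ^ q := by
        rw [← Real.rpow_natCast]
        exact Real.rpow_le_rpow_of_exponent_le hd1 (by push_cast; linarith)
      linarith
  -- Sublinearity of the domain enters here: `|w| / z` gains the factor `z^(-η)` because `η ≤ 1 -
  -- β`.
  have hwη : |w| / z ≤ A * z ^ (-η) := by
    rw [div_le_iff₀ hz0, mul_assoc, ← Real.rpow_add_one hz0.ne']
    have : z ^ β ≤ z ^ (-η + 1) := Real.rpow_le_rpow_of_exponent_le hz1 (by linarith)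
    exact hw.trans (by gcongr)
  have hquad : ∀ b, b ≤ V.e → z ^ (b - 2) * (|w| / z) * d ^ 2 ≤ A * F := by
    intro b hb
    calc z ^ (b - 2) * (|w| / z) * d ^ 2 ≤ z ^ (V.e - 2) * (A * z ^ (-η)) * (1 + d ^ q) := by
          have : z ^ (b - 2) ≤ z ^ (V.e - 2) :=
            Real.rpow_le_rpow_of_exponent_le hz1 (by linarith)
          gcongr
      _ = A * F := by
          simp only [F]
          rw [show V.e - 2 - η = V.e - 2 + -η by ring, Real.rpow_add hz0]; ring
  -- A logarithm is admitted only with `e = 0`, so that its derivatives have the same order as those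
  -- of the other terms.
  have g₀ : |V.c₀ * (Real.log (V.lin z w + D) - Real.log (V.lin z w)
      - ((V.lin z w)⁻¹ * D + -(V.lin z w) ^ (-2 : ℝ) / 2 * D ^ 2))| ≤ |V.c₀| * C₀ * F := by
    rcases h.c₀_eq with h0 | h0
    · simp [h0]
    · rw [abs_mul, mul_assoc |V.c₀|]
      gcongr
      refine (log_expansion (half_pos hp) hz0 hl1 hD (by linarith)).trans ?_
      have := hcube 0 h0.ge
      rw [Real.rpow_zero, one_mul] at this
      gcongr
  have g₁ : |V.c₁ * ((V.lin z w + D) ^ V.a - V.lin z w ^ V.a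
      - (V.a * V.lin z w ^ (V.a - 1) * D + V.a * (V.a - 1) * V.lin z w ^ (V.a - 2) / 2 * D ^ 2))| ≤
        |V.c₁| * C₁ * F := by
    rw [abs_mul, mul_assoc |V.c₁|]
    gcongr
    refine (h₁ z _ D d hz0 hl1 hl2 hD (by linarith)).trans ?_
    rw [mul_assoc]
    gcongr
    exact hcube _ h.a_le
  have g₂ : |V.A₀ * ((w + y) ^ 2 * (z + x) ^ (V.e - 2) - w ^ 2 * z ^ (V.e - 2)
      - ((V.e - 2) * w ^ 2 * z ^ (V.e - 2 - 1) * x + 2 * w * z ^ (V.e - 2) * y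
        + z ^ (V.e - 2) * y ^ 2))| ≤ |V.A₀| * (C₂ * A + C₂) * F := by
    rw [abs_mul, mul_assoc |V.A₀|]
    gcongr
    refine (h₂ z w x y d hz0 hx hy hdz2 hwz).trans ?_
    have k1 := hquad _ le_rfl
    have k2 := hcube _ le_rfl
    rw [sub_add_cancel]
    calc _ = C₂ * (z ^ (V.e - 2) * (|w| / z) * d ^ 2) + C₂ * (z ^ V.e * (d / z) ^ 3) := by ring
      _ ≤ C₂ * (A * F) + C₂ * F := by gcongr
      _ = _ := by ring
  have g₃ : |V.A₁ * ((w + y) ^ 2 * (z + x) ^ (V.a - 2) - w ^ 2 * z ^ (V.a - 2)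
      - ((V.a - 2) * w ^ 2 * z ^ (V.a - 2 - 1) * x + 2 * w * z ^ (V.a - 2) * y
        + z ^ (V.a - 2) * y ^ 2))| ≤ |V.A₁| * (C₃ * A + C₃) * F := by
    rw [abs_mul, mul_assoc |V.A₁|]
    gcongr
    refine (h₃ z w x y d hz0 hx hy hdz2 hwz).trans ?_
    have k1 := hquad _ h.a_le
    have k2 := hcube _ h.a_le
    rw [sub_add_cancel]
    calc _ = C₃ * (z ^ (V.a - 2) * (|w| / z) * d ^ 2) + C₃ * (z ^ V.a * (d / z) ^ 3) := by ring
      _ ≤ C₃ * (A * F) + C₃ * F := by gcongr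
      _ = _ := by ring
  have g₄ : |V.B * ((w + y) * (z + x) ^ (V.e - 2 + V.s) - w * z ^ (V.e - 2 + V.s)
      - ((V.e - 2 + V.s) * w * z ^ (V.e - 2 + V.s - 1) * x + z ^ (V.e - 2 + V.s) * y))| ≤
        |V.B| * C₄ * F := by
    rw [abs_mul, mul_assoc |V.B|]
    gcongr
    refine (h₄ z w x y d hz0 hx hy hdz2 hwz).trans ?_
    rw [mul_assoc]
    have : z ^ (V.e - 2 + V.s - 1) ≤ z ^ (V.e - 2 - η) :=
      Real.rpow_le_rpow_of_exponent_le hz1 (by linarith [h.s_le])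
    simp only [F]
    gcongr
  have hsum : V.val (z + x) (w + y) - V.val z w - V.taylor z w x y =
      V.c₀ * (Real.log (V.lin z w + D) - Real.log (V.lin z w)
      - ((V.lin z w)⁻¹ * D + -(V.lin z w) ^ (-2 : ℝ) / 2 * D ^ 2))
      + V.c₁ * ((V.lin z w + D) ^ V.a - V.lin z w ^ V.a
      - (V.a * V.lin z w ^ (V.a - 1) * D + V.a * (V.a - 1) * V.lin z w ^ (V.a - 2) / 2 * D ^ 2))
      + V.A₀ * ((w + y) ^ 2 * (z + x) ^ (V.e - 2) - w ^ 2 * z ^ (V.e - 2)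
      - ((V.e - 2) * w ^ 2 * z ^ (V.e - 2 - 1) * x + 2 * w * z ^ (V.e - 2) * y
        + z ^ (V.e - 2) * y ^ 2))
      + V.A₁ * ((w + y) ^ 2 * (z + x) ^ (V.a - 2) - w ^ 2 * z ^ (V.a - 2)
      - ((V.a - 2) * w ^ 2 * z ^ (V.a - 2 - 1) * x + 2 * w * z ^ (V.a - 2) * y
        + z ^ (V.a - 2) * y ^ 2))
      + V.B * ((w + y) * (z + x) ^ (V.e - 2 + V.s) - w * z ^ (V.e - 2 + V.s)
      - ((V.e - 2 + V.s) * w * z ^ (V.e - 2 + V.s - 1) * x + z ^ (V.e - 2 + V.s) * y)) := by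
    simp only [val, hlin, taylor, grad₀, grad₁, radial, radial₂, transverse, slope, D]
    ring
  rw [hsum]
  calc _ ≤ |V.c₀| * C₀ * F + |V.c₁| * C₁ * F + |V.A₀| * (C₂ * A + C₂) * F
        + |V.A₁| * (C₃ * A + C₃) * F + |V.B| * C₄ * F := by
        refine (abs_add_le _ _).trans (add_le_add ?_ g₄)
        refine (abs_add_le _ _).trans (add_le_add ?_ g₃)
        refine (abs_add_le _ _).trans (add_le_add ?_ g₂)
        exact (abs_add_le _ _).trans (add_le_add g₀ g₁)
    _ = _ := by simp only [F]; ring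

end Potential

/-! ### Size of the derivatives of a potential, large jumps, and the passage to the expectation -/

namespace Potential

variable {V : Potential} {β A : ℝ}

lemma Admissible.exists_radial_le (h : V.Admissible β) : ∃ C : ℝ, 0 ≤ C ∧
    ∀ z l : ℝ, 1 ≤ z → V.p / 2 * z ≤ l → l ≤ 2 * z →
      |V.radial l| ≤ C * z ^ (V.e - 1) ∧ |V.radial₂ l| ≤ C * z ^ (V.e - 2) := by
  have hp := half_pos h.p_pos
  obtain ⟨C₁, hC₁, h₁⟩ := exists_rpow_le (-1) hp
  obtain ⟨C₂, hC₂, h₂⟩ := exists_rpow_le (V.a - 1) hp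
  obtain ⟨C₃, hC₃, h₃⟩ := exists_rpow_le (-2) hp
  obtain ⟨C₄, hC₄, h₄⟩ := exists_rpow_le (V.a - 2) hp
  refine ⟨|V.c₀| * (C₁ + C₃) + |V.c₁| * (|V.a| * C₂ + |V.a * (V.a - 1)| * C₄), by positivity,
    fun z l hz hl1 hl2 => ?_⟩
  have hz0 : 0 < z := by linarith
  have hl : 0 < l := lt_of_lt_of_le (by positivity) hl1
  have ha := h.a_le
  constructor
  · have k1 : |V.c₀ * l⁻¹| ≤ |V.c₀| * C₁ * z ^ (V.e - 1) := by
      rcases h.c₀_eq with h0 | h0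
      · simp [h0]
      · rw [abs_mul, abs_of_pos (inv_pos.2 hl), ← Real.rpow_neg_one, mul_assoc, h0, zero_sub]
        gcongr
        exact h₁ z l hz0 hl1 hl2
    have k2 : |V.c₁ * (V.a * l ^ (V.a - 1))| ≤ |V.c₁| * (|V.a| * C₂) * z ^ (V.e - 1) := by
      rw [abs_mul, abs_mul, abs_of_pos (Real.rpow_pos_of_pos hl _), mul_assoc, mul_assoc]
      gcongr
      exact (h₂ z l hz0 hl1 hl2).trans (by gcongr)
    refine (abs_add_le _ _).trans ((add_le_add k1 k2).trans ?_)
    rw [← add_mul]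
    gcongr
    · linarith
    · have : 0 ≤ |V.a * (V.a - 1)| * C₄ := by positivity
      linarith
  · have k1 : |V.c₀ * (-l ^ (-2 : ℝ) / 2)| ≤ |V.c₀| * C₃ * z ^ (V.e - 2) := by
      rcases h.c₀_eq with h0 | h0
      · simp [h0]
      · have hl2' := Real.rpow_pos_of_pos hl (-2)
        rw [abs_mul, neg_div, abs_neg, abs_of_pos (by positivity : 0 < l ^ (-2 : ℝ) / 2), mul_assoc, h0, zero_sub]
        gcongr
        linarith [h₃ z l hz0 hl1 hl2]
    have k2 : |V.c₁ * (V.a * (V.a - 1) * l ^ (V.a - 2) / 2)| ≤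
        |V.c₁| * (|V.a * (V.a - 1)| * C₄) * z ^ (V.e - 2) := by
      have hl2' := Real.rpow_pos_of_pos hl (V.a - 2)
      rw [mul_div_assoc, abs_mul, abs_mul (V.a * (V.a - 1)),
        abs_of_pos (by positivity : 0 < l ^ (V.a - 2) / 2), mul_assoc, mul_assoc]
      gcongr
      have : C₄ * z ^ (V.a - 2) ≤ C₄ * z ^ (V.e - 2) := by gcongr
      linarith [h₄ z l hz0 hl1 hl2]
    refine (abs_add_le _ _).trans ((add_le_add k1 k2).trans ?_)
    rw [← add_mul]
    gcongr
    · linarith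
    · have : 0 ≤ |V.a| * C₂ := by positivity
      linarith

lemma Admissible.abs_transverse_le (h : V.Admissible β) {z : ℝ} (hz : 1 ≤ z) :
    |V.transverse z| ≤ (|V.A₀| + |V.A₁|) * z ^ (V.e - 2) := by
  have ha := h.a_le
  have hz0 : 0 < z := by linarith
  refine (abs_add_le _ _).trans ?_
  rw [abs_mul, abs_mul, abs_of_pos (Real.rpow_pos_of_pos hz0 _),
    abs_of_pos (Real.rpow_pos_of_pos hz0 _), add_mul]
  gcongr

/-- The transverse terms give `w² z^(e-3)` and the tilt gives `w z^(e-3+s)`; with `|w| ≤ A z^β` and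
`s ≤ β` both fit the stated power. -/
lemma Admissible.exists_slope_le (h : V.Admissible β) (hA : 0 ≤ A) : ∃ C : ℝ, 0 ≤ C ∧
    ∀ z w : ℝ, 1 ≤ z → |w| ≤ A * z ^ β → |V.slope z w| ≤ C * z ^ (V.e - 3 + 2 * β) := by
  refine ⟨|V.A₀| * (|V.e - 2| * A ^ 2) + |V.A₁| * (|V.a - 2| * A ^ 2)
    + |V.B| * (|V.e - 2 + V.s| * A), by positivity, fun z w hz hw => ?_⟩
  have hz0 : 0 < z := by linarith
  have ha := h.a_le
  have key : ∀ b, b ≤ V.e → |(b - 2) * w ^ 2 * z ^ (b - 2 - 1)| ≤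
      |b - 2| * A ^ 2 * z ^ (V.e - 3 + 2 * β) := by
    intro b hb
    rw [abs_mul, abs_mul, abs_pow, abs_of_pos (Real.rpow_pos_of_pos hz0 _), mul_assoc, mul_assoc]
    refine mul_le_mul_of_nonneg_left ?_ (abs_nonneg _)
    calc |w| ^ 2 * z ^ (b - 2 - 1) ≤ (A * z ^ β) ^ 2 * z ^ (b - 2 - 1) := by gcongr
      _ = A ^ 2 * z ^ (b - 3 + 2 * β) := by
          rw [mul_pow, mul_assoc, ← Real.rpow_natCast (z ^ β), ← Real.rpow_mul hz0.le,
            ← Real.rpow_add hz0]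
          congr 2; push_cast; ring
      _ ≤ _ := by gcongr
  have key2 : |(V.e - 2 + V.s) * w * z ^ (V.e - 2 + V.s - 1)| ≤
      |V.e - 2 + V.s| * A * z ^ (V.e - 3 + 2 * β) := by
    rw [abs_mul, abs_mul, abs_of_pos (Real.rpow_pos_of_pos hz0 _), mul_assoc, mul_assoc]
    refine mul_le_mul_of_nonneg_left ?_ (abs_nonneg _)
    calc |w| * z ^ (V.e - 2 + V.s - 1) ≤ (A * z ^ β) * z ^ (V.e - 2 + V.s - 1) := by gcongr
      _ = A * z ^ (V.e - 3 + V.s + β) := by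
          rw [mul_assoc, ← Real.rpow_add hz0]; congr 2; ring
      _ ≤ _ := by
          have := h.s_le
          have : z ^ (V.e - 3 + V.s + β) ≤ z ^ (V.e - 3 + 2 * β) :=
            Real.rpow_le_rpow_of_exponent_le hz (by linarith)
          gcongr
  have k1 := mul_le_mul_of_nonneg_left (key V.e le_rfl) (abs_nonneg V.A₀)
  have k2 := mul_le_mul_of_nonneg_left (key V.a ha) (abs_nonneg V.A₁)
  have k3 := mul_le_mul_of_nonneg_left key2 (abs_nonneg V.B)
  rw [← abs_mul] at k1 k2 k3
  refine (abs_add_le _ _).trans ((add_le_add_left (abs_add_le _ _) _).trans ?_)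
  refine (add_le_add (add_le_add k1 k2) k3).trans (le_of_eq ?_)
  ring

lemma Admissible.exists_grad_le (h : V.Admissible β) (hA : 0 ≤ A) : ∃ C Z : ℝ, 0 ≤ C ∧ 1 ≤ Z ∧
    ∀ z w : ℝ, Z ≤ z → |w| ≤ A * z ^ β →
      |V.grad₀ z w| ≤ C * z ^ (V.e - 1) ∧ |V.grad₁ z w| ≤ C * z ^ (V.e - 1) ∧
      |V.radial₂ (V.lin z w)| ≤ C * z ^ (V.e - 2) ∧ |V.transverse z| ≤ C * z ^ (V.e - 2) := by
  obtain ⟨Z, hZ1, hZ⟩ := exists_cone h.β_lt A h.p_pos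
  obtain ⟨C₁, hC₁, h₁⟩ := h.exists_radial_le
  obtain ⟨C₂, hC₂, h₂⟩ := h.exists_slope_le hA
  set C₃ := |V.A₀| + |V.A₁|
  refine ⟨C₁ + C₂ + 2 * A * C₃ + |V.B| + C₃, Z, by positivity, hZ1, fun z w hz hw => ?_⟩
  have hz1 : 1 ≤ z := hZ1.trans hz
  have hz0 : 0 < z := by linarith
  obtain ⟨hl1, hl2⟩ := h.lin_bounds hz0 (hZ z w hz hw)
  obtain ⟨hr, hr2⟩ := h₁ z _ hz1 hl1 hl2
  have ht : |V.transverse z| ≤ C₃ * z ^ (V.e - 2) := h.abs_transverse_le hz1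
  have hs := h₂ z w hz1 hw
  have hβ := h.β_lt
  have hsβ := h.s_le
  have hze1 := Real.rpow_pos_of_pos hz0 (V.e - 1)
  have hze2 := Real.rpow_pos_of_pos hz0 (V.e - 2)
  have n1 : 0 ≤ 2 * A * C₃ := by positivity
  have n2 : 0 ≤ |V.B| := abs_nonneg _
  have n3 : 0 ≤ C₃ := by positivity
  refine ⟨?_, ?_, hr2.trans (by gcongr; linarith), ht.trans (by gcongr; linarith)⟩
  · have k1 : |V.p * V.radial (V.lin z w)| ≤ 1 * (C₁ * z ^ (V.e - 1)) := by
      rw [abs_mul, abs_of_pos h.p_pos]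
      gcongr
      exact h.p_le
    have k2 : |V.slope z w| ≤ C₂ * z ^ (V.e - 1) := by
      refine hs.trans ?_
      have : z ^ (V.e - 3 + 2 * β) ≤ z ^ (V.e - 1) :=
        Real.rpow_le_rpow_of_exponent_le hz1 (by linarith)
      gcongr
    refine (abs_add_le _ _).trans ((add_le_add k1 k2).trans ?_)
    rw [one_mul, ← add_mul]
    exact mul_le_mul_of_nonneg_right (by linarith) hze1.le
  · have k1 : |V.t * V.radial (V.lin z w)| ≤ 1 * (C₁ * z ^ (V.e - 1)) := by
      rw [abs_mul]
      gcongr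
      exact h.t_le
    have k2 : |2 * w * V.transverse z| ≤ 2 * A * C₃ * z ^ (V.e - 1) := by
      rw [abs_mul, abs_mul, abs_two]
      calc 2 * |w| * |V.transverse z| ≤ 2 * (A * z ^ β) * (C₃ * z ^ (V.e - 2)) := by gcongr
        _ = 2 * A * C₃ * z ^ (β + (V.e - 2)) := by rw [Real.rpow_add hz0]; ring
        _ ≤ _ := by
          have : z ^ (β + (V.e - 2)) ≤ z ^ (V.e - 1) :=
            Real.rpow_le_rpow_of_exponent_le hz1 (by linarith)
          gcongr
    have k3 : |V.B * z ^ (V.e - 2 + V.s)| ≤ |V.B| * z ^ (V.e - 1) := by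
      rw [abs_mul, abs_of_pos (Real.rpow_pos_of_pos hz0 _)]
      have : z ^ (V.e - 2 + V.s) ≤ z ^ (V.e - 1) :=
        Real.rpow_le_rpow_of_exponent_le hz1 (by linarith)
      gcongr
    refine (abs_add_le _ _).trans ((add_le_add k1 ((abs_add_le _ _).trans
      (add_le_add k2 k3))).trans ?_)
    rw [one_mul, ← add_mul, ← add_mul]
    exact mul_le_mul_of_nonneg_right (by linarith) hze1.le

/-- For large jumps, powers of the relative size of the jump up to the second are dominated
by the power `q`. -/
lemma large_jump {q θ τ : ℝ} (hq : 2 < q) (hθ : 0 < θ) (hθ1 : θ ≤ 1) (hτ : θ ≤ τ) :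
    1 ≤ θ ^ (-q) * τ ^ q ∧ τ ≤ θ ^ (-q) * τ ^ q ∧ τ ^ 2 ≤ θ ^ (-q) * τ ^ q := by
  have hτ0 : 0 < τ := hθ.trans_le hτ
  have hu : 1 ≤ τ / θ := (one_le_div hθ).2 hτ
  have e : θ ^ (-q) * τ ^ q = (τ / θ) ^ q := by
    rw [Real.div_rpow hτ0.le hθ.le, Real.rpow_neg hθ.le, mul_comm, div_eq_mul_inv]
  have hτu : τ ≤ τ / θ := le_div_self hτ0.le hθ hθ1
  rw [e]
  refine ⟨Real.one_le_rpow hu (by linarith), ?_, ?_⟩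
  · exact hτu.trans (Real.self_le_rpow_of_one_le hu (by linarith))
  · calc τ ^ 2 ≤ (τ / θ) ^ 2 := by gcongr
      _ = (τ / θ) ^ (2 : ℝ) := by norm_cast
      _ ≤ _ := Real.rpow_le_rpow_of_exponent_le hu hq.le

/-- For jumps comparable to `z` the Taylor polynomial approximates nothing. Its size is bounded so
that it can be integrated over all jumps, with the contribution of the large ones charged to the
error. -/
lemma Admissible.exists_taylor_le (h : V.Admissible β) {q η : ℝ} (hq : 2 < q)
    (hηq : 2 + η - V.e ≤ q) (hA : 0 ≤ A) :
    ∃ C Z : ℝ, 0 ≤ C ∧ 1 ≤ Z ∧ ∀ z w x y d : ℝ, Z ≤ z → |w| ≤ A * z ^ β → |x| ≤ d → |y| ≤ d →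
      V.p / 8 * z ≤ d → |V.taylor z w x y| ≤ C * z ^ (V.e - 2 - η) * d ^ q := by
  obtain ⟨C, Z, hC, hZ1, hb⟩ := h.exists_grad_le hA
  refine ⟨7 * C * (V.p / 8) ^ (-q), Z, ?_, hZ1, fun z w x y d hz hw hx hy hd => ?_⟩
  · have := h.p_pos
    positivity
  have hp := h.p_pos
  have hz1 : 1 ≤ z := hZ1.trans hz
  have hz0 : 0 < z := by linarith
  have hd0 : 0 ≤ d := (abs_nonneg _).trans hx
  obtain ⟨b0, b1, b2, b3⟩ := hb z w hz hw
  obtain ⟨-, l1, l2⟩ := large_jump hq (by positivity : 0 < V.p / 8) (by linarith [h.p_le])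
    ((le_div_iff₀ hz0).2 hd)
  set K := (V.p / 8) ^ (-q) * (d / z) ^ q
  have hlin : |V.p * x + V.t * y| ≤ 2 * d := by
    have k1 : |V.p * x| ≤ 1 * d := by rw [abs_mul, abs_of_pos hp]; gcongr; exact h.p_le
    have k2 : |V.t * y| ≤ 1 * d := by rw [abs_mul]; gcongr; exact h.t_le
    have := abs_add_le (V.p * x) (V.t * y)
    linarith
  have hze := Real.rpow_pos_of_pos hz0 V.e
  have e1 : z ^ (V.e - 1) * d = z ^ V.e * (d / z) := by
    rw [Real.rpow_sub hz0, Real.rpow_one]; ring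
  have e2 : z ^ (V.e - 2) * d ^ 2 = z ^ V.e * (d / z) ^ 2 := by
    rw [Real.rpow_sub hz0, show z ^ (2 : ℝ) = z ^ 2 by norm_cast]
    field_simp
  have k1 : |V.grad₀ z w * x| ≤ C * z ^ (V.e - 1) * d := by rw [abs_mul]; gcongr
  have k2 : |V.grad₁ z w * y| ≤ C * z ^ (V.e - 1) * d := by rw [abs_mul]; gcongr
  have k3 : |V.radial₂ (V.lin z w) * (V.p * x + V.t * y) ^ 2| ≤
      C * z ^ (V.e - 2) * (2 * d) ^ 2 := by rw [abs_mul, abs_pow]; gcongr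
  have k4 : |V.transverse z * y ^ 2| ≤ C * z ^ (V.e - 2) * d ^ 2 := by
    rw [abs_mul, abs_pow]; gcongr
  have hfin : z ^ V.e * (d / z) ^ q ≤ z ^ (V.e - 2 - η) * d ^ q := by
    have : z ^ V.e * (d / z) ^ q = z ^ (V.e - q) * d ^ q := by
      rw [Real.div_rpow hd0 hz0.le, Real.rpow_sub hz0]; ring
    rw [this]
    have : z ^ (V.e - q) ≤ z ^ (V.e - 2 - η) :=
      Real.rpow_le_rpow_of_exponent_le hz1 (by linarith [h.e_le])
    gcongr
  have hpq : 0 ≤ (V.p / 8) ^ (-q) := by positivity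
  calc |V.taylor z w x y| ≤ C * z ^ (V.e - 1) * d + C * z ^ (V.e - 1) * d
        + C * z ^ (V.e - 2) * (2 * d) ^ 2 + C * z ^ (V.e - 2) * d ^ 2 := by
        refine (abs_add_le _ _).trans (add_le_add ?_ k4)
        refine (abs_add_le _ _).trans (add_le_add ?_ k3)
        exact (abs_add_le _ _).trans (add_le_add k1 k2)
    _ = 2 * C * (z ^ (V.e - 1) * d) + 5 * C * (z ^ (V.e - 2) * d ^ 2) := by ring
    _ ≤ 2 * C * (z ^ V.e * K) + 5 * C * (z ^ V.e * K) := by rw [e1, e2]; gcongr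
    _ = 7 * C * (V.p / 8) ^ (-q) * (z ^ V.e * (d / z) ^ q) := by simp only [K]; ring
    _ ≤ 7 * C * (V.p / 8) ^ (-q) * (z ^ (V.e - 2 - η) * d ^ q) := by gcongr
    _ = _ := by ring

/-- The expectation of the Taylor polynomial in terms of the moments of the increment. -/
def drift (V : Potential) {S : Set Plane} (κ : Kernel S S) (x : S) : ℝ :=
  V.grad₀ ((x : Plane) 0) ((x : Plane) 1) * meanIncrement κ x 0
    + V.grad₁ ((x : Plane) 0) ((x : Plane) 1) * meanIncrement κ x 1
    + V.radial₂ (V.lin ((x : Plane) 0) ((x : Plane) 1)) * V.p ^ 2 * secondMoment κ x 0 0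
    + V.radial₂ (V.lin ((x : Plane) 0) ((x : Plane) 1)) * (2 * V.p * V.t) * secondMoment κ x 0 1
    + (V.radial₂ (V.lin ((x : Plane) 0) ((x : Plane) 1)) * V.t ^ 2
      + V.transverse ((x : Plane) 0)) * secondMoment κ x 1 1

/-- A function that agrees with the potential away from the origin and grows slowly over large
jumps is superharmonic where the drift of the potential is negative. -/
theorem Admissible.exists_superharmonic (h : V.Admissible β) {S : Set Plane} {κ : Kernel S S}
    [IsMarkovKernel κ]
    {q η M R₀ Z₀ C₀ : ℝ} (hq : 2 < q) (hq3 : q ≤ 3) (hηβ : η ≤ 1 - β) (hηq : 2 + η - V.e ≤ q)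
    (hA : 0 ≤ A) (hM : MomentBound κ q M) (hC₀ : 0 ≤ C₀)
    (hS : ∀ x : S, 1 ≤ (x : Plane) 0 → |(x : Plane) 1| ≤ A * (x : Plane) 0 ^ β)
    {f : S → ℝ} (hf0 : ∀ y, 0 ≤ f y)
    (hf : ∀ y : S, R₀ ≤ (y : Plane) 0 → f y = V.val ((y : Plane) 0) ((y : Plane) 1))
    (hlarge : ∀ x y : S, Z₀ ≤ (x : Plane) 0 →
      V.p / 8 * (x : Plane) 0 ≤ ‖(y : Plane) - (x : Plane)‖ →
      f y ≤ f x + C₀ * (‖(y : Plane) - (x : Plane)‖ / (x : Plane) 0) ^ q)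
    (hdrift : ∀ E : ℝ, ∃ Z : ℝ, ∀ x : S, Z ≤ (x : Plane) 0 →
      V.drift κ x + E * (x : Plane) 0 ^ (V.e - 2 - η) ≤ 0) :
    ∃ Z : ℝ, ∀ x : S, Z ≤ (x : Plane) 0 →
      ∫⁻ y, ENNReal.ofReal (f y) ∂(κ x) ≤ ENNReal.ofReal (f x) := by
  obtain ⟨C₁, Z₁, hC₁, hZ₁, h₁⟩ := h.exists_expansion (A := A) hq hq3 hηβ hηq hA
  obtain ⟨C₂, Z₂, hC₂, hZ₂, h₂⟩ := h.exists_taylor_le (A := A) hq hηq hA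
  obtain ⟨Z₃, h₃⟩ := hdrift ((C₁ + C₂ + C₀) * (1 + M))
  -- From `z ≥ 2 |R₀|`, a jump of length at most `z / 2` stays where `f` coincides with the
  -- potential.
  refine ⟨max (max Z₀ (2 * |R₀|)) (max (max Z₁ Z₂) Z₃), fun x hx => ?_⟩
  simp only [max_le_iff] at hx
  obtain ⟨⟨hx0, hxR⟩, ⟨hx1, hx2⟩, hx3⟩ := hx
  set z := (x : Plane) 0
  set w := (x : Plane) 1
  have hz1 : 1 ≤ z := hZ₁.trans hx1
  have hz0 : 0 < z := by linarith
  have hw := hS x hz1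
  have hp := h.p_pos
  have hfx : f x = V.val z w := hf x (by linarith [le_abs_self R₀, abs_nonneg R₀])
  set F := z ^ (V.e - 2 - η)
  have hF : 0 < F := Real.rpow_pos_of_pos hz0 _
  have hpt : ∀ y : S, f y ≤ f x + V.taylor z w (((y : Plane) - (x : Plane)) 0)
      (((y : Plane) - (x : Plane)) 1)
      + (C₁ + C₂ + C₀) * F * (1 + ‖(y : Plane) - (x : Plane)‖ ^ q) := by
    intro y
    set d := ‖(y : Plane) - (x : Plane)‖
    have hd0 : 0 ≤ d := norm_nonneg _
    have hdq : 0 ≤ d ^ q := by positivity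
    have hx' := abs_apply_le_norm ((y : Plane) - (x : Plane)) 0
    have hy' := abs_apply_le_norm ((y : Plane) - (x : Plane)) 1
    have e0 : (y : Plane) 0 = z + ((y : Plane) - (x : Plane)) 0 := by
      rw [PiLp.sub_apply]; ring
    have e1 : (y : Plane) 1 = w + ((y : Plane) - (x : Plane)) 1 := by
      rw [PiLp.sub_apply]; ring
    rcases le_total d (V.p / 8 * z) with hd | hd
    · have k := h₁ z w _ _ d hx1 hw hx' hy' hd
      rw [← e0, ← e1, ← hfx] at k
      have hy0 : R₀ ≤ (y : Plane) 0 := by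
        have : d ≤ 1 / 2 * z := hd.trans (by nlinarith [h.p_le])
        rw [e0]
        linarith [neg_abs_le (((y : Plane) - (x : Plane)) 0), le_abs_self R₀]
      rw [← hf y hy0] at k
      have k' := (abs_le.1 k).2
      have : C₁ * F * (1 + d ^ q) ≤ (C₁ + C₂ + C₀) * F * (1 + d ^ q) := by
        gcongr; linarith
      linarith
    · have k := (abs_le.1 (h₂ z w _ _ d hx2 hw hx' hy' hd)).1
      have k2 := hlarge x y hx0 hd
      have k3 : C₀ * (d / z) ^ q ≤ C₀ * F * d ^ q := by
        rw [Real.div_rpow hd0 hz0.le, mul_assoc, div_eq_inv_mul, ← Real.rpow_neg hz0.le]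
        have : z ^ (-q) ≤ F := Real.rpow_le_rpow_of_exponent_le hz1 (by linarith)
        gcongr
      have k4 : C₁ * F * d ^ q + (C₁ + C₂ + C₀) * F ≥ 0 := by positivity
      change f y ≤ f x + C₀ * (d / z) ^ q at k2
      linarith
  have hint := hM.lintegral_le hq x hf0 (E := (C₁ + C₂ + C₀) * F) (by positivity)
    (b₀ := V.grad₀ z w) (b₁ := V.grad₁ z w) (q₀ := V.radial₂ (V.lin z w) * V.p ^ 2)
    (q₁ := V.radial₂ (V.lin z w) * (2 * V.p * V.t))
    (q₂ := V.radial₂ (V.lin z w) * V.t ^ 2 + V.transverse z) (fun y => by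
      refine (hpt y).trans (le_of_eq ?_)
      simp only [taylor]
      ring)
  refine hint.trans (ENNReal.ofReal_le_ofReal ?_)
  have k := h₃ x hx3
  simp only [drift] at k
  change _ + (C₁ + C₂ + C₀) * (1 + M) * F ≤ 0 at k
  linarith

end Potential

/-! ### Drift of a potential at the boundary and in the interior -/

lemma exists_abs_rpow_add_sub_le (b : ℝ) {k : ℝ} (hk : 0 < k) : ∃ C : ℝ, 0 ≤ C ∧
    ∀ z u : ℝ, 0 < z → |u| ≤ k / 2 * z → |(k * z + u) ^ b - (k * z) ^ b| ≤ C * z ^ (b - 1) * |u| := by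
  obtain ⟨C, hC, h⟩ := exists_abs_one_add_rpow_sub_one_le b
  refine ⟨k ^ b * C * k⁻¹, by positivity, fun z u hz hu => ?_⟩
  have hkz : 0 < k * z := by positivity
  have ht : |u / (k * z)| ≤ 1 / 2 := by
    rw [abs_div, abs_of_pos hkz, div_le_iff₀ hkz]; linarith
  have e1 : (k * z + u) ^ b = (k * z) ^ b * (1 + u / (k * z)) ^ b := by
    rw [← Real.mul_rpow hkz.le (by linarith [neg_abs_le (u / (k * z))])]
    congr 1; field_simp
  have e2 : (k * z + u) ^ b - (k * z) ^ b = (k * z) ^ b * ((1 + u / (k * z)) ^ b - 1) := by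
    rw [e1]; ring
  rw [e2, abs_mul, abs_of_pos (Real.rpow_pos_of_pos hkz b)]
  calc _ ≤ (k * z) ^ b * (C * |u / (k * z)|) := by gcongr; exact h _ ht
    _ = _ := by
      rw [Real.mul_rpow hk.le hz.le, abs_div, abs_of_pos hkz, Real.rpow_sub hz, Real.rpow_one]
      field_simp

namespace Potential
variable {V : Potential} {β A : ℝ}

/-- Replacing `ℓ` by `p z` costs a relative error `|w| / z`. This reduces the sign conditions to
inequalities in `z` alone. -/
lemma Admissible.exists_radial_sub_le (h : V.Admissible β) : ∃ C : ℝ, 0 ≤ C ∧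
    ∀ z w : ℝ, 1 ≤ z → |w| ≤ V.p / 2 * z →
      |V.radial (V.lin z w) - V.radial (V.p * z)| ≤ C * z ^ (V.e - 2) * |w| ∧
      |V.radial₂ (V.lin z w) - V.radial₂ (V.p * z)| ≤ C * z ^ (V.e - 3) * |w| := by
  have hp := h.p_pos
  obtain ⟨C₁, hC₁, h₁⟩ := exists_abs_rpow_add_sub_le (-1) hp
  obtain ⟨C₂, hC₂, h₂⟩ := exists_abs_rpow_add_sub_le (V.a - 1) hp
  obtain ⟨C₃, hC₃, h₃⟩ := exists_abs_rpow_add_sub_le (-2) hp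
  obtain ⟨C₄, hC₄, h₄⟩ := exists_abs_rpow_add_sub_le (V.a - 2) hp
  refine ⟨|V.c₀| * (C₁ + C₃) + |V.c₁| * (|V.a| * C₂ + |V.a * (V.a - 1)| * C₄), by positivity,
    fun z w hz hw => ?_⟩
  have hz0 : 0 < z := by linarith
  have ha := h.a_le
  have htw : |V.t * w| ≤ |w| := by
    rw [abs_mul]; exact mul_le_of_le_one_left (abs_nonneg _) h.t_le
  have htw' := htw.trans hw
  have n1 : 0 ≤ |V.c₁| * (|V.a| * C₂) := by positivity
  have n2 : 0 ≤ |V.c₁| * (|V.a * (V.a - 1)| * C₄) := by positivity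
  have n3 : 0 ≤ |V.c₀| * C₁ := by positivity
  have n4 : 0 ≤ |V.c₀| * C₃ := by positivity
  have s1 : (-1 : ℝ) - 1 = 0 - 2 := by norm_num
  have s2 : V.a - 1 - 1 = V.a - 2 := by ring
  have s3 : (-2 : ℝ) - 1 = 0 - 3 := by norm_num
  have s4 : V.a - 2 - 1 = V.a - 3 := by ring
  have up : ∀ b d C : ℝ, 0 ≤ C → b ≤ V.e →
      C * z ^ (b - d) * |V.t * w| ≤ C * (z ^ (V.e - d) * |w|) := by
    intro b d C hC hb
    have : z ^ (b - d) ≤ z ^ (V.e - d) := Real.rpow_le_rpow_of_exponent_le hz (by linarith)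
    rw [mul_assoc]
    gcongr
  constructor
  · have e : V.radial (V.lin z w) - V.radial (V.p * z) =
        V.c₀ * ((V.p * z + V.t * w) ^ (-1 : ℝ) - (V.p * z) ^ (-1 : ℝ)) +
        V.c₁ * (V.a * ((V.p * z + V.t * w) ^ (V.a - 1) - (V.p * z) ^ (V.a - 1))) := by
      simp only [radial, lin, Real.rpow_neg_one]; ring
    have k1 : |V.c₀ * ((V.p * z + V.t * w) ^ (-1 : ℝ) - (V.p * z) ^ (-1 : ℝ))| ≤
        |V.c₀| * (C₁ * (z ^ (V.e - 2) * |w|)) := by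
      rcases h.c₀_eq with h0 | h0
      · simp [h0]
      · rw [abs_mul]
        gcongr
        refine (h₁ z _ hz0 htw').trans ?_
        rw [s1]
        exact up 0 2 C₁ hC₁ h0.ge
    have k2 : |V.c₁ * (V.a * ((V.p * z + V.t * w) ^ (V.a - 1) - (V.p * z) ^ (V.a - 1)))| ≤
        |V.c₁| * (|V.a| * (C₂ * (z ^ (V.e - 2) * |w|))) := by
      rw [abs_mul, abs_mul]
      gcongr
      refine (h₂ z _ hz0 htw').trans ?_
      rw [s2]
      exact up V.a 2 C₂ hC₂ ha
    rw [e]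
    refine (abs_add_le _ _).trans ((add_le_add k1 k2).trans ?_)
    have : 0 ≤ z ^ (V.e - 2) * |w| := by positivity
    calc _ = (|V.c₀| * C₁ + |V.c₁| * (|V.a| * C₂)) * (z ^ (V.e - 2) * |w|) := by ring
      _ ≤ (|V.c₀| * (C₁ + C₃) + |V.c₁| * (|V.a| * C₂ + |V.a * (V.a - 1)| * C₄)) *
          (z ^ (V.e - 2) * |w|) := mul_le_mul_of_nonneg_right (by linarith) this
      _ = _ := by ring
  · have e : V.radial₂ (V.lin z w) - V.radial₂ (V.p * z) =
        V.c₀ * (-((V.p * z + V.t * w) ^ (-2 : ℝ) - (V.p * z) ^ (-2 : ℝ)) / 2) +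
        V.c₁ * (V.a * (V.a - 1) *
          (((V.p * z + V.t * w) ^ (V.a - 2) - (V.p * z) ^ (V.a - 2)) / 2)) := by
      simp only [radial₂, lin]; ring
    have k1 : |V.c₀ * (-((V.p * z + V.t * w) ^ (-2 : ℝ) - (V.p * z) ^ (-2 : ℝ)) / 2)| ≤
        |V.c₀| * (C₃ * (z ^ (V.e - 3) * |w|)) := by
      rcases h.c₀_eq with h0 | h0
      · simp [h0]
      · rw [abs_mul, abs_div, abs_neg, abs_two]
        gcongr
        refine (half_le_self (abs_nonneg _)).trans ((h₃ z _ hz0 htw').trans ?_)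
        rw [s3]
        exact up 0 3 C₃ hC₃ h0.ge
    have k2 : |V.c₁ * (V.a * (V.a - 1) *
          (((V.p * z + V.t * w) ^ (V.a - 2) - (V.p * z) ^ (V.a - 2)) / 2))| ≤
        |V.c₁| * (|V.a * (V.a - 1)| * (C₄ * (z ^ (V.e - 3) * |w|))) := by
      rw [abs_mul, abs_mul (V.a * (V.a - 1)), abs_div, abs_two]
      gcongr
      refine (half_le_self (abs_nonneg _)).trans ((h₄ z _ hz0 htw').trans ?_)
      rw [s4]
      exact up V.a 3 C₄ hC₄ ha
    rw [e]
    refine (abs_add_le _ _).trans ((add_le_add k1 k2).trans ?_)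
    have : 0 ≤ z ^ (V.e - 3) * |w| := by positivity
    calc _ = (|V.c₀| * C₃ + |V.c₁| * (|V.a * (V.a - 1)| * C₄)) * (z ^ (V.e - 3) * |w|) := by ring
      _ ≤ (|V.c₀| * (C₁ + C₃) + |V.c₁| * (|V.a| * C₂ + |V.a * (V.a - 1)| * C₄)) *
          (z ^ (V.e - 3) * |w|) := mul_le_mul_of_nonneg_right (by linarith) this
      _ = _ := by ring

/-- The inner product of the gradient with a reflection vector, to leading order. -/
def bdryMain (V : Potential) (ς a b z : ℝ) : ℝ :=
  V.radial (V.p * z) * (a * b * z ^ (b - 1)) - 2 * V.p * (a * z ^ b) * V.transverse z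
    - V.B * ς * V.p * z ^ (V.e - 2 + V.s)

/-- The oblique parts cancel: `(p, t)` paired with the reflection vector is the slope, because `p² +
t² = 1`. What is left of leading order is `bdryMain`. The errors are of order `z^(e-3+2β)` and
`z^(e-2)`, below `z^(e-2+s)` because `s > 2β - 1` and `s > 0`. -/
lemma Admissible.exists_bdry_grad_le (h : V.Admissible β) (hpt : V.p ^ 2 + V.t ^ 2 = 1)
    (hβs : 2 * β - 1 < V.s) (hA : 0 ≤ A) {ς a b K c : ℝ} (hς : |ς| = 1) (ha : 0 < a)
    (hb : 0 ≤ b) (hbβ : b ≤ β) (hc : 0 < c)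
    (hside : ∀ᶠ z in atTop, V.bdryMain ς a b z ≤ -c * z ^ (V.e - 2 + V.s)) :
    ∀ᶠ z in atTop, ∀ w : ℝ, |w| ≤ A * z ^ β → |ς * w - a * z ^ b| ≤ K →
      V.grad₀ z w * (V.p * (a * b * z ^ (b - 1)) + ς * V.t) +
        V.grad₁ z w * (V.t * (a * b * z ^ (b - 1)) - ς * V.p) ≤
      -(c / 2) * z ^ (V.e - 2 + V.s) := by
  have hp := h.p_pos
  obtain ⟨Z, hZ1, hZ⟩ := exists_cone h.β_lt A hp
  obtain ⟨C₁, hC₁, h₁⟩ := h.exists_radial_sub_le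
  obtain ⟨C₂, hC₂, h₂⟩ := h.exists_slope_le hA
  set C₃ := |V.A₀| + |V.A₁|
  have hC₃ : 0 ≤ C₃ := by positivity
  set N := a * b
  have hN : 0 ≤ N := by positivity
  have hv1 := eventually_mul_rpow_le (by linarith : V.e - 3 + 2 * β < V.e - 2 + V.s)
    (C₁ * A * N + C₂ * (N + 1) + (2 * A * C₃ + |V.B|) * N) (by positivity : 0 < c / 4)
  have hv2 := eventually_mul_rpow_le (by linarith [h.s_pos] : V.e - 2 < V.e - 2 + V.s)
    (2 * C₃ * |K|) (by positivity : 0 < c / 4)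
  filter_upwards [hside, hv1, hv2, eventually_ge_atTop Z] with z hmain hv1 hv2 hz w hw hK
  have hz1 : 1 ≤ z := hZ1.trans hz
  have hz0 : 0 < z := by linarith
  have hwp := hZ z w hz hw
  have hr := (h₁ z w hz1 hwp).1
  have hs := h₂ z w hz1 hw
  have ht : |V.transverse z| ≤ C₃ * z ^ (V.e - 2) := h.abs_transverse_le hz1
  set ν := N * z ^ (b - 1)
  have hν0 : 0 ≤ ν := by positivity
  have hνβ : ν ≤ N * z ^ (β - 1) := by simp only [ν]; gcongr
  have hνN : ν ≤ N := hνβ.trans (mul_le_of_le_one_right hN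
    (Real.rpow_le_one_of_one_le_of_nonpos hz1 (by linarith [h.β_lt])))
  set ψ := V.transverse z
  set X := z ^ (V.e - 3 + 2 * β)
  have hX : 0 < X := Real.rpow_pos_of_pos hz0 _
  have d1 : |(V.radial (V.lin z w) - V.radial (V.p * z)) * ν| ≤ C₁ * A * N * X := by
    rw [abs_mul, abs_of_nonneg hν0]
    calc _ ≤ C₁ * z ^ (V.e - 2) * (A * z ^ β) * (N * z ^ (β - 1)) := by
          gcongr; exact hr.trans (by gcongr)
      _ = C₁ * A * N * (z ^ (V.e - 2) * z ^ β * z ^ (β - 1)) := by ring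
      _ = _ := by rw [← Real.rpow_add hz0, ← Real.rpow_add hz0]; simp only [X]; ring_nf
  have d2 : |V.slope z w * (V.p * ν + ς * V.t)| ≤ C₂ * (N + 1) * X := by
    have : |V.p * ν + ς * V.t| ≤ N + 1 := by
      refine (abs_add_le _ _).trans (add_le_add ?_ ?_)
      · rw [abs_of_nonneg (by positivity)]
        exact (mul_le_of_le_one_left hν0 h.p_le).trans hνN
      · rw [abs_mul, hς, one_mul]; exact h.t_le
    rw [abs_mul]
    calc _ ≤ C₂ * X * (N + 1) := by gcongr
      _ = _ := by ring
  have d3 : |(2 * w * ψ + V.B * z ^ (V.e - 2 + V.s)) * (V.t * ν)| ≤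
      (2 * A * C₃ + |V.B|) * N * X := by
    have k1 : |2 * w * ψ + V.B * z ^ (V.e - 2 + V.s)| ≤
        (2 * A * C₃ + |V.B|) * z ^ (V.e - 2 + β) := by
      refine (abs_add_le _ _).trans ?_
      rw [abs_mul, abs_mul, abs_two, abs_mul, abs_of_pos (Real.rpow_pos_of_pos hz0 _), add_mul]
      have hsβ := h.s_le
      refine add_le_add ?_ (by gcongr)
      calc 2 * |w| * |ψ| ≤ 2 * (A * z ^ β) * (C₃ * z ^ (V.e - 2)) := by gcongr
        _ = _ := by rw [Real.rpow_add hz0]; ring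
    have k2 : |V.t * ν| ≤ N * z ^ (β - 1) := by
      rw [abs_mul, abs_of_nonneg hν0]
      exact (mul_le_of_le_one_left hν0 h.t_le).trans hνβ
    rw [abs_mul]
    calc _ ≤ (2 * A * C₃ + |V.B|) * z ^ (V.e - 2 + β) * (N * z ^ (β - 1)) := by gcongr
      _ = (2 * A * C₃ + |V.B|) * N * (z ^ (V.e - 2 + β) * z ^ (β - 1)) := by ring
      _ = _ := by rw [← Real.rpow_add hz0]; simp only [X]; ring_nf
  have d4 : |2 * V.p * ψ * (ς * w - a * z ^ b)| ≤ 2 * C₃ * |K| * z ^ (V.e - 2) := by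
    rw [abs_mul, abs_mul, abs_mul, abs_two, abs_of_pos hp]
    calc _ ≤ 2 * 1 * (C₃ * z ^ (V.e - 2)) * |K| :=
          mul_le_mul (by gcongr; exact h.p_le) (hK.trans (le_abs_self K)) (abs_nonneg _)
            (by positivity)
      _ = _ := by ring
  have e : V.grad₀ z w * (V.p * ν + ς * V.t) + V.grad₁ z w * (V.t * ν - ς * V.p) =
      V.bdryMain ς a b z + (V.radial (V.lin z w) - V.radial (V.p * z)) * ν
        + V.slope z w * (V.p * ν + ς * V.t)
        + (2 * w * ψ + V.B * z ^ (V.e - 2 + V.s)) * (V.t * ν)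
        - 2 * V.p * ψ * (ς * w - a * z ^ b) := by
    have hpt' : V.radial (V.lin z w) * ν * (V.p ^ 2 + V.t ^ 2) = V.radial (V.lin z w) * ν := by
      rw [hpt, mul_one]
    simp only [grad₀, grad₁, bdryMain]
    change _ = V.radial (V.p * z) * ν - _ - _ + _ + _ + _ - _
    linear_combination hpt'
  rw [e]
  have := le_abs_self ((V.radial (V.lin z w) - V.radial (V.p * z)) * ν)
  have := le_abs_self (V.slope z w * (V.p * ν + ς * V.t))
  have := le_abs_self ((2 * w * ψ + V.B * z ^ (V.e - 2 + V.s)) * (V.t * ν))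
  have := neg_abs_le (2 * V.p * ψ * (ς * w - a * z ^ b))
  linarith

/-- The drift of the potential is negative near the boundary. -/
lemma Admissible.eventually_drift_bdry (h : V.Admissible β) {S : Set Plane} {κ : Kernel S S}
    [IsMarkovKernel κ] {q η M α : ℝ} (hq : 2 < q) (hη : 0 ≤ η)
    (hM : MomentBound κ q M) (hVp : V.p = Real.cos α) (hVt : V.t = Real.sin α)
    (hβs : 2 * β - 1 < V.s) (hA : 0 ≤ A) {ς a b K c μ₀ C : ℝ} (hς : |ς| = 1) (ha : 0 < a)
    (hb : 0 ≤ b) (hbβ : b ≤ β) (hc : 0 < c) (hμ₀ : 0 < μ₀)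
    (hside : ∀ᶠ z in atTop, V.bdryMain ς a b z ≤ -c * z ^ (V.e - 2 + V.s)) (E : ℝ) :
    ∀ᶠ z in atTop, ∀ (x : S) (μ : ℝ), (x : Plane) 0 = z → |(x : Plane) 1| ≤ A * z ^ β →
      |ς * (x : Plane) 1 - a * z ^ b| ≤ K → μ₀ ≤ μ →
      ‖meanIncrement κ x - μ • unitReflVec ς (a * b * z ^ (b - 1)) α‖ ≤ C * z⁻¹ →
      V.drift κ x + E * z ^ (V.e - 2 - η) ≤ 0 := by
  obtain ⟨C₁, Z, hC₁, hZ1, h₁⟩ := h.exists_grad_le hA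
  set N := a * b
  have hN : 0 ≤ N := by positivity
  -- The slope is at most `N` for `z ≥ 1`, so the normalising factor of the reflection vector is at
  -- least `1 / √(N² + 1)`.
  set c' := μ₀ * (√(N ^ 2 + 1))⁻¹ * (c / 2)
  have hc' : 0 < c' := by positivity
  -- The deviation of the mean increment from its direction, the merely bounded second moments and
  -- the term with `E` all contribute at most order `z^(e-2)`, which is beaten because `s > 0`.
  have hv := eventually_mul_rpow_le (by linarith [h.s_pos] : V.e - 2 < V.e - 2 + V.s)
    (2 * C₁ * |C| + 5 * C₁ * (1 + M) + |E|) hc'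
  filter_upwards [h.exists_bdry_grad_le (by rw [hVp, hVt]; exact Real.cos_sq_add_sin_sq α) hβs hA
    (K := K) hς ha hb hbβ hc hside, hv, eventually_ge_atTop Z] with z hg hv hz x μ hxz hw hK hμ hm
  have hz1 : 1 ≤ z := hZ1.trans hz
  have hz0 : 0 < z := by linarith
  have hgN := hg _ hw hK
  obtain ⟨b0, b1, b2, b3⟩ := h₁ z _ hz hw
  have M00 := hM.abs_secondMoment_le hq x 0 0
  have M01 := hM.abs_secondMoment_le hq x 0 1
  have M11 := hM.abs_secondMoment_le hq x 1 1
  set w := (x : Plane) 1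
  set m := meanIncrement κ x
  change |ς * w - a * z ^ b| ≤ K at hK
  change ‖m - μ • unitReflVec ς (N * z ^ (b - 1)) α‖ ≤ C * z⁻¹ at hm
  change V.grad₀ z w * (V.p * (N * z ^ (b - 1)) + ς * V.t) +
        V.grad₁ z w * (V.t * (N * z ^ (b - 1)) - ς * V.p) ≤ _ at hgN
  set ν := N * z ^ (b - 1)
  have hν0 : 0 ≤ ν := by positivity
  have hνN : ν ≤ N := mul_le_of_le_one_right hN
    (Real.rpow_le_one_of_one_le_of_nonpos hz1 (by linarith [h.β_lt]))
  set g := V.grad₀ z w * (V.p * ν + ς * V.t) + V.grad₁ z w * (V.t * ν - ς * V.p)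
  set Y := z ^ (V.e - 2 + V.s)
  have hY : 0 < Y := Real.rpow_pos_of_pos hz0 _
  set ρ := (√(ν ^ 2 + 1))⁻¹
  have hρ : 0 < ρ := by positivity
  have hμ0 : 0 ≤ μ := hμ₀.le.trans hμ
  have hρN : (√(N ^ 2 + 1))⁻¹ ≤ ρ := by simp only [ρ]; gcongr
  have hρμ : μ₀ * (√(N ^ 2 + 1))⁻¹ ≤ μ * ρ := by gcongr
  have hmain : μ * ρ * g ≤ -c' * Y := by
    calc μ * ρ * g ≤ μ * ρ * (-(c / 2) * Y) := by
          have : 0 ≤ μ * ρ := by positivity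
          gcongr
      _ ≤ μ₀ * (√(N ^ 2 + 1))⁻¹ * (-(c / 2) * Y) :=
          mul_le_mul_of_nonpos_right hρμ (by nlinarith)
      _ = _ := by simp only [c']; ring
  set u := m - μ • unitReflVec ς ν α
  have hu0 : m 0 = u 0 + μ * ρ * (V.p * ν + ς * V.t) := by
    simp only [u, PiLp.sub_apply, PiLp.smul_apply, unitReflVec, reflVec, hVp, hVt]
    simp
    ring
  have hu1 : m 1 = u 1 + μ * ρ * (V.t * ν - ς * V.p) := by
    simp only [u, PiLp.sub_apply, PiLp.smul_apply, unitReflVec, reflVec, hVp, hVt]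
    simp
    ring
  have hCz : C * z⁻¹ ≤ |C| * z⁻¹ := by gcongr; exact le_abs_self C
  have hze : z ^ (V.e - 1) * z⁻¹ = z ^ (V.e - 2) := by
    rw [← Real.rpow_neg_one z, ← Real.rpow_add hz0]; ring_nf
  have k0 : |V.grad₀ z w * u 0| ≤ C₁ * |C| * z ^ (V.e - 2) := by
    rw [abs_mul]
    calc _ ≤ C₁ * z ^ (V.e - 1) * (|C| * z⁻¹) := by
          gcongr; exact (abs_apply_le_norm u 0).trans (hm.trans hCz)
      _ = C₁ * |C| * (z ^ (V.e - 1) * z⁻¹) := by ring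
      _ = _ := by rw [hze]
  have k1 : |V.grad₁ z w * u 1| ≤ C₁ * |C| * z ^ (V.e - 2) := by
    rw [abs_mul]
    calc _ ≤ C₁ * z ^ (V.e - 1) * (|C| * z⁻¹) := by
          gcongr; exact (abs_apply_le_norm u 1).trans (hm.trans hCz)
      _ = C₁ * |C| * (z ^ (V.e - 1) * z⁻¹) := by ring
      _ = _ := by rw [hze]
  have hp := h.p_pos
  have hp1 := h.p_le
  have ht1 := h.t_le
  have hM0 : 0 ≤ 1 + M := (abs_nonneg _).trans M00
  set W := z ^ (V.e - 2)
  have hW : 0 < W := Real.rpow_pos_of_pos hz0 _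
  set r₂ := V.radial₂ (V.lin z w)
  have q0 : |r₂ * V.p ^ 2 * secondMoment κ x 0 0| ≤ C₁ * W * 1 ^ 2 * (1 + M) := by
    rw [abs_mul, abs_mul, abs_pow, abs_of_pos hp]; gcongr
  have q1 : |r₂ * (2 * V.p * V.t) * secondMoment κ x 0 1| ≤ C₁ * W * (2 * 1 * 1) * (1 + M) := by
    rw [abs_mul, abs_mul, abs_mul, abs_mul, abs_two, abs_of_pos hp]; gcongr
  have q2 : |r₂ * V.t ^ 2 * secondMoment κ x 1 1| ≤ C₁ * W * 1 ^ 2 * (1 + M) := by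
    rw [abs_mul, abs_mul, abs_pow]; gcongr
  have q3 : |V.transverse z * secondMoment κ x 1 1| ≤ C₁ * W * (1 + M) := by
    rw [abs_mul]; gcongr
  have hE : E * z ^ (V.e - 2 - η) ≤ |E| * W := by
    have : z ^ (V.e - 2 - η) ≤ W := Real.rpow_le_rpow_of_exponent_le hz1 (by linarith)
    have h0 : 0 < z ^ (V.e - 2 - η) := Real.rpow_pos_of_pos hz0 _
    calc _ ≤ |E| * z ^ (V.e - 2 - η) := by gcongr; exact le_abs_self E
      _ ≤ _ := by gcongr
  have hd : V.drift κ x = V.grad₀ z w * u 0 + V.grad₁ z w * u 1 + μ * ρ * g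
      + r₂ * V.p ^ 2 * secondMoment κ x 0 0 + r₂ * (2 * V.p * V.t) * secondMoment κ x 0 1
      + r₂ * V.t ^ 2 * secondMoment κ x 1 1 + V.transverse z * secondMoment κ x 1 1 := by
    have : V.drift κ x = V.grad₀ z w * m 0 + V.grad₁ z w * m 1
      + r₂ * V.p ^ 2 * secondMoment κ x 0 0 + r₂ * (2 * V.p * V.t) * secondMoment κ x 0 1
      + (r₂ * V.t ^ 2 + V.transverse z) * secondMoment κ x 1 1 := by
      simp only [drift, hxz, r₂, w, m]
    rw [this, hu0, hu1]
    simp only [g]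
    ring
  rw [hd]
  have := (abs_le.1 k0).2
  have := (abs_le.1 k1).2
  have := (abs_le.1 q0).2
  have := (abs_le.1 q1).2
  have := (abs_le.1 q2).2
  have := (abs_le.1 q3).2
  linarith

/-- The drift of the potential is negative in the interior. -/
lemma Admissible.eventually_drift_interior (h : V.Admissible β) {S : Set Plane} {κ : Kernel S S}
    {η ω : ℝ} (hηβ : η ≤ 1 - β) (hωη : ω < η) (hA : 0 ≤ A)
    {Q : Matrix (Fin 2) (Fin 2) ℝ} {c : ℝ} (hc : 0 < c)
    (hint : ∀ᶠ z in atTop, V.radial₂ (V.p * z) *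
        (V.p ^ 2 * Q 0 0 + 2 * V.p * V.t * Q 0 1 + V.t ^ 2 * Q 1 1) + V.transverse z * Q 1 1 ≤
      -c * z ^ (V.e - 2 - ω)) (E : ℝ) : ∃ ε : ℝ, 0 < ε ∧
    ∀ᶠ z in atTop, ∀ x : S, (x : Plane) 0 = z → |(x : Plane) 1| ≤ A * z ^ β →
      ‖meanIncrement κ x‖ ≤ ε * z ^ (-1 - ω) →
      (∀ i j, |(secondMoment κ x - Q) i j| ≤ ε * z ^ (-ω)) →
      V.drift κ x + E * z ^ (V.e - 2 - η) ≤ 0 := by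
  obtain ⟨C₁, Z, hC₁, hZ1, h₁⟩ := h.exists_grad_le hA
  obtain ⟨C₂, hC₂, h₂⟩ := h.exists_radial_sub_le
  obtain ⟨Z', -, hZ'⟩ := exists_cone h.β_lt A h.p_pos
  set v := V.p ^ 2 * Q 0 0 + 2 * V.p * V.t * Q 0 1 + V.t ^ 2 * Q 1 1
  -- The `7` counts the error terms: one for each component of the gradient, one, two and one for
  -- the radial second-order terms, and one for the transverse term. Together they take at most half
  -- of `c`; the remaining two errors take a quarter each.
  have hε : 0 < c / (2 * (7 * C₁ + 1)) := by positivity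
  refine ⟨c / (2 * (7 * C₁ + 1)), hε, ?_⟩
  set ε := c / (2 * (7 * C₁ + 1))
  have hεc : 7 * C₁ * ε ≤ c / 2 := by
    have : (7 * C₁ + 1) * ε = c / 2 := by simp only [ε]; field_simp
    linarith
  have hv1 := eventually_mul_rpow_le (by linarith : V.e - 3 + β < V.e - 2 - ω)
    (C₂ * A * |v|) (by positivity : 0 < c / 4)
  have hv2 := eventually_mul_rpow_le (by linarith : V.e - 2 - η < V.e - 2 - ω)
    E (by positivity : 0 < c / 4)
  filter_upwards [hint, hv1, hv2, eventually_ge_atTop Z, eventually_ge_atTop Z'] with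
    z hmain hv1 hv2 hz hz' x hxz hw hm hQ
  have hz1 : 1 ≤ z := hZ1.trans hz
  have hz0 : 0 < z := by linarith
  obtain ⟨b0, b1, b2, b3⟩ := h₁ z _ hz hw
  have hr := (h₂ z _ hz1 (hZ' z _ hz' hw)).2
  set w := (x : Plane) 1
  set m := meanIncrement κ x
  set W := z ^ (V.e - 2 - ω)
  have hW : 0 < W := Real.rpow_pos_of_pos hz0 _
  have hp := h.p_pos
  have hp1 := h.p_le
  have ht1 := h.t_le
  have e1 : z ^ (V.e - 1) * z ^ (-1 - ω) = W := by
    rw [← Real.rpow_add hz0]; simp only [W]; ring_nf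
  have e2 : z ^ (V.e - 2) * z ^ (-ω) = W := by
    rw [← Real.rpow_add hz0]; simp only [W]; ring_nf
  have k0 : |V.grad₀ z w * m 0| ≤ C₁ * ε * W := by
    rw [abs_mul, ← e1]
    calc _ ≤ C₁ * z ^ (V.e - 1) * (ε * z ^ (-1 - ω)) := by
          gcongr; exact (abs_apply_le_norm m 0).trans hm
      _ = _ := by ring
  have k1 : |V.grad₁ z w * m 1| ≤ C₁ * ε * W := by
    rw [abs_mul, ← e1]
    calc _ ≤ C₁ * z ^ (V.e - 1) * (ε * z ^ (-1 - ω)) := by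
          gcongr; exact (abs_apply_le_norm m 1).trans hm
      _ = _ := by ring
  set r₂ := V.radial₂ (V.lin z w)
  set T := secondMoment κ x - Q
  have q0 : |r₂ * V.p ^ 2 * T 0 0| ≤ C₁ * ε * W := by
    rw [abs_mul, abs_mul, abs_pow, abs_of_pos hp, ← e2]
    calc _ ≤ C₁ * z ^ (V.e - 2) * 1 ^ 2 * (ε * z ^ (-ω)) := by gcongr; exact hQ 0 0
      _ = _ := by ring
  have q1 : |r₂ * (2 * V.p * V.t) * T 0 1| ≤ 2 * C₁ * ε * W := by
    rw [abs_mul, abs_mul, abs_mul, abs_mul, abs_two, abs_of_pos hp, ← e2]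
    calc _ ≤ C₁ * z ^ (V.e - 2) * (2 * 1 * 1) * (ε * z ^ (-ω)) := by gcongr; exact hQ 0 1
      _ = _ := by ring
  have q2 : |r₂ * V.t ^ 2 * T 1 1| ≤ C₁ * ε * W := by
    rw [abs_mul, abs_mul, abs_pow, ← e2]
    calc _ ≤ C₁ * z ^ (V.e - 2) * 1 ^ 2 * (ε * z ^ (-ω)) := by gcongr; exact hQ 1 1
      _ = _ := by ring
  have q3 : |V.transverse z * T 1 1| ≤ C₁ * ε * W := by
    rw [abs_mul, ← e2]
    calc _ ≤ C₁ * z ^ (V.e - 2) * (ε * z ^ (-ω)) := by gcongr; exact hQ 1 1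
      _ = _ := by ring
  have q4 : |(r₂ - V.radial₂ (V.p * z)) * v| ≤ C₂ * A * |v| * z ^ (V.e - 3 + β) := by
    rw [abs_mul]
    calc _ ≤ C₂ * z ^ (V.e - 3) * (A * z ^ β) * |v| := by
          gcongr; exact hr.trans (by gcongr)
      _ = _ := by rw [Real.rpow_add hz0]; ring
  have hd : V.drift κ x = V.grad₀ z w * m 0 + V.grad₁ z w * m 1
      + r₂ * V.p ^ 2 * T 0 0 + r₂ * (2 * V.p * V.t) * T 0 1
      + r₂ * V.t ^ 2 * T 1 1 + V.transverse z * T 1 1 + (r₂ - V.radial₂ (V.p * z)) * v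
      + (V.radial₂ (V.p * z) * v + V.transverse z * Q 1 1) := by
    simp only [drift, hxz, r₂, w, m, T, v, Matrix.sub_apply]
    ring
  rw [hd]
  have := (abs_le.1 k0).2
  have := (abs_le.1 k1).2
  have := (abs_le.1 q0).2
  have := (abs_le.1 q1).2
  have := (abs_le.1 q2).2
  have := (abs_le.1 q3).2
  have := (abs_le.1 q4).2
  have := mul_le_mul_of_nonneg_right hεc hW.le
  linarith

end Potential

/-! ### Sublinear domains -/

section Geometry
variable {ap am βp βm : ℝ}

lemma abs_le_of_mem_domain (hap : 0 < ap) {x : Plane}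
    (hx : x ∈ domain ap am βp βm) (h1 : 1 ≤ x 0) :
    |x 1| ≤ max ap am * x 0 ^ max βp βm := by
  obtain ⟨-, hl, hu⟩ := hx
  have k1 : bdry am βm (x 0) ≤ max ap am * x 0 ^ max βp βm := by
    rw [bdry]
    gcongr
    · exact le_max_right _ _
    · exact le_max_right _ _
  have k2 : bdry ap βp (x 0) ≤ max ap am * x 0 ^ max βp βm := by
    rw [bdry]
    gcongr
    · exact le_max_left _ _
    · exact le_max_left _ _
  exact abs_le.2 ⟨by linarith, by linarith⟩

lemma exists_le_of_norm_gt (hap : 0 < ap) (ham : 0 < am) (hβp : 0 ≤ βp) (hβm : 0 ≤ βm) (Z : ℝ) :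
    ∃ R : ℝ, ∀ x ∈ domain ap am βp βm, R < ‖x‖ → Z ≤ x 0 := by
  refine ⟨|Z| + (am * |Z| ^ βm + ap * |Z| ^ βp), fun x hx hR => ?_⟩
  obtain ⟨h0, hl, hu⟩ := hx
  by_contra! hZ
  have hZ' : x 0 ≤ |Z| := hZ.le.trans (le_abs_self Z)
  have k1 : bdry am βm (x 0) ≤ am * |Z| ^ βm := by rw [bdry]; gcongr
  have k2 : bdry ap βp (x 0) ≤ ap * |Z| ^ βp := by rw [bdry]; gcongr
  have n1 : 0 ≤ am * |Z| ^ βm := by positivity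
  have n2 : 0 ≤ ap * |Z| ^ βp := by positivity
  have k3 : |x 1| ≤ am * |Z| ^ βm + ap * |Z| ^ βp := abs_le.2 ⟨by linarith, by linarith⟩
  have := norm_le_add_abs x
  rw [abs_of_nonneg h0] at this
  linarith

/-- Subadditivity of `z ↦ z^β` for `0 ≤ β ≤ 1`: moving left by at most `B` lowers the curve by at
most `a B^β`. -/
lemma bdry_sub_le {a β B z y : ℝ} (ha : 0 < a) (h0 : 0 ≤ β) (h1 : β ≤ 1) (hB : 0 ≤ B)
    (hz : B ≤ z) (hy : z - B ≤ y) : bdry a β z - a * B ^ β ≤ bdry a β y := by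
  have k := Real.rpow_add_le_add_rpow (sub_nonneg.2 hz) hB h0 h1
  rw [sub_add_cancel] at k
  have k2 : (z - B) ^ β ≤ y ^ β := Real.rpow_le_rpow (by linarith) hy h0
  have := mul_le_mul_of_nonneg_left (k.trans (add_le_add_left k2 _)) ha.le
  simp only [bdry]
  linarith

/-- With positive exponents both half-heights tend to infinity. A nearby exterior point lies beyond
one of the curves, whose height changes only by a bounded amount over a bounded distance; hence the
original point is within bounded vertical distance of that curve and off the axis. -/
lemma boundaryNearCurves_of_pos (hap : 0 < ap) (ham : 0 < am) (hβp : 0 < βp) (hβm : 0 < βm)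
    (hβp1 : βp < 1) (hβm1 : βm < 1) {S DB : Set Plane}
    (hDB : IsBoundaryPart (domain ap am βp βm) DB) : BoundaryNearCurves ap am βp βm S DB := by
  obtain ⟨B, hB, hnear⟩ := hDB.exists_near
  have hp := (tendsto_rpow_atTop hβp).const_mul_atTop hap
  have hm := (tendsto_rpow_atTop hβm).const_mul_atTop ham
  obtain ⟨Z, hZ⟩ := eventually_atTop.1 ((hp.eventually_gt_atTop (ap * B ^ βp + B)).and
    ((hm.eventually_gt_atTop (am * B ^ βm + B)).and (eventually_gt_atTop B)))
  obtain ⟨R, hR⟩ := exists_le_of_norm_gt hap ham hβp.le hβm.le Z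
  have n1 : 0 ≤ ap * B ^ βp := by positivity
  have n2 : 0 ≤ am * B ^ βm := by positivity
  refine ⟨|R| + 1 + (ap * B ^ βp + am * B ^ βm + B), fun x hx hxR => ?_⟩
  have hx0 : Z ≤ x 0 := hR x (hDB.1 hx.2) (by linarith [le_abs_self R])
  obtain ⟨h1, h2, h3⟩ := hZ _ hx0
  obtain ⟨y, hy, hy0, hy1⟩ := hnear x hx.2
  have hy0' := abs_le.1 hy0
  have hy1' := abs_le.1 hy1
  have hp := bdry_sub_le hap hβp.le hβp1.le hB h3.le (by linarith : x 0 - B ≤ y 0)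
  have hm := bdry_sub_le ham hβm.le hβm1.le hB h3.le (by linarith : x 0 - B ≤ y 0)
  have e1 : bdry ap βp (x 0) = ap * x 0 ^ βp := rfl
  have e2 : bdry am βm (x 0) = am * x 0 ^ βm := rfl
  have hR0 := abs_nonneg R
  by_cases hu : y 1 ≤ bdry ap βp (y 0)
  · have hl : y 1 < -bdry am βm (y 0) := by
      by_contra! hl
      exact hy ⟨by linarith, hl, hu⟩
    right
    constructor <;> linarith
  · push Not at hu
    left
    constructor <;> linarith

end Geometry

namespace Potential
variable {V : Potential}

/-- A potential with negative drift gives a superharmonic function outside a bounded set. -/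
theorem Admissible.superharmonic_outside_ball {S DB : Set Plane} {κ : Kernel S S}
    [IsMarkovKernel κ] {ap am βp βm : ℝ} (hap : 0 < ap) (ham : 0 < am) (hβp : 0 ≤ βp)
    (hβm : 0 ≤ βm) (h : V.Admissible (max βp βm)) (hS : S ⊆ domain ap am βp βm)
    (hnear : BoundaryNearCurves ap am βp βm S DB) {α : ℝ}
    (hRp : ReflectionUpper κ DB ap βp α) (hRm : ReflectionLower κ DB am βm (-α))
    (hVp : V.p = Real.cos α) (hVt : V.t = Real.sin α) (hβs : 2 * max βp βm - 1 < V.s)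
    {q η M R₀ C₀ Z₀ ω c : ℝ} (hq : 2 < q) (hq3 : q ≤ 3) (hη : 0 ≤ η) (hηβ : η ≤ 1 - max βp βm)
    (hηq : 2 + η - V.e ≤ q) (hM : MomentBound κ q M) (hC₀ : 0 ≤ C₀) (hω : 0 ≤ ω) (hωη : ω < η)
    {Q : Matrix (Fin 2) (Fin 2) ℝ}
    (hrate : ∀ ε : ℝ, 0 < ε → ∀ᶠ r : ℝ in atTop, ∀ x : S, ‖(x : Plane)‖ = r → (x : Plane) ∉ DB →
      ‖meanIncrement κ x‖ ≤ ε * r ^ (-1 - ω) ∧ ∀ i j, |(secondMoment κ x - Q) i j| ≤ ε * r ^ (-ω))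
    (hc : 0 < c) (hup : ∀ᶠ z in atTop, V.bdryMain 1 ap βp z ≤ -c * z ^ (V.e - 2 + V.s))
    (hlow : ∀ᶠ z in atTop, V.bdryMain (-1) am βm z ≤ -c * z ^ (V.e - 2 + V.s))
    (hint : ∀ᶠ z in atTop, V.radial₂ (V.p * z) *
        (V.p ^ 2 * Q 0 0 + 2 * V.p * V.t * Q 0 1 + V.t ^ 2 * Q 1 1) + V.transverse z * Q 1 1 ≤
      -c * z ^ (V.e - 2 - ω))
    {f : S → ℝ} (hf0 : ∀ y, 0 ≤ f y)
    (hf : ∀ y : S, R₀ ≤ (y : Plane) 0 → f y = V.val ((y : Plane) 0) ((y : Plane) 1))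
    (hlarge : ∀ x y : S, Z₀ ≤ (x : Plane) 0 →
      V.p / 8 * (x : Plane) 0 ≤ ‖(y : Plane) - (x : Plane)‖ →
      f y ≤ f x + C₀ * (‖(y : Plane) - (x : Plane)‖ / (x : Plane) 0) ^ q) :
    ∃ R : ℝ, ∀ x : S, R < ‖(x : Plane)‖ →
      ∫⁻ y, ENNReal.ofReal (f y) ∂(κ x) ≤ ENNReal.ofReal (f x) := by
  set A := max ap am
  have hA : 0 ≤ A := hap.le.trans (le_max_left _ _)
  have hSA : ∀ x : S, 1 ≤ (x : Plane) 0 → |(x : Plane) 1| ≤ A * (x : Plane) 0 ^ max βp βm :=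
    fun x hx => abs_le_of_mem_domain hap (hS x.2) hx
  obtain ⟨K, hK⟩ := hnear
  obtain ⟨μp, Cp, hμp, hdp⟩ := hRp.drift
  obtain ⟨μm, Cm, hμm, hdm⟩ := hRm.drift
  suffices hdrift : ∀ E : ℝ, ∃ Z : ℝ, ∀ x : S, Z ≤ (x : Plane) 0 →
      V.drift κ x + E * (x : Plane) 0 ^ (V.e - 2 - η) ≤ 0 by
    obtain ⟨Z, hZ⟩ := h.exists_superharmonic hq hq3 hηβ hηq hA hM hC₀ hSA hf0 hf hlarge hdrift
    obtain ⟨R, hR⟩ := exists_le_of_norm_gt hap ham hβp hβm Z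
    exact ⟨R, fun x hx => hZ x (hR x (hS x.2) hx)⟩
  intro E
  have hb1 := h.eventually_drift_bdry hq hη hM hVp hVt hβs hA (K := K) (C := |Cp|)
    (abs_one : |(1 : ℝ)| = 1) hap hβp (le_max_left _ _) hc hμp hup E
  have hb2 := h.eventually_drift_bdry hq hη hM hVp hVt hβs hA (K := K) (C := |Cm|)
    (by norm_num : |(-1 : ℝ)| = 1) ham hβm (le_max_right _ _) hc hμm hlow E
  obtain ⟨ε, hε, hi⟩ := h.eventually_drift_interior (κ := κ) hηβ hωη hA hc hint E
  obtain ⟨Z, hZ⟩ := eventually_atTop.1 (hb1.and (hb2.and (hi.and (hdp.and (hdm.and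
    ((hrate ε hε).and ((eventually_ge_atTop 1).and (eventually_ge_atTop K))))))))
  refine ⟨Z, fun x hx => ?_⟩
  -- The hypotheses are stated in terms of `‖x‖` and the drift estimates in terms of `x₁`. As `0 <
  -- x₁ ≤ ‖x‖`, negative powers of the norm are bounded by those of `x₁`.
  have hxr : (x : Plane) 0 ≤ ‖(x : Plane)‖ :=
    (le_abs_self _).trans (abs_apply_le_norm (x : Plane) 0)
  obtain ⟨h1, h2, h3, -, -, -, hz1, hzK⟩ := hZ _ hx
  obtain ⟨-, -, -, h4, h5, h6, -, -⟩ := hZ _ (hx.trans hxr)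
  have hz0 : 0 < (x : Plane) 0 := by linarith
  have hw := hSA x hz1
  obtain ⟨-, hl, hu⟩ := hS x.2
  have hinv : ∀ C : ℝ, C * ‖(x : Plane)‖⁻¹ ≤ |C| * ((x : Plane) 0)⁻¹ := by
    intro C
    have : ‖(x : Plane)‖⁻¹ ≤ ((x : Plane) 0)⁻¹ := by gcongr
    calc _ ≤ |C| * ‖(x : Plane)‖⁻¹ := by gcongr; exact le_abs_self C
      _ ≤ _ := by gcongr
  by_cases hxD : (x : Plane) ∈ DB
  · rcases hK x ⟨x.2, hxD⟩ (hzK.trans hxr) with ⟨hx1, hd⟩ | ⟨hx1, hd⟩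
    · obtain ⟨μ, hμ, hm⟩ := h4 x rfl hxD hx1
      refine h1 x μ rfl hw ?_ hμ (hm.trans (hinv Cp))
      simp only [bdry] at hd hu
      exact abs_le.2 ⟨by linarith, by linarith⟩
    · obtain ⟨μ, hμ, hm⟩ := h5 x rfl hxD hx1
      refine h2 x μ rfl hw ?_ hμ (hm.trans (hinv Cm))
      simp only [bdry] at hd hl
      exact abs_le.2 ⟨by linarith, by linarith⟩
  · obtain ⟨k1, k2⟩ := h6 x rfl hxD
    refine h3 x rfl hw (k1.trans ?_) fun i j => (k2 i j).trans ?_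
    · have : ‖(x : Plane)‖ ^ (-1 - ω) ≤ (x : Plane) 0 ^ (-1 - ω) :=
        Real.rpow_le_rpow_of_nonpos hz0 hxr (by linarith)
      gcongr
    · have : ‖(x : Plane)‖ ^ (-ω) ≤ (x : Plane) 0 ^ (-ω) :=
        Real.rpow_le_rpow_of_nonpos hz0 hxr (by linarith)
      gcongr

/-- The potential is comparable with its leading term. -/
lemma Admissible.exists_val_sub_le {β : ℝ} (h : V.Admissible β) : ∃ C : ℝ, 0 ≤ C ∧
    ∀ z w : ℝ, 1 ≤ z → |w| ≤ V.p / 2 * z →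
      |V.val z w - V.c₀ * Real.log z| ≤ C * z ^ V.e := by
  have hp := half_pos h.p_pos
  obtain ⟨C₁, hC₁, h₁⟩ := exists_rpow_le V.a hp
  refine ⟨|V.c₀| * (|Real.log (V.p / 2)| + |Real.log 2|) + |V.c₁| * C₁ + (|V.A₀| + |V.A₁|)
    + |V.B|, by positivity, fun z w hz hw => ?_⟩
  have hz0 : 0 < z := by linarith
  have ha := h.a_le
  have hsβ := h.s_le
  have hβ := h.β_lt
  obtain ⟨hl1, hl2⟩ := h.lin_bounds hz0 hw
  have hl0 : 0 < V.lin z w := lt_of_lt_of_le (by positivity) hl1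
  have hwz : |w| ≤ z := hw.trans (by nlinarith [h.p_le])
  have g0 : |V.c₀ * (Real.log (V.lin z w) - Real.log z)| ≤
      |V.c₀| * (|Real.log (V.p / 2)| + |Real.log 2|) * z ^ V.e := by
    rcases h.c₀_eq with h0 | h0
    · simp [h0]
    · rw [h0, Real.rpow_zero, mul_one, abs_mul]
      gcongr
      have k1 := Real.log_le_log (by positivity) hl1
      have k2 := Real.log_le_log hl0 hl2
      rw [Real.log_mul hp.ne' hz0.ne'] at k1
      rw [Real.log_mul two_ne_zero hz0.ne'] at k2
      have := neg_abs_le (Real.log (V.p / 2))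
      have := le_abs_self (Real.log 2)
      have := abs_nonneg (Real.log 2)
      have := abs_nonneg (Real.log (V.p / 2))
      exact abs_le.2 ⟨by linarith, by linarith⟩
  have g1 : |V.c₁ * V.lin z w ^ V.a| ≤ |V.c₁| * C₁ * z ^ V.e := by
    rw [abs_mul, abs_of_pos (Real.rpow_pos_of_pos hl0 _), mul_assoc]
    gcongr
    exact (h₁ z _ hz0 hl1 hl2).trans (by gcongr)
  have g2 : |w ^ 2 * V.transverse z| ≤ (|V.A₀| + |V.A₁|) * z ^ V.e := by
    rw [abs_mul, abs_pow]
    calc _ ≤ z ^ 2 * ((|V.A₀| + |V.A₁|) * z ^ (V.e - 2)) := by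
          gcongr; exact h.abs_transverse_le hz
      _ = _ := by
          rw [Real.rpow_sub hz0, show z ^ (2 : ℝ) = z ^ 2 by norm_cast]; field_simp
  have g3 : |V.B * (w * z ^ (V.e - 2 + V.s))| ≤ |V.B| * z ^ V.e := by
    rw [abs_mul, abs_mul, abs_of_pos (Real.rpow_pos_of_pos hz0 _)]
    gcongr
    calc _ ≤ z * z ^ (V.e - 2 + V.s) := by gcongr
      _ = z ^ (V.e - 1 + V.s) := by
          rw [mul_comm, ← Real.rpow_add_one hz0.ne']; ring_nf
      _ ≤ _ := Real.rpow_le_rpow_of_exponent_le hz (by linarith)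
  have e : V.val z w - V.c₀ * Real.log z = V.c₀ * (Real.log (V.lin z w) - Real.log z)
      + V.c₁ * V.lin z w ^ V.a + w ^ 2 * V.transverse z + V.B * (w * z ^ (V.e - 2 + V.s)) := by
    simp only [val, transverse]; ring
  rw [e, add_mul, add_mul, add_mul]
  refine (abs_add_le _ _).trans (add_le_add ?_ g3)
  refine (abs_add_le _ _).trans (add_le_add ?_ g2)
  exact (abs_add_le _ _).trans (add_le_add g0 g1)

end Potential

/-- A positive-definite covariance, evaluated in the direction of angle `α`. -/
lemma betaC_mul {Q : Matrix (Fin 2) (Fin 2) ℝ} (hQ : Q.PosDef) (α : ℝ) : 0 < Q 1 1 ∧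
    Real.cos α ^ 2 * Q 0 0 + 2 * Real.cos α * Real.sin α * Q 0 1 + Real.sin α ^ 2 * Q 1 1 =
      betaC Q α * Q 1 1 ∧ 0 < betaC Q α := by
  have h11 : 0 < Q 1 1 := hQ.diag_pos
  have e : Real.cos α ^ 2 * Q 0 0 + 2 * Real.cos α * Real.sin α * Q 0 1 + Real.sin α ^ 2 * Q 1 1 =
      betaC Q α * Q 1 1 := by
    rw [betaC, Real.sin_two_mul, Real.cos_sq']
    field_simp
    ring
  refine ⟨h11, e, ?_⟩
  have hne : (![Real.cos α, Real.sin α] : Fin 2 → ℝ) ≠ 0 := by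
    intro h0
    have h1 : Real.cos α = 0 := congrFun h0 0
    have h2 : Real.sin α = 0 := congrFun h0 1
    have := Real.cos_sq_add_sin_sq α
    rw [h1, h2] at this
    norm_num at this
  have hpos := hQ.dotProduct_mulVec_pos hne
  have hsym : Q 1 0 = Q 0 1 := by simpa using hQ.1.apply 0 1
  simp [Matrix.mulVec, dotProduct, Fin.sum_univ_two, hsym] at hpos
  have : 0 < betaC Q α * Q 1 1 := by rw [← e]; linarith
  exact (mul_pos_iff_of_pos_right h11).1 this

/-- An exponent and a sign for the linear correction term, which acts only when the exponents
of the two boundary curves differ. -/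
lemma exists_tilt {βp βm : ℝ} (hp1 : βp < 1) (hm1 : βm < 1) (h0 : 0 < max βp βm) :
    ∃ s B : ℝ, 0 < s ∧ s < max βp βm ∧ 2 * max βp βm - 1 < s ∧ |B| ≤ 1 ∧
      (βp = max βp βm ∨ βp < s ∧ B * 1 = 1) ∧ (βm = max βp βm ∨ βm < s ∧ B * (-1) = 1) := by
  have hlt : max βp βm < 1 := max_lt hp1 hm1
  -- For unequal exponents `s` is placed strictly between them, also above `2 max βp βm - 1`, and
  -- the sign of `B` favours the flatter curve. For equal exponents the tilt is switched off.
  rcases lt_trichotomy βp βm with h | h | h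
  · rw [max_eq_right h.le] at *
    obtain ⟨s, h1, h2⟩ := exists_between
      (max_lt (max_lt h0 (by linarith : 2 * βm - 1 < βm)) h)
    simp only [max_lt_iff] at h1
    exact ⟨s, 1, h1.1.1, h2, h1.1.2, by simp, Or.inr ⟨h1.2, by norm_num⟩, Or.inl rfl⟩
  · subst h
    rw [max_self] at *
    obtain ⟨s, h1, h2⟩ := exists_between (max_lt h0 (by linarith : 2 * βp - 1 < βp))
    simp only [max_lt_iff] at h1
    exact ⟨s, 0, h1.1, h2, h1.2, by simp, Or.inl rfl, Or.inl rfl⟩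
  · rw [max_eq_left h.le] at *
    obtain ⟨s, h1, h2⟩ := exists_between
      (max_lt (max_lt h0 (by linarith : 2 * βp - 1 < βp)) h)
    simp only [max_lt_iff] at h1
    exact ⟨s, -1, h1.1.1, h2, h1.1.2, by simp, Or.inl rfl, Or.inr ⟨h1.2, by norm_num⟩⟩

/-! ### The logarithmic and the decaying potential -/

namespace Potential

lemma bdryMain_eq (V : Potential) (hp : 0 < V.p) (ς a b : ℝ) {z : ℝ} (hz : 0 < z) :
    V.bdryMain ς a b z = a * (b * V.c₀ * V.p⁻¹ * z ^ (b - 2) - 2 * V.p * V.A₀ * z ^ (b - 2 + V.e)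
      + (b * (V.c₁ * V.a * V.p ^ (V.a - 1)) - 2 * V.p * V.A₁) * z ^ (b - 2 + V.a))
      - V.B * ς * V.p * z ^ (V.e - 2 + V.s) := by
  have e1 : z ^ (b - 1) * z⁻¹ = z ^ (b - 2) := by
    rw [← Real.rpow_neg_one z, ← Real.rpow_add hz]; ring_nf
  have e2 : z ^ (V.a - 1) * z ^ (b - 1) = z ^ (b - 2 + V.a) := by
    rw [← Real.rpow_add hz]; ring_nf
  have e3 : z ^ b * z ^ (V.e - 2) = z ^ (b - 2 + V.e) := by
    rw [← Real.rpow_add hz]; ring_nf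
  have e4 : z ^ b * z ^ (V.a - 2) = z ^ (b - 2 + V.a) := by
    rw [← Real.rpow_add hz]; ring_nf
  simp only [bdryMain, radial, transverse]
  rw [Real.mul_rpow hp.le hz.le, mul_inv]
  linear_combination V.c₀ * V.p⁻¹ * a * b * e1 + V.c₁ * V.a * V.p ^ (V.a - 1) * a * b * e2
    - 2 * V.p * a * V.A₀ * e3 - 2 * V.p * a * V.A₁ * e4

lemma radial₂_eq (V : Potential) (hp : 0 < V.p) {z : ℝ} (hz : 0 < z) :
    V.radial₂ (V.p * z) = -V.c₀ * V.p ^ (-2 : ℝ) / 2 * z ^ (-2 : ℝ) +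
      V.c₁ * (V.a * (V.a - 1)) * V.p ^ (V.a - 2) / 2 * z ^ (V.a - 2) := by
  simp only [radial₂]
  rw [Real.mul_rpow hp.le hz.le, Real.mul_rpow hp.le hz.le]
  ring

/-- The potential of logarithmic growth, used for recurrence. -/
def logarithmic (p t β δ s B : ℝ) : Potential where
  c₀ := 1
  c₁ := -1
  a := -δ
  e := 0
  A₀ := β / 2 * p ^ (-2 : ℝ)
  A₁ := β * (δ * (1 + δ / 2)) / 2 * p ^ (-2 - δ)
  B := B
  s := s
  p := p
  t := t

/-- The decaying potential, used for transience. -/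
def decaying (p t k γ s B : ℝ) : Potential where
  c₀ := 0
  c₁ := 1
  a := -γ
  e := -γ
  A₀ := -(γ / 2 * k) * p ^ (-2 - γ)
  A₁ := 0
  B := B
  s := s
  p := p
  t := t

/-- The value of `A₀` cancels the order `z^(β-2)` exactly on a curve of exponent `β`. The value of
`A₁` exceeds the cancelling one by the factor `1 + δ/2`, leaving a negative term of order
`z^(β-2-δ)`, which beats the tilt since `s < β - δ`. On a flatter curve both brackets are
nonpositive and the tilt gives the bound. -/
lemma logarithmic_bdryMain {p t β δ s B ς a b : ℝ} (hp : 0 < p) (hβ : 0 < β) (hδ : 0 < δ)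
    (hδs : δ < β - s) (hB : |B| ≤ 1) (hς : |ς| = 1) (ha : 0 < a) (hbβ : b ≤ β)
    (hb : b = β ∨ b < s ∧ B * ς = 1) :
    ∀ᶠ z in atTop, (logarithmic p t β δ s B).bdryMain ς a b z ≤ -p * z ^ (0 - 2 + s) := by
  set V := logarithmic p t β δ s B
  have hpm : p * p ^ (-2 : ℝ) = p⁻¹ := by
    rw [← Real.rpow_neg_one p]
    nth_rw 1 [← Real.rpow_one p]
    rw [← Real.rpow_add hp]; norm_num
  have hpm2 : p * p ^ (-2 - δ) = p ^ (-δ - 1) := by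
    nth_rw 1 [← Real.rpow_one p]
    rw [← Real.rpow_add hp]; ring_nf
  have key : ∀ z : ℝ, 0 < z → V.bdryMain ς a b z = a * ((b - β) * p⁻¹ * z ^ (b - 2)
      + δ * (b - β * (1 + δ / 2)) * p ^ (-δ - 1) * z ^ (b - 2 - δ))
      - B * ς * p * z ^ (0 - 2 + s) := by
    intro z hz
    rw [V.bdryMain_eq hp ς a b hz]
    simp only [V, logarithmic, add_zero]
    rw [← sub_eq_add_neg]
    linear_combination (-a * β * z ^ (b - 2)) * hpm
      - a * β * δ * (1 + δ / 2) * z ^ (b - 2 - δ) * hpm2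
  rcases hb with hb | ⟨-, hb⟩
  · have hv := eventually_mul_rpow_le (by linarith : 0 - 2 + s < b - 2 - δ) (2 * p)
      (by positivity : 0 < a * (δ * (β * (δ / 2)) * p ^ (-δ - 1)))
    filter_upwards [hv, eventually_gt_atTop 0] with z hz hz0
    rw [key z hz0]
    have hY : 0 < z ^ (0 - 2 + s) := Real.rpow_pos_of_pos hz0 _
    have hBς : -(B * ς) ≤ 1 := by
      have : |B * ς| ≤ 1 := by rw [abs_mul, hς, mul_one]; exact hB
      linarith [neg_abs_le (B * ς)]
    have := mul_le_mul_of_nonneg_right hBς (by positivity : 0 ≤ p * z ^ (0 - 2 + s))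
    subst hb
    linear_combination this + hz
  · filter_upwards [eventually_gt_atTop 0] with z hz0
    rw [key z hz0, hb]
    have h1 : 0 < z ^ (b - 2) := Real.rpow_pos_of_pos hz0 _
    have h2 : 0 < z ^ (b - 2 - δ) := Real.rpow_pos_of_pos hz0 _
    have k1 : (b - β) * p⁻¹ * z ^ (b - 2) ≤ 0 :=
      mul_nonpos_of_nonpos_of_nonneg
        (mul_nonpos_of_nonpos_of_nonneg (by linarith) (by positivity)) h1.le
    have k2 : δ * (b - β * (1 + δ / 2)) * p ^ (-δ - 1) * z ^ (b - 2 - δ) ≤ 0 := by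
      have : b - β * (1 + δ / 2) ≤ 0 := by nlinarith
      refine mul_nonpos_of_nonpos_of_nonneg (mul_nonpos_of_nonpos_of_nonneg
        (mul_nonpos_of_nonneg_of_nonpos hδ.le this) (by positivity)) h2.le
    have := mul_nonpos_of_nonneg_of_nonpos ha.le (add_nonpos k1 k2)
    linarith

/-- The leading coefficient has the sign of `k - b`. It is negative for `b = β`; on a flatter curve
it may be positive, but its order `z^(b-2-γ)` is below that of the tilt because `b < s`. -/
lemma decaying_bdryMain {p t β k γ s B ς a b : ℝ} (hp : 0 < p) (hγ : 0 < γ) (hk : k < β)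
    (hs : s < β) (hB : |B| ≤ 1) (hς : |ς| = 1) (ha : 0 < a)
    (hb : b = β ∨ b < s ∧ B * ς = 1) :
    ∀ᶠ z in atTop, (decaying p t k γ s B).bdryMain ς a b z ≤ -(p / 2) * z ^ (-γ - 2 + s) := by
  set V := decaying p t k γ s B
  have hpm2 : p * p ^ (-2 - γ) = p ^ (-γ - 1) := by
    nth_rw 1 [← Real.rpow_one p]
    rw [← Real.rpow_add hp]; ring_nf
  have key : ∀ z : ℝ, 0 < z → V.bdryMain ς a b z =
      a * (γ * (k - b) * p ^ (-γ - 1)) * z ^ (b - 2 - γ) - B * ς * p * z ^ (-γ - 2 + s) := by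
    intro z hz
    rw [V.bdryMain_eq hp ς a b hz]
    simp only [V, decaying]
    rw [← sub_eq_add_neg]
    linear_combination a * γ * k * z ^ (b - 2 - γ) * hpm2
  rcases hb with hb | ⟨hbs, hb⟩
  · have hkb : 0 < b - k := by linarith
    have hv := eventually_mul_rpow_le (by linarith : -γ - 2 + s < b - 2 - γ) (2 * p)
      (by positivity : 0 < a * (γ * (b - k) * p ^ (-γ - 1)))
    filter_upwards [hv, eventually_gt_atTop 0] with z hz hz0
    rw [key z hz0]
    have hY : 0 < z ^ (-γ - 2 + s) := Real.rpow_pos_of_pos hz0 _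
    have hBς : -(B * ς) ≤ 1 := by
      have : |B * ς| ≤ 1 := by rw [abs_mul, hς, mul_one]; exact hB
      linarith [neg_abs_le (B * ς)]
    have := mul_le_mul_of_nonneg_right hBς (by positivity : 0 ≤ p * z ^ (-γ - 2 + s))
    have : 0 < p * z ^ (-γ - 2 + s) := by positivity
    linarith
  · have hv := eventually_mul_rpow_le (by linarith : b - 2 - γ < -γ - 2 + s)
      (a * (γ * (k - b) * p ^ (-γ - 1))) (by positivity : 0 < p / 2)
    filter_upwards [hv, eventually_gt_atTop 0] with z hz hz0
    rw [key z hz0, hb]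
    linarith

/-- At order `z^(-2)` the gain is proportional to `v - β σ`, and at order `z^(-2-δ)` to `(1 + δ) v -
(1 + δ/2) β σ`. The overshoot `1 + δ/2` used at the boundary is smaller than `1 + δ`, so the second
gain survives when `v = β σ`, the critical case. -/
lemma logarithmic_interior {p t β δ s B v σ : ℝ} (hp : 0 < p) (hβ : 0 < β) (hδ : 0 < δ)
    (hσ : 0 < σ) (hv : β * σ ≤ v) : ∃ c₀ c₁ : ℝ, 0 ≤ c₀ ∧ 0 < c₁ ∧ (β * σ < v → 0 < c₀) ∧
      ∀ z : ℝ, 0 < z → (logarithmic p t β δ s B).radial₂ (p * z) * v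
        + (logarithmic p t β δ s B).transverse z * σ = -c₀ * z ^ (-2 : ℝ) - c₁ * z ^ (-2 - δ) := by
  have h1 := Real.rpow_pos_of_pos hp (-2)
  have h2 := Real.rpow_pos_of_pos hp (-2 - δ)
  have hβσ : 0 < β * σ := by positivity
  refine ⟨(v - β * σ) * p ^ (-2 : ℝ) / 2,
    δ * ((1 + δ) * v - (1 + δ / 2) * (β * σ)) * p ^ (-2 - δ) / 2, ?_, ?_, ?_, fun z hz => ?_⟩
  · have : 0 ≤ v - β * σ := by linarith
    positivity
  · have : 0 < (1 + δ) * v - (1 + δ / 2) * (β * σ) := by nlinarith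
    positivity
  · intro h
    have : 0 < v - β * σ := by linarith
    positivity
  · have := (logarithmic p t β δ s B).radial₂_eq hp hz
    change (logarithmic p t β δ s B).radial₂ (p * z) = _ at this
    rw [this]
    simp only [logarithmic, transverse]
    rw [show -δ - 2 = -2 - δ by ring, zero_sub]
    ring

/-- For `γ > 0` the right side is negative when `k σ > (γ + 1) v`; with `v = β_c σ` this allows any
`k > β_c` once `γ` is small. -/
lemma decaying_interior {p t k γ s B v σ : ℝ} (hp : 0 < p) {z : ℝ} (hz : 0 < z) :
    (decaying p t k γ s B).radial₂ (p * z) * v + (decaying p t k γ s B).transverse z * σ =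
      -(γ / 2 * (k * σ - (γ + 1) * v) * p ^ (-2 - γ)) * z ^ (-γ - 2) := by
  have := (decaying p t k γ s B).radial₂_eq hp hz
  change (decaying p t k γ s B).radial₂ (p * z) = _ at this
  rw [this]
  simp only [decaying, transverse]
  rw [show -γ - 2 = -2 - γ by ring]
  ring

/-- Uniform positivity of the decaying potential. -/
lemma decaying_lower {p t k γ s B β A : ℝ} (h : (decaying p t k γ s B).Admissible β) :
    ∃ c : ℝ, 0 < c ∧ ∀ᶠ z in atTop, ∀ w : ℝ, |w| ≤ A * z ^ β →
      c * z ^ (-γ) ≤ (decaying p t k γ s B).val z w := by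
  set V := decaying p t k γ s B
  obtain ⟨Z, hZ1, hZ⟩ := exists_cone h.β_lt A h.p_pos
  have hβ := h.β_lt
  have hsβ : s ≤ β := h.s_le
  have hγ : -γ ≤ 0 := h.e_le
  set c := (2 : ℝ) ^ (-γ) / 4
  have hc : 0 < c := by positivity
  have hv1 := eventually_mul_rpow_le (by linarith : -γ - 2 + 2 * β < -γ) (|V.A₀| * A ^ 2) hc
  have hv2 := eventually_mul_rpow_le (by linarith : -γ - 2 + s + β < -γ) (|B| * A) hc
  refine ⟨c, hc, ?_⟩
  filter_upwards [hv1, hv2, eventually_ge_atTop Z] with z hv1 hv2 hz w hw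
  have hz1 : 1 ≤ z := hZ1.trans hz
  have hz0 : 0 < z := by linarith
  obtain ⟨hl1, hl2⟩ := h.lin_bounds hz0 (hZ z w hz hw)
  have hp := h.p_pos
  have hl0 : 0 < V.lin z w := lt_of_lt_of_le (by positivity) hl1
  have k1 : 4 * c * z ^ (-γ) ≤ V.lin z w ^ (-γ) := by
    calc 4 * c * z ^ (-γ) = (2 * z) ^ (-γ) := by
          rw [Real.mul_rpow zero_le_two hz0.le]; simp only [c]; ring
      _ ≤ _ := Real.rpow_le_rpow_of_nonpos hl0 hl2 hγ
  have k2 : |V.A₀ * (w ^ 2 * z ^ (-γ - 2))| ≤ |V.A₀| * A ^ 2 * z ^ (-γ - 2 + 2 * β) := by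
    rw [abs_mul, abs_mul, abs_pow, abs_of_pos (Real.rpow_pos_of_pos hz0 _)]
    calc _ ≤ |V.A₀| * ((A * z ^ β) ^ 2 * z ^ (-γ - 2)) := by gcongr
      _ = |V.A₀| * A ^ 2 * (z ^ (-γ - 2) * (z ^ β * z ^ β)) := by ring
      _ = _ := by rw [← Real.rpow_add hz0, ← Real.rpow_add hz0, two_mul]
  have k3 : |B * (w * z ^ (-γ - 2 + s))| ≤ |B| * A * z ^ (-γ - 2 + s + β) := by
    rw [abs_mul, abs_mul, abs_of_pos (Real.rpow_pos_of_pos hz0 (-γ - 2 + s))]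
    calc _ ≤ |B| * ((A * z ^ β) * z ^ (-γ - 2 + s)) := by gcongr
      _ = _ := by rw [Real.rpow_add hz0 _ β]; ring
  have e : V.val z w = V.lin z w ^ (-γ) + V.A₀ * (w ^ 2 * z ^ (-γ - 2))
      + B * (w * z ^ (-γ - 2 + s)) := by
    simp only [val, V, decaying]; ring
  rw [e]
  have := neg_abs_le (V.A₀ * (w ^ 2 * z ^ (-γ - 2)))
  have := neg_abs_le (B * (w * z ^ (-γ - 2 + s)))
  have := Real.rpow_pos_of_pos hz0 (-γ)
  nlinarith

end Potential

/-! ### Recurrence and transience for sublinear curves -/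

section

open Potential

variable {S DB : Set Plane} {κ : Kernel S S} {ap am βp βm α : ℝ} {Q : Matrix (Fin 2) (Fin 2) ℝ}

/-- The interior assumptions at the rate `r^{-ω}`. -/
def InteriorRate (κ : Kernel S S) (DB : Set Plane) (Q : Matrix (Fin 2) (Fin 2) ℝ) (ω : ℝ) : Prop :=
  ∀ ε : ℝ, 0 < ε → ∀ᶠ r : ℝ in atTop, ∀ x : S, ‖(x : Plane)‖ = r → (x : Plane) ∉ DB →
    ‖meanIncrement κ x‖ ≤ ε * r ^ (-1 - ω) ∧ ∀ i j, |(secondMoment κ x - Q) i j| ≤ ε * r ^ (-ω)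

lemma interiorRate_zero (hD : ZeroDrift κ DB) (hC : CovarianceLimit κ DB Q) :
    InteriorRate κ DB Q 0 := by
  intro ε hε
  obtain ⟨R₁, -, h1⟩ := hD ε hε
  obtain ⟨R₂, h2⟩ := hC ε hε
  filter_upwards [eventually_ge_atTop R₁, eventually_ge_atTop R₂] with r hr1 hr2 x hx hxD
  rw [sub_zero, neg_zero, Real.rpow_zero, mul_one, Real.rpow_neg_one]
  exact ⟨h1 r hr1 x hxD hx.ge, fun i j =>
    (abs_apply_le_matOpNorm _ i j).trans (h2 x hxD (by rw [hx]; exact hr2))⟩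

/-- Giving up part of the exponent turns a bound `O(r^(-ε))` into an arbitrarily small multiple of
`r^(-ω)`, the same form as the basic assumptions with `ω = 0`. -/
lemma exists_interiorRate (hD : ZeroDriftPlus κ DB) (hC : CovarianceLimitPlus κ DB Q) :
    ∃ ε : ℝ, 0 < ε ∧ ∀ ω : ℝ, ω < ε → InteriorRate κ DB Q ω := by
  obtain ⟨ε, K, hε, -, h⟩ := interior_plus hD hC
  refine ⟨ε, hε, fun ω hω ε' hε' => ?_⟩
  filter_upwards [h, eventually_mul_rpow_le (by linarith : -1 - ε < -1 - ω) K hε',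
    eventually_mul_rpow_le (by linarith : -ε < -ω) K hε'] with r h h1 h2 x hx hxD
  obtain ⟨k1, k2⟩ := h x hx hxD
  exact ⟨k1.trans h1, fun i j => (k2 i j).trans h2⟩

/-- Recurrence in a domain with sublinear boundary curves. -/
theorem recurrent_of_sublinear [IsMarkovKernel κ] (hap : 0 < ap) (ham : 0 < am) (hβp : 0 ≤ βp)
    (hβm : 0 ≤ βm) (hp1 : βp < 1) (hm1 : βm < 1) (hβ : 0 < max βp βm)
    (hS : S ⊆ domain ap am βp βm) (hnear : BoundaryNearCurves ap am βp βm S DB)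
    (hα : |α| < Real.pi / 2) (hQ : Q.PosDef) (hN : NonConfinement κ) (hM : BoundedMoments κ)
    (hRp : ReflectionUpper κ DB ap βp α) (hRm : ReflectionLower κ DB am βm (-α))
    (hrate : max βp βm < betaC Q α ∧ InteriorRate κ DB Q 0 ∨ max βp βm = betaC Q α ∧
      ∃ ε : ℝ, 0 < ε ∧ ∀ ω : ℝ, ω < ε → InteriorRate κ DB Q ω) (x₀ : S) :
    Recurrent κ x₀ := by
  obtain ⟨q, M, hq, hq3, -, hM⟩ := exists_momentBound hM
  have hlt : max βp βm < 1 := max_lt hp1 hm1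
  obtain ⟨s, B, hs0, hsβ, hsβ2, hB, hbp, hbm⟩ := exists_tilt hp1 hm1 hβ
  obtain ⟨hσ, hv, -⟩ := betaC_mul hQ α
  have hcos : 0 < Real.cos α := Real.cos_pos_of_mem_Ioo (abs_lt.1 hα)
  set β := max βp βm
  set η := min (1 - β) (q - 2)
  have hη : 0 < η := lt_min (by linarith) (by linarith)
  -- Below the critical exponent the order `z^(-2)` already has a strictly negative coefficient, so
  -- `ω = 0` suffices. At the critical exponent only `z^(-2-δ)` is left, so the errors must be small
  -- at the rate `ω = δ`.
  obtain ⟨δ, ω, hδ, hδη, hδs, hω0, hωη, hωδ, hrate⟩ : ∃ δ ω : ℝ, 0 < δ ∧ δ < η ∧ δ < β - s ∧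
      0 ≤ ω ∧ ω < η ∧ (ω = 0 ∧ β < betaC Q α ∨ ω = δ ∧ β = betaC Q α) ∧
      InteriorRate κ DB Q ω := by
    rcases hrate with ⟨h1, h2⟩ | ⟨h1, ε, hε, h2⟩
    · obtain ⟨δ, h3, h4⟩ := exists_between (lt_min hη (by linarith : 0 < β - s))
      exact ⟨δ, 0, h3, h4.trans_le (min_le_left _ _), h4.trans_le (min_le_right _ _), le_rfl, hη,
        Or.inl ⟨rfl, h1⟩, h2⟩
    · obtain ⟨δ, h3, h4⟩ := exists_between (lt_min (lt_min hη (by linarith : 0 < β - s)) hε)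
      simp only [lt_min_iff] at h4
      obtain ⟨⟨h4, h5⟩, h6⟩ := h4
      exact ⟨δ, δ, h3, by simpa [η] using h4, h5, h3.le, by simpa [η] using h4,
        Or.inr ⟨rfl, h1⟩, h2 δ h6⟩
  set V := logarithmic (Real.cos α) (Real.sin α) β δ s B
  have hV : V.Admissible β :=
    { p_pos := hcos
      p_le := Real.cos_le_one α
      t_le := Real.abs_sin_le_one α
      c₀_eq := Or.inr rfl
      a_le := neg_nonpos.2 hδ.le
      e_le := le_rfl
      s_pos := hs0
      s_le := hsβ.le
      β_lt := hlt }
  have hβv : β * Q 1 1 ≤ betaC Q α * Q 1 1 := by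
    gcongr
    rcases hωδ with h | h
    · exact h.2.le
    · exact h.2.le
  obtain ⟨c₀, c₁, hc₀, hc₁, hc₀', hint⟩ :=
    logarithmic_interior (t := Real.sin α) (s := s) (B := B) hcos hβ hδ hσ hβv
  obtain ⟨c₂, hc₂, hint⟩ : ∃ c₂ : ℝ, 0 < c₂ ∧ ∀ᶠ z in atTop, V.radial₂ (V.p * z) *
        (V.p ^ 2 * Q 0 0 + 2 * V.p * V.t * Q 0 1 + V.t ^ 2 * Q 1 1) + V.transverse z * Q 1 1 ≤
      -c₂ * z ^ (V.e - 2 - ω) := by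
    have hi : ∀ z : ℝ, 0 < z → V.radial₂ (V.p * z) *
        (V.p ^ 2 * Q 0 0 + 2 * V.p * V.t * Q 0 1 + V.t ^ 2 * Q 1 1) + V.transverse z * Q 1 1 =
        -c₀ * z ^ (-2 : ℝ) - c₁ * z ^ (-2 - δ) := by
      intro z hz
      rw [← hint z hz, ← hv]
      rfl
    have he : V.e = 0 := rfl
    rcases hωδ with ⟨h1, h2⟩ | ⟨h1, -⟩
    · refine ⟨c₀, hc₀' (by gcongr), ?_⟩
      filter_upwards [eventually_gt_atTop 0] with z hz
      rw [hi z hz, he, h1, zero_sub, sub_zero]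
      have := mul_pos hc₁ (Real.rpow_pos_of_pos hz (-2 - δ))
      linarith
    · refine ⟨c₁, hc₁, ?_⟩
      filter_upwards [eventually_gt_atTop 0] with z hz
      rw [hi z hz, he, h1, zero_sub]
      have := mul_nonneg hc₀ (Real.rpow_pos_of_pos hz (-2)).le
      linarith
  have hup := logarithmic_bdryMain (t := Real.sin α) hcos hβ hδ hδs hB abs_one hap
    (le_max_left βp βm) hbp
  have hlow := logarithmic_bdryMain (t := Real.sin α) hcos hβ hδ hδs hB
    (by norm_num : |(-1 : ℝ)| = 1) ham (le_max_right βp βm) hbm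
  set c := min (Real.cos α) c₂
  have hc : 0 < c := lt_min hcos hc₂
  have mono : ∀ (c' d : ℝ), c ≤ c' → ∀ z : ℝ, 0 < z → -c' * z ^ d ≤ -c * z ^ d := by
    intro c' d hcc z hz
    have := Real.rpow_pos_of_pos hz d
    exact mul_le_mul_of_nonneg_right (by linarith) this.le
  obtain ⟨C, hC, hval⟩ := hV.exists_val_sub_le
  obtain ⟨Z, hZ1, hZ⟩ := exists_cone hlt (max ap am) hcos
  have hSA : ∀ x : S, 1 ≤ (x : Plane) 0 →
      |(x : Plane) 1| ≤ max ap am * (x : Plane) 0 ^ β :=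
    fun x hx => abs_le_of_mem_domain hap (hS x.2) hx
  have hlog : ∀ x : S, Z ≤ (x : Plane) 0 →
      |V.val ((x : Plane) 0) ((x : Plane) 1) - Real.log ((x : Plane) 0)| ≤ C := by
    intro x hx
    have hx1 := hZ1.trans hx
    have := hval _ _ hx1 (hZ _ _ hx (hSA x hx1))
    have he : V.e = 0 := rfl
    have hc₀ : V.c₀ = 1 := rfl
    rwa [he, hc₀, one_mul, Real.rpow_zero, mul_one] at this
  -- The potential differs from `log x₁` by at most `C`, so it is nonnegative once `x₁ ≥ exp C`.
  set R₀ := max Z (Real.exp C)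
  have hR₀ : ∀ x : S, R₀ ≤ (x : Plane) 0 → 0 ≤ V.val ((x : Plane) 0) ((x : Plane) 1) := by
    intro x hx
    have h1 := hlog x ((le_max_left _ _).trans hx)
    have h2 : C ≤ Real.log ((x : Plane) 0) := by
      rw [Real.le_log_iff_exp_le (by linarith [le_max_left Z (Real.exp C)])]
      exact (le_max_right _ _).trans hx
    linarith [(abs_le.1 h1).1]
  have hmeas0 : Measurable fun x : S => (x : Plane) 0 := by fun_prop
  have hmeas1 : Measurable fun x : S => (x : Plane) 1 := by fun_prop
  set f : S → ℝ := fun x =>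
    if R₀ ≤ (x : Plane) 0 then V.val ((x : Plane) 0) ((x : Plane) 1) else 0
  have hf1 : ∀ x : S, R₀ ≤ (x : Plane) 0 → f x = V.val ((x : Plane) 0) ((x : Plane) 1) :=
    fun x hx => if_pos hx
  have hf2 : ∀ x : S, ¬ R₀ ≤ (x : Plane) 0 → f x = 0 := fun x hx => if_neg hx
  have hf0 : ∀ x, 0 ≤ f x := by
    intro x
    by_cases hx : R₀ ≤ (x : Plane) 0
    · rw [hf1 x hx]; exact hR₀ x hx
    · rw [hf2 x hx]
  have hfm : Measurable f := by
    refine Measurable.ite (measurableSet_le measurable_const hmeas0) ?_ measurable_const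
    simp only [val, lin]
    fun_prop
  have hθ : 0 < V.p / 8 := div_pos hcos (by norm_num)
  have hθ1 : V.p / 8 ≤ 1 := by linarith [hV.p_le]
  obtain ⟨R, hR⟩ := hV.superharmonic_outside_ball (f := f) (R₀ := R₀) (Z₀ := R₀)
    (C₀ := (1 + 2 * C) * (V.p / 8) ^ (-q)) (c := c) hap ham hβp hβm hS hnear hRp hRm rfl rfl hsβ2
    hq hq3 hη.le (min_le_left _ _)
    (by have : V.e = 0 := rfl
        rw [this]; linarith [min_le_right (1 - β) (q - 2)])
    hM (mul_nonneg (by linarith) (Real.rpow_nonneg hθ.le _)) hω0 hωη hrate hc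
    (by filter_upwards [hup, eventually_gt_atTop 0] with z h hz
        exact h.trans (mono _ _ (min_le_left _ _) z hz))
    (by filter_upwards [hlow, eventually_gt_atTop 0] with z h hz
        exact h.trans (mono _ _ (min_le_left _ _) z hz))
    (by filter_upwards [hint, eventually_gt_atTop 0] with z h hz
        exact h.trans (mono _ _ (min_le_right _ _) z hz))
    hf0 hf1 (by
      intro x y hx hd
      have hZx := (le_max_left Z (Real.exp C)).trans hx
      have hx0 : 0 < (x : Plane) 0 := by linarith
      set d := ‖(y : Plane) - (x : Plane)‖
      obtain ⟨l1, l2, -⟩ := large_jump hq hθ hθ1 ((le_div_iff₀ hx0).2 hd)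
      set τ := d / (x : Plane) 0
      have hτ0 : 0 ≤ τ := by positivity
      have hK : 0 ≤ (1 + 2 * C) * (V.p / 8) ^ (-q) * τ ^ q := by
        have : 0 ≤ (V.p / 8) ^ (-q) := Real.rpow_nonneg hθ.le _
        positivity
      -- A jump of relative size `τ` raises `log x₁` by at most `τ`. For large jumps this and the
      -- constant `2 C` are absorbed by the `q`-th power of `τ`.
      by_cases hy : R₀ ≤ (y : Plane) 0
      · have hZy := (le_max_left Z (Real.exp C)).trans hy
        have hy0 : 0 < (y : Plane) 0 := by linarith
        have k1 := (abs_le.1 (hlog x hZx)).1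
        have k2 := (abs_le.1 (hlog y hZy)).2
        rw [hf1 x hx, hf1 y hy]
        have hyx : (y : Plane) 0 ≤ (x : Plane) 0 * (1 + τ) := by
          have k3 := (le_abs_self _).trans (abs_apply_le_norm ((y : Plane) - (x : Plane)) 0)
          rw [PiLp.sub_apply] at k3
          have : (x : Plane) 0 * τ = d := by simp only [τ]; field_simp
          rw [mul_add, mul_one, this]
          linarith
        have k4 : Real.log ((y : Plane) 0) ≤ Real.log ((x : Plane) 0) + τ := by
          refine (Real.log_le_log hy0 hyx).trans ?_
          rw [Real.log_mul hx0.ne' (by positivity)]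
          have := Real.log_le_sub_one_of_pos (by positivity : 0 < 1 + τ)
          linarith
        have k5 := mul_le_mul_of_nonneg_left l1 (by linarith : 0 ≤ 2 * C)
        linarith
      · rw [hf2 y hy]
        exact add_nonneg (hf0 x) hK)
  refine recurrent_of_superharmonic κ hN x₀ hfm (fun K => ?_) R hR
  obtain ⟨r, hr⟩ := exists_le_of_norm_gt hap ham hβp hβm (max R₀ (Real.exp (K + C)))
  refine ⟨r + 1, fun y hy => ?_⟩
  have h1 := hr y (hS y.2) (by linarith)
  have h2 := (le_max_left _ _).trans h1
  have hZy := (le_max_left Z (Real.exp C)).trans h2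
  rw [hf1 y h2]
  have h3 : K + C ≤ Real.log ((y : Plane) 0) := by
    rw [Real.le_log_iff_exp_le (by linarith)]
    exact (le_max_right _ _).trans h1
  linarith [(abs_le.1 (hlog y hZy)).1]

/-- Transience in a domain with sublinear boundary curves. -/
theorem transient_of_sublinear [IsMarkovKernel κ] (hap : 0 < ap) (ham : 0 < am) (hβp : 0 ≤ βp)
    (hβm : 0 ≤ βm) (hp1 : βp < 1) (hm1 : βm < 1)
    (hS : S ⊆ domain ap am βp βm) (hnear : BoundaryNearCurves ap am βp βm S DB)
    (hα : |α| < Real.pi / 2) (hQ : Q.PosDef) (hN : NonConfinement κ) (hM : BoundedMoments κ)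
    (hRp : ReflectionUpper κ DB ap βp α) (hRm : ReflectionLower κ DB am βm (-α))
    (hβc : betaC Q α < max βp βm) (hrate : InteriorRate κ DB Q 0) (x₀ : S) :
    Transient κ x₀ := by
  obtain ⟨q, M, hq, hq3, -, hM⟩ := exists_momentBound hM
  have hlt : max βp βm < 1 := max_lt hp1 hm1
  obtain ⟨hσ, hv, hβc0⟩ := betaC_mul hQ α
  obtain ⟨s, B, hs0, hsβ, hsβ2, hB, hbp, hbm⟩ := exists_tilt hp1 hm1 (hβc0.trans hβc)
  have hcos : 0 < Real.cos α := Real.cos_pos_of_mem_Ioo (abs_lt.1 hα)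
  set β := max βp βm
  -- The moment budget `q - 2` is split in two, half for `η` and half for `γ`, since `2 + η + γ ≤ q`
  -- is required.
  set η := min (1 - β) ((q - 2) / 2)
  have hη : 0 < η := lt_min (by linarith) (by linarith)
  obtain ⟨k, hk1, hk2⟩ := exists_between hβc
  -- The second bound on `γ` says `(γ + 1) β_c < k`, the condition for a negative interior drift.
  obtain ⟨γ, hγ, hγ2⟩ := exists_between (lt_min (by linarith : 0 < (q - 2) / 2)
    (div_pos (sub_pos.2 hk1) hβc0))
  obtain ⟨hγq, hγk⟩ := lt_min_iff.1 hγ2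
  rw [lt_div_iff₀ hβc0] at hγk
  set V := decaying (Real.cos α) (Real.sin α) k γ s B
  have hV : V.Admissible β :=
    { p_pos := hcos
      p_le := Real.cos_le_one α
      t_le := Real.abs_sin_le_one α
      c₀_eq := Or.inl rfl
      a_le := le_rfl
      e_le := neg_nonpos.2 hγ.le
      s_pos := hs0
      s_le := hsβ.le
      β_lt := hlt }
  have he : V.e = -γ := rfl
  have hc₀ : V.c₀ = 0 := rfl
  set c₂ := γ / 2 * (k * Q 1 1 - (γ + 1) * (betaC Q α * Q 1 1)) * Real.cos α ^ (-2 - γ)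
  have hc₂ : 0 < c₂ := by
    have : 0 < k * Q 1 1 - (γ + 1) * (betaC Q α * Q 1 1) := by
      have := mul_pos (by linarith : 0 < k - (γ + 1) * betaC Q α) hσ
      linarith
    positivity
  have hint : ∀ᶠ z in atTop, V.radial₂ (V.p * z) *
        (V.p ^ 2 * Q 0 0 + 2 * V.p * V.t * Q 0 1 + V.t ^ 2 * Q 1 1) + V.transverse z * Q 1 1 ≤
      -c₂ * z ^ (V.e - 2 - 0) := by
    filter_upwards [eventually_gt_atTop 0] with z hz
    have h := decaying_interior (t := Real.sin α) (s := s) (B := B) (k := k) (γ := γ)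
      (v := betaC Q α * Q 1 1) (σ := Q 1 1) hcos hz
    rw [← hv] at h
    rw [sub_zero, he]
    refine le_of_eq (h.trans ?_)
    rw [hv]
  have hup := decaying_bdryMain (t := Real.sin α) hcos hγ hk2 hsβ hB abs_one hap hbp
  have hlow := decaying_bdryMain (t := Real.sin α) hcos hγ hk2 hsβ hB
    (by norm_num : |(-1 : ℝ)| = 1) ham hbm
  set c := min (Real.cos α / 2) c₂
  have hc : 0 < c := lt_min (half_pos hcos) hc₂
  have mono : ∀ (c' d : ℝ), c ≤ c' → ∀ z : ℝ, 0 < z → -c' * z ^ d ≤ -c * z ^ d := by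
    intro c' d hcc z hz
    have := Real.rpow_pos_of_pos hz d
    exact mul_le_mul_of_nonneg_right (by linarith) this.le
  have hA : 0 ≤ max ap am := hap.le.trans (le_max_left _ _)
  obtain ⟨C, hC, hval⟩ := hV.exists_val_sub_le
  obtain ⟨Z, hZ1, hZ⟩ := exists_cone hlt (max ap am) hcos
  obtain ⟨c₃, hc₃, hlower⟩ := decaying_lower (A := max ap am) hV
  have hsmall := eventually_mul_rpow_le (neg_lt_zero.2 hγ) C one_pos
  obtain ⟨Z', hZ'⟩ := eventually_atTop.1 (hlower.and hsmall)
  have hSA : ∀ x : S, 1 ≤ (x : Plane) 0 →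
      |(x : Plane) 1| ≤ max ap am * (x : Plane) 0 ^ β :=
    fun x hx => abs_le_of_mem_domain hap (hS x.2) hx
  set R₀ := max Z Z'
  have hb : ∀ x : S, R₀ ≤ (x : Plane) 0 → 0 < (x : Plane) 0 ∧
      c₃ * (x : Plane) 0 ^ (-γ) ≤ V.val ((x : Plane) 0) ((x : Plane) 1) ∧
      V.val ((x : Plane) 0) ((x : Plane) 1) ≤ C * (x : Plane) 0 ^ (-γ) ∧
      C * (x : Plane) 0 ^ (-γ) ≤ 1 := by
    intro x hx
    have hxZ := (le_max_left _ _).trans hx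
    have hx1 := hZ1.trans hxZ
    obtain ⟨h1, h2⟩ := hZ' _ ((le_max_right _ _).trans hx)
    have h3 := hval _ _ hx1 (hZ _ _ hxZ (hSA x hx1))
    rw [hc₀, he, zero_mul, sub_zero] at h3
    rw [Real.rpow_zero, mul_one] at h2
    exact ⟨by linarith, h1 _ (hSA x hx1), (abs_le.1 h3).2, h2⟩
  have hmeas0 : Measurable fun x : S => (x : Plane) 0 := by fun_prop
  have hmeas1 : Measurable fun x : S => (x : Plane) 1 := by fun_prop
  -- The extension by `1` keeps `f` between `0` and `1`, because the potential is at most `1` beyond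
  -- `R₀`. Large jumps then raise `f` by at most `1`, and `f` stays bounded below on balls.
  set f : S → ℝ := fun x =>
    if R₀ ≤ (x : Plane) 0 then V.val ((x : Plane) 0) ((x : Plane) 1) else 1
  have hf1 : ∀ x : S, R₀ ≤ (x : Plane) 0 → f x = V.val ((x : Plane) 0) ((x : Plane) 1) :=
    fun x hx => if_pos hx
  have hf2 : ∀ x : S, ¬ R₀ ≤ (x : Plane) 0 → f x = 1 := fun x hx => if_neg hx
  have hfm : Measurable f := by
    refine Measurable.ite (measurableSet_le measurable_const hmeas0) ?_ measurable_const
    simp only [val, lin]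
    fun_prop
  have hf01 : ∀ x, 0 ≤ f x ∧ f x ≤ 1 := by
    intro x
    by_cases hx : R₀ ≤ (x : Plane) 0
    · obtain ⟨h0, h1, h2, h3⟩ := hb x hx
      rw [hf1 x hx]
      have := mul_pos hc₃ (Real.rpow_pos_of_pos h0 (-γ))
      constructor <;> linarith
    · rw [hf2 x hx]; norm_num
  have hθ : 0 < V.p / 8 := div_pos hcos (by norm_num)
  have hθ1 : V.p / 8 ≤ 1 := by linarith [hV.p_le]
  obtain ⟨R, hR⟩ := hV.superharmonic_outside_ball (f := f) (R₀ := R₀) (Z₀ := R₀)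
    (C₀ := (V.p / 8) ^ (-q)) (c := c) hap ham hβp hβm hS hnear hRp hRm rfl rfl hsβ2
    hq hq3 hη.le (min_le_left _ _)
    (by rw [he]; linarith [min_le_right (1 - β) ((q - 2) / 2)])
    hM (Real.rpow_nonneg hθ.le _) le_rfl hη hrate hc
    (by filter_upwards [hup, eventually_gt_atTop 0] with z h hz
        exact h.trans (mono _ _ (min_le_left _ _) z hz))
    (by filter_upwards [hlow, eventually_gt_atTop 0] with z h hz
        exact h.trans (mono _ _ (min_le_left _ _) z hz))
    (by filter_upwards [hint, eventually_gt_atTop 0] with z h hz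
        exact h.trans (mono _ _ (min_le_right _ _) z hz))
    (fun y => (hf01 y).1) hf1 (by
      intro x y hx hd
      have hx0 := (hb x hx).1
      obtain ⟨l1, -, -⟩ := large_jump hq hθ hθ1 ((le_div_iff₀ hx0).2 hd)
      linarith [(hf01 x).1, (hf01 y).2])
  refine transient_of_superharmonic κ hN x₀ hfm (fun r => ?_) (fun ε hε => ?_) R hR
  · have hr : 0 < |r| + 1 := by positivity
    refine ⟨min 1 (c₃ * (|r| + 1) ^ (-γ)), lt_min one_pos (by positivity), fun y hy => ?_⟩
    by_cases hy0 : R₀ ≤ (y : Plane) 0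
    · rw [hf1 y hy0]
      obtain ⟨h0, h1, -, -⟩ := hb y hy0
      have h2 : (y : Plane) 0 ≤ |r| + 1 := by
        linarith [(le_abs_self _).trans (abs_apply_le_norm (y : Plane) 0), le_abs_self r]
      have h3 := Real.rpow_le_rpow_of_nonpos h0 h2 (neg_nonpos.2 hγ.le)
      exact (min_le_right _ _).trans (le_trans (by gcongr) h1)
    · rw [hf2 y hy0]; exact min_le_left _ _
  · obtain ⟨Z₁, hZ₁⟩ := eventually_atTop.1 (eventually_mul_rpow_le (neg_lt_zero.2 hγ) C hε)
    obtain ⟨r, hr⟩ := exists_le_of_norm_gt hap ham hβp hβm (max R₀ Z₁)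
    refine ⟨r + 1, fun y hy => ?_⟩
    have h1 := hr y (hS y.2) (by linarith)
    have h2 := (le_max_left _ _).trans h1
    have h3 := hZ₁ _ ((le_max_right _ _).trans h1)
    rw [Real.rpow_zero, mul_one] at h3
    rw [hf1 y h2]
    exact (hb y h2).2.2.1.trans h3

end

end CurvilinearWedge

end

theorem theorem3
    (ap am βp βm : ℝ) (hap : 0 < ap) (ham : 0 < am) (hβp : 0 ≤ βp) (hβm : 0 ≤ βm)
    (DB : Set CurvilinearWedge.Plane)
    (hDB : CurvilinearWedge.IsBoundaryPart (CurvilinearWedge.domain ap am βp βm) DB)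
    (S : Set CurvilinearWedge.Plane) (hS : S ⊆ CurvilinearWedge.domain ap am βp βm)
    (κ : ProbabilityTheory.Kernel S S) [ProbabilityTheory.IsMarkovKernel κ] (x₀ : S)
    (α : ℝ) (hα : |α| < Real.pi / 2)
    (Cov : Matrix (Fin 2) (Fin 2) ℝ) (hCov : Cov.PosDef)
    (hN : CurvilinearWedge.NonConfinement κ)
    (hM : CurvilinearWedge.BoundedMoments κ)
    (hD : CurvilinearWedge.ZeroDrift κ DB)
    (hRp : CurvilinearWedge.ReflectionUpper κ DB ap βp α)
    (hRm : CurvilinearWedge.ReflectionLower κ DB am βm (-α))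
    (hC : CurvilinearWedge.CovarianceLimit κ DB Cov) :
    -- (a): both exponents in `[0, 1)`
    (βp < 1 → βm < 1 →
      (βp = 0 ∨ βm = 0 → CurvilinearWedge.BoundaryNearCurves ap am βp βm S DB) →
      -- (i)
      (0 < max βp βm → max βp βm < CurvilinearWedge.betaC Cov α →
        CurvilinearWedge.Recurrent κ x₀) ∧
      -- (ii)
      (CurvilinearWedge.betaC Cov α < max βp βm → CurvilinearWedge.Transient κ x₀) ∧
      -- (iii)
      (CurvilinearWedge.ZeroDriftPlus κ DB → CurvilinearWedge.CovarianceLimitPlus κ DB Cov →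
        max βp βm = CurvilinearWedge.betaC Cov α → CurvilinearWedge.Recurrent κ x₀)) ∧
    -- (b): both exponents greater than `1`
    (CurvilinearWedge.ZeroDriftPlus κ DB → CurvilinearWedge.CovarianceLimitPlus κ DB Cov →
      1 < βp → 1 < βm → CurvilinearWedge.Recurrent κ x₀) := by
  refine ⟨fun hp1 hm1 hnear0 => ?_, fun hDp hCp hp hm =>
    CurvilinearWedge.recurrent_of_superlinear hap ham hp hm hDB hS x₀ hα hCov hN hM hRp hRm
      hDp hCp⟩
  have hnear : CurvilinearWedge.BoundaryNearCurves ap am βp βm S DB := by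
    by_cases h0 : βp = 0 ∨ βm = 0
    · exact hnear0 h0
    · push Not at h0
      exact CurvilinearWedge.boundaryNearCurves_of_pos hap ham (hβp.lt_of_ne' h0.1)
        (hβm.lt_of_ne' h0.2) hp1 hm1 hDB
  refine ⟨fun hβ hβc => ?_, fun hβc => ?_, fun hDp hCp hβc => ?_⟩
  · exact CurvilinearWedge.recurrent_of_sublinear hap ham hβp hβm hp1 hm1 hβ hS hnear hα hCov hN
      hM hRp hRm (Or.inl ⟨hβc, CurvilinearWedge.interiorRate_zero hD hC⟩) x₀
  · exact CurvilinearWedge.transient_of_sublinear hap ham hβp hβm hp1 hm1 hS hnear hα hCov hN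
      hM hRp hRm hβc (CurvilinearWedge.interiorRate_zero hD hC) x₀
  -- In the critical case positivity of the larger exponent is automatic, because `betaC` is
  -- positive for a positive-definite covariance.
  · exact CurvilinearWedge.recurrent_of_sublinear hap ham hβp hβm hp1 hm1
      (hβc ▸ (CurvilinearWedge.betaC_mul hCov α).2.2) hS hnear hα hCov hN hM hRp hRm
      (Or.inr ⟨hβc, CurvilinearWedge.exists_interiorRate hDp hCp⟩) x₀
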